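/- Let $\mathbb S=\{j\in\mathbb H: \mathrm{Re}\,j=0,\ |j|=1\}$, $\mathbb C_j=\{u+jv:u,v\in\mathbb R\}$ for $j\in\mathbb S$, and $\mathbb{C}_j\cong\mathbb C$ via $u+jv\leftrightarrow u+iv$. Let $\mathcal X$ be a (left) quaternionic Banach space. Let $U_+=U\subset\mathbb H$ be a bounded open axially symmetric set (i.e. $u+jv\in U$ with $j\in\mathbb S$ implies $u+kv\in U$ for all $k\in\mathbb S$), let $U_-=\mathbb H\setminus\overline{U_+}$ and $\Gamma=\partial U_+$. Fix $j\in\mathbb S$, put $\Gamma_j=\Gamma\cap\mathbb C_j$, and assume that the boundary of $U_+\cap\mathbb C_j$ in $\mathbb C_j$ is a piecewise $\mathcal C^1$-contour, oriented in the usual way: it is a finite union of pairwise disjoint simple closed curves, each consisting of finitely many regular $\mathcal C^1$-arcs such that at every junction the quotient of the two one-sided tangents is not in $(-\infty,0]$, and at every interior point of an arc $U_+\cap\mathbb C_j$ lies to the left and the exterior of $U_+\cap\mathbb C_j$ to the right of the curve. A function $F$ on an axially symmetric set $K\subset\mathbb H$ with values in $\mathcal X$ is called Hölder slice continuous of order $\alpha$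 if it is bounded and $F(u+kv)=F_0(u,v)+kF_1(u,v)$ for all $k\in\mathbb S$, where $F_0(u,-v)=F_0(u,v)$, $F_1(u,-v)=-F_1(u,v)$, and $F_0,F_1$ are Hölder continuous of order $\alpha$ on $\{(u,v): u+kv\in K,\ k\in\mathbb S\}$. If $K$ has bounded complement, $F$ is called Hölder slice continuous of order $\alpha$ on $K\cup\{\infty\}$ if $F(p)$ is so on $K$ and $F(1/p)$ (with value $F(\infty)$ at $p=0$) is so on $\{p: 1/p\in K\cup\{\infty\}\}$. Let $\alpha\in(0,1)$ and let $f:\Gamma_j\to\mathcal X$ be Hölder continuous of order $\alpha$. For $p\in\mathbb H\setminus\Gamma$ let $$\hat f(p)=\frac1{2\pi}\int_{\partial(U_+\cap\mathbb C_j)}S_L^{-1}(s,p)\,ds_j\,f(s),\qquad S_L^{-1}(s,p)=-(p^2-2p\,\mathrm{Re}(s)+|s|^2)^{-1}(p-\overline s),\quad ds_j=-j\,ds,$$ be the left slice Cauchy transform of $f$, and set $\hat f_+=\hat f|_{U_+}$, $\hat f_-=-\hat f|_{U_-}$. Then: (i) $\hat f_+$ has a Hölder slice continuous extension $f_+$ of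 order $\alpha$ to $\overline{U_+}$, and $\hat f_-$ has a Hölder slice continuous extension $f_-$ of order $\alpha$ to $\overline{U_-}\cup\{\infty\}$; (ii) $f=f_++f_-$ on $\Gamma_j$. -/

import Mathlib

open Set Filter Topology MeasureTheory
open scoped NNReal

noncomputable section

namespace SliceCauchy

/-- The sphere of unit purely imaginary quaternions. -/
def imagSphere : Set (Quaternion ℝ) := {q | q.re = 0 ∧ ‖q‖ = 1}

/-- The point `x + j y` attached to `z = x + i y`; for `j ∈ imagSphere` this identifies the complex
plane with the slice `ℂ_j`. -/
def slicePt (j : Quaternion ℝ) (z : ℂ) : Quaternion ℝ := (z.re : Quaternion ℝ) + z.im • j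

/-- The slice `ℂ_j` of the quaternions. -/
def slicePlane (j : Quaternion ℝ) : Set (Quaternion ℝ) := range (slicePt j)

/-- The 2-sphere `[q] = {x₀ + j |Im q| : j ∈ imagSphere}`. -/
def sphereOf (q : Quaternion ℝ) : Set (Quaternion ℝ) :=
  {p | ∃ j ∈ imagSphere, p = (q.re : Quaternion ℝ) + ‖q.im‖ • j}

/-- `U` contains the whole sphere `[q]` of each of its points `q`. -/
def AxiallySymmetric (U : Set (Quaternion ℝ)) : Prop := ∀ q ∈ U, sphereOf q ⊆ U

/-- The set `U ∩ ℂ_j`, seen in the complex plane. -/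
def sliceSet (j : Quaternion ℝ) (U : Set (Quaternion ℝ)) : Set ℂ := {z | slicePt j z ∈ U}

/-- The complement `U₋` of the closure of `U = U₊`. -/
def exteriorOf (U : Set (Quaternion ℝ)) : Set (Quaternion ℝ) := (closure U)ᶜ

/-- An oriented simple closed piecewise `C¹` curve in the complex plane, given as a cyclic chain of
`n + 1` regular `C¹` arcs, each parametrized by `[0,1]` (the addition in `Fin (n + 1)` is cyclic).
The quotient of the two one-sided tangents at each junction is not in `(-∞, 0]` (no cusps). -/
structure ClosedPiecewiseC1Curve where
  n : ℕ
  arc : Fin (n + 1) → ℝ → ℂ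
  contDiffOn_arc : ∀ k, ContDiffOn ℝ 1 (arc k) (Icc 0 1)
  deriv_ne_zero : ∀ k, ∀ t ∈ Icc (0 : ℝ) 1, derivWithin (arc k) (Icc 0 1) t ≠ 0
  joined : ∀ k, arc k 1 = arc (k + 1) 0
  simple : ∀ k l, ∀ s ∈ Ico (0 : ℝ) 1, ∀ t ∈ Ico (0 : ℝ) 1, arc k s = arc l t → k = l ∧ s = t
  no_cusp : ∀ k, derivWithin (arc (k + 1)) (Icc 0 1) 0 / derivWithin (arc k) (Icc 0 1) 1
    ∈ Complex.slitPlane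

/-- The image of a closed curve. -/
def ClosedPiecewiseC1Curve.image (c : ClosedPiecewiseC1Curve) : Set ℂ :=
  ⋃ k, c.arc k '' Icc 0 1

/-- The finite family `c` of closed piecewise `C¹` curves is the boundary contour of the plane set
`D`, with its usual orientation: the curves are pairwise disjoint, together they form the boundary
of `D`, and at each point interior to an arc, `D` lies to the left and the exterior of `D` to the
right of the curve. -/
structure IsBoundaryContour {N : ℕ} (c : Fin N → ClosedPiecewiseC1Curve) (D : Set ℂ) : Prop where
  disjoint : ∀ i l, i ≠ l → Disjoint (c i).image (c l).image
  image_eq : ⋃ i, (c i).image = frontier D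
  left_side : ∀ i k, ∀ t ∈ Ioo (0 : ℝ) 1, ∀ᶠ ε : ℝ in 𝓝[>] 0,
    (c i).arc k t + ε * (Complex.I * derivWithin ((c i).arc k) (Icc 0 1) t) ∈ D
  right_side : ∀ i k, ∀ t ∈ Ioo (0 : ℝ) 1, ∀ᶠ ε : ℝ in 𝓝[>] 0,
    (c i).arc k t - ε * (Complex.I * derivWithin ((c i).arc k) (Icc 0 1) t) ∉ closure D

/-- The left slice Cauchy kernel `S_L⁻¹(s, p) = -(p² - 2 p Re s + |s|²)⁻¹ (p - s̄)`. -/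
def cauchyKernel (s p : Quaternion ℝ) : Quaternion ℝ :=
  -((p ^ 2 - 2 * p * (s.re : Quaternion ℝ) + ((‖s‖ ^ 2 : ℝ) : Quaternion ℝ))⁻¹ * (p - star s))

variable {X : Type*} [NormedAddCommGroup X] [NormedSpace ℝ X] [Module (Quaternion ℝ) X]

/-- The left Cauchy transform `(1 / 2π) ∫ S_L⁻¹(s, p) ds_j f(s)`, `ds_j = -j ds`, over the
contour `c` transported to the slice `ℂ_j`. -/
def cauchyTransform (j : Quaternion ℝ) {N : ℕ} (c : Fin N → ClosedPiecewiseC1Curve)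
    (f : Quaternion ℝ → X) (p : Quaternion ℝ) : X :=
  (1 / (2 * Real.pi)) • ∑ i, ∑ k, ∫ t in (0 : ℝ)..1,
    (cauchyKernel (slicePt j ((c i).arc k t)) p *
      (-j * slicePt j (derivWithin ((c i).arc k) (Icc 0 1) t))) • f (slicePt j ((c i).arc k t))

/-- The set of `z = u + i v` such that `u + j v` lies in `K` for some `j ∈ imagSphere` (equivalently,
if `K` is axially symmetric, for all `j`). -/
def shadow (K : Set (Quaternion ℝ)) : Set ℂ := {z | ∃ j ∈ imagSphere, slicePt j z ∈ K}

/-- `F` is a bounded Hölder slice continuous function of order `α` on the axially symmetric set `K`: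
`F (u + j v) = F₀ (u, v) + j F₁ (u, v)` with `F₀` even and `F₁` odd in `v`, both Hölder continuous
of order `α`. -/
def HolderSliceOn (α : ℝ≥0) (F : Quaternion ℝ → X) (K : Set (Quaternion ℝ)) : Prop :=
  ∃ F₀ F₁ : ℂ → X,
    (∀ z ∈ shadow K, F₀ (star z) = F₀ z ∧ F₁ (star z) = -F₁ z) ∧
    (∀ j ∈ imagSphere, ∀ z ∈ shadow K, F (slicePt j z) = F₀ z + j • F₁ z) ∧
    (∃ C : ℝ≥0, HolderOnWith C α F₀ (shadow K)) ∧
    (∃ C : ℝ≥0, HolderOnWith C α F₁ (shadow K)) ∧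
    ∃ M : ℝ, ∀ p ∈ K, ‖F p‖ ≤ M

open Classical in
/-- `F` is Hölder slice continuous of order `α` on `K ∪ {∞}`, where `K` has bounded complement:
`F (p)` is so on `K`, and `F (1 / p)`, with the value `F ∞` at `0`, is so on the set of all `p`
with `1 / p ∈ K ∪ {∞}`. -/
def HolderSliceOnWithInfty (α : ℝ≥0) (F : OnePoint (Quaternion ℝ) → X)
    (K : Set (Quaternion ℝ)) : Prop :=
  HolderSliceOn α (fun p => F (p : OnePoint (Quaternion ℝ))) K ∧
  HolderSliceOn α
    (fun p => if p = 0 then F OnePoint.infty else F ((p⁻¹ : Quaternion ℝ) : OnePoint (Quaternion ℝ)))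
    {p | p = 0 ∨ p⁻¹ ∈ K}

end SliceCauchy

end

/-!
# The slice Cauchy transform of a Hölder continuous function

The theorem reduces to the Plemelj–Privalov theorem in one plane. Fixing `j` makes `X` a complex
Banach space (`i` acts as `j`), and `D = U ∩ ℂ_j` becomes a bounded open set in `ℂ` with boundary
contour `Γ`. The slice Cauchy kernel is, at `p = u + k v`, a combination of the complex Cauchy
kernels at `z = u + i v` and at its conjugate (`cauchyKernel_slicePt`), so the slice Cauchy transform
is the slice function induced by the complex Cauchy transform `φ` of `f`: `F₀` is the mean of `φ z`
and `φ (star z)`, and `F₁` is half of `j (φ (star z) - φ z)` (`cauchyTransform_slicePt`). Both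
formulas turn Hölder continuity on the slice into Hölder slice continuity
(`holderSliceOn_of_slice`), and on `ℂ_j` the induced function is the given one. It remains to treat
`φ` on `D` and on the complement of `D`.

*Boundary values.* The arcs of `Γ` are regular, so a disc of radius `r` contains a length `O(r)` of
`Γ`; by the layer cake formula `∫ |s - s₀| ^ (α - 1) / max |s - s₀| r |ds| = O(r ^ (α - 1))`
(`integrable_holderMajorant_comp`). Comparing `φ z` with the absolutely convergent integral
`Φ s₀ = (1 / 2 π i) ∫ (f s - f s₀) / (s - s₀) ds` gives `φ z = 1_D(z) f s₀ + Φ s₀ + O(|z - s₀| ^ α)`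
whenever the distances from `z` to `s₀` and to `Γ` are comparable. The boundary values from inside
and from outside are therefore `f + Φ` and `Φ`, and their difference is `f`. For Hölder continuity
along `Γ` two boundary points at distance `r` are compared with a third point, at distance `O(r)`
from both and of order `r` from `Γ`. Such a point exists since finitely many regular arcs leave a
fixed fraction of every disc free (`exists_disc_of_isRegularArc`), and it does not matter on which
side of `Γ` it lies, since the two boundary values differ by the Hölder continuous function `f`.

*The Cauchy integral of `1`.* The argument uses that `(1 / 2 π i) ∫ ds / (s - z)` is the indicator
function of `D` (`IsContour.contourCauchy_eq_indicator`). Its derivative telescopes to zero off `Γ`,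
and it jumps by `1` across every interior point of an arc, which a logarithm as local primitive
shows; since `D` lies to the left and its exterior to the right, the indicator function has the same
jump. The difference of the two is locally constant off the finite set of junctions, whose complement
is connected, and it vanishes at infinity.

*Infinity.* In the coordinate `1 / z` the Cauchy transform is Lipschitz near `0`, with value `0`
there (`IsContour.exists_lipschitz_infty`). Hence `φ` is bounded, and Hölder continuous after
inversion (`exists_bound_and_holder_inv`).
-/

namespace SliceCauchy

/-! ### Integrals of decreasing functions of the distance -/

/-- If the sublevel sets of `ρ` have at most linearly growing measure, a decreasing function of `ρ`
has at most `C` times the integral which it has on the half line: by the layer cake formula it is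
enough to compare the superlevel sets, which are intervals. -/
theorem lintegral_comp_le_of_measure_lt_le {T : Type*} [MeasurableSpace T] {ν : Measure T}
    {ρ : T → ℝ} (hρm : AEMeasurable ρ ν) (hρ0 : ∀ t, 0 ≤ ρ t) {C : ℝ} (hC : 0 < C)
    (hν : ∀ r > 0, ν {t | ρ t < r} ≤ ENNReal.ofReal (C * r))
    {h : ℝ → ℝ} (hm : Measurable h) (h0 : ∀ x, 0 ≤ x → 0 ≤ h x) (hanti : AntitoneOn h (Ioi 0)) :
    ∫⁻ t, ENNReal.ofReal (h (ρ t)) ∂ν ≤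
      ENNReal.ofReal C * ∫⁻ x in Ioi (0 : ℝ), ENNReal.ofReal (h x) := by
  have hle : ∀ a : ℝ, 0 ≤ a → ν {t | ρ t ≤ a} ≤ ENNReal.ofReal (C * a) := by
    intro a ha
    have hlim : Tendsto (fun r : ℝ => ENNReal.ofReal (C * r)) (𝓝[>] a)
        (𝓝 (ENNReal.ofReal (C * a))) :=
      ((ENNReal.continuous_ofReal.comp (continuous_const.mul continuous_id)).tendsto a).mono_left
        nhdsWithin_le_nhds
    refine ge_of_tendsto hlim ?_
    filter_upwards [self_mem_nhdsWithin] with r hr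
    have hr' : a < r := hr
    exact (measure_mono fun t (ht : ρ t ≤ a) => lt_of_le_of_lt ht hr').trans
      (hν r (ha.trans_lt hr'))
  rw [lintegral_eq_lintegral_meas_lt ν (Eventually.of_forall fun t => h0 _ (hρ0 t))
      (hm.comp_aemeasurable hρm),
    lintegral_eq_lintegral_meas_lt (volume.restrict (Ioi (0 : ℝ)))
      ((ae_restrict_iff' measurableSet_Ioi).2 (Eventually.of_forall fun x hx => h0 x hx.le))
      hm.aemeasurable, ← lintegral_const_mul' _ _ ENNReal.ofReal_ne_top]
  refine lintegral_mono fun l => ?_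
  have hSm : MeasurableSet {x : ℝ | l < h x} := measurableSet_lt measurable_const hm
  rw [Measure.restrict_apply hSm]
  set S : Set ℝ := {x : ℝ | l < h x} ∩ Ioi 0 with hS
  by_cases htop : volume S = ⊤
  · rw [htop, ENNReal.mul_top (by simpa using hC)]
    exact le_top
  · have hsub : {t | l < h (ρ t)} ⊆ {t | ρ t ≤ (volume S).toReal} := by
      intro t ht
      rcases (hρ0 t).eq_or_lt with h0t | h0t
      · simp only [mem_ofPred_eq, ← h0t]
        exact ENNReal.toReal_nonneg
      · have : Ioc 0 (ρ t) ⊆ S := fun x hx =>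
          ⟨lt_of_lt_of_le ht (hanti hx.1 h0t hx.2), hx.1⟩
        have h2 := measure_mono (μ := volume) this
        rw [Real.volume_Ioc, sub_zero] at h2
        exact (ENNReal.ofReal_le_iff_le_toReal htop).1 h2
    refine (measure_mono hsub).trans ((hle _ ENNReal.toReal_nonneg).trans_eq ?_)
    rw [ENNReal.ofReal_mul hC.le, ENNReal.ofReal_toReal htop]

/-- The kernel majorant `x ^ (a - 1) / max x r`, which is integrable on the half line since
`0 < a < 1`. -/
noncomputable def holderMajorant (a r x : ℝ) : ℝ := x ^ (a - 1) / max x r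

theorem holderMajorant_nonneg {a r x : ℝ} (hx : 0 ≤ x) : 0 ≤ holderMajorant a r x :=
  div_nonneg (Real.rpow_nonneg hx _) (le_max_of_le_left hx)

theorem measurable_holderMajorant (a r : ℝ) : Measurable (holderMajorant a r) := by
  unfold holderMajorant
  fun_prop

theorem antitoneOn_holderMajorant {a r : ℝ} (ha : a < 1) :
    AntitoneOn (holderMajorant a r) (Ioi 0) := by
  intro x (hx : 0 < x) y (hy : 0 < y) hxy
  unfold holderMajorant
  have h1 : y ^ (a - 1) ≤ x ^ (a - 1) :=
    Real.rpow_le_rpow_of_nonpos hx hxy (by linarith)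
  exact div_le_div₀ (Real.rpow_nonneg hx.le _) h1 (lt_max_of_lt_left hx)
    (max_le_max_right _ hxy)

theorem lintegral_holderMajorant_le {a r : ℝ} (ha0 : 0 < a) (ha1 : a < 1) (hr : 0 < r) :
    ∫⁻ x in Ioi (0 : ℝ), ENNReal.ofReal (holderMajorant a r x) ≤
      ENNReal.ofReal ((a⁻¹ + (1 - a)⁻¹) * r ^ (a - 1)) := by
  rw [← Ioc_union_Ioi_eq_Ioi hr.le]
  refine (lintegral_union_le _ _ _).trans ?_
  rw [add_mul, ENNReal.ofReal_add (by positivity)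
    (mul_nonneg (inv_nonneg.2 (by linarith)) (Real.rpow_nonneg hr.le _))]
  refine add_le_add ?_ ?_
  · have hint : IntegrableOn (fun x : ℝ => r⁻¹ * x ^ (a - 1)) (Ioc 0 r) := by
      have := (intervalIntegral.intervalIntegrable_rpow' (a := 0) (b := r)
        (show -1 < a - 1 by linarith)).const_mul r⁻¹
      exact (intervalIntegrable_iff_integrableOn_Ioc_of_le hr.le).1 this
    have hval : ∫ x in Ioc 0 r, r⁻¹ * x ^ (a - 1) = a⁻¹ * r ^ (a - 1) := by
      rw [← intervalIntegral.integral_of_le hr.le, intervalIntegral.integral_const_mul,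
        integral_rpow (Or.inl (by linarith)), sub_add_cancel, Real.zero_rpow ha0.ne', sub_zero,
        Real.rpow_sub_one hr.ne']
      field_simp
    rw [← hval, ofReal_integral_eq_lintegral_ofReal hint]
    · refine setLIntegral_mono' measurableSet_Ioc fun x hx => ENNReal.ofReal_le_ofReal ?_
      rw [holderMajorant, div_eq_inv_mul]
      gcongr
      · exact Real.rpow_nonneg hx.1.le _
      · exact le_max_right _ _
    · refine (ae_restrict_iff' measurableSet_Ioc).2 (Eventually.of_forall fun x hx => ?_)
      exact mul_nonneg (inv_nonneg.2 hr.le) (Real.rpow_nonneg hx.1.le _)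
  · have hint : IntegrableOn (fun x : ℝ => x ^ (a - 2)) (Ioi r) :=
      integrableOn_Ioi_rpow_of_lt (by linarith) hr
    have hval : ∫ x in Ioi r, x ^ (a - 2) = (1 - a)⁻¹ * r ^ (a - 1) := by
      rw [integral_Ioi_rpow_of_lt (by linarith) hr, show a - 2 + 1 = -(1 - a) by ring, neg_div_neg_eq,
        show a - 1 = -(1 - a) by ring, div_eq_inv_mul]
    rw [← hval, ofReal_integral_eq_lintegral_ofReal hint]
    · refine setLIntegral_mono' measurableSet_Ioi fun x (hx : r < x) =>
        ENNReal.ofReal_le_ofReal ?_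
      have hx0 := hr.trans hx
      rw [holderMajorant, max_eq_left hx.le, ← Real.rpow_sub_one hx0.ne']
      exact le_of_eq (by ring_nf)
    · refine (ae_restrict_iff' measurableSet_Ioi).2 (Eventually.of_forall fun x (hx : r < x) => ?_)
      exact Real.rpow_nonneg (hr.trans hx).le _

/-- The basic integral estimate: `∫ ρ ^ (a - 1) / max ρ r ≲ r ^ (a - 1)`. -/
theorem integrable_holderMajorant_comp {T : Type*} [MeasurableSpace T] {ν : Measure T}
    {ρ : T → ℝ} (hρm : AEMeasurable ρ ν) (hρ0 : ∀ t, 0 ≤ ρ t) {C : ℝ} (hC : 0 < C)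
    (hν : ∀ r > 0, ν {t | ρ t < r} ≤ ENNReal.ofReal (C * r))
    {a r : ℝ} (ha0 : 0 < a) (ha1 : a < 1) (hr : 0 < r) :
    Integrable (fun t => holderMajorant a r (ρ t)) ν ∧
      ∫ t, holderMajorant a r (ρ t) ∂ν ≤ C * (a⁻¹ + (1 - a)⁻¹) * r ^ (a - 1) := by
  have hK : 0 ≤ (a⁻¹ + (1 - a)⁻¹) * r ^ (a - 1) :=
    mul_nonneg (add_nonneg (by positivity) (inv_nonneg.2 (by linarith))) (Real.rpow_nonneg hr.le _)
  have hb : ∫⁻ t, ENNReal.ofReal (holderMajorant a r (ρ t)) ∂ν ≤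
      ENNReal.ofReal (C * (a⁻¹ + (1 - a)⁻¹) * r ^ (a - 1)) := by
    refine (lintegral_comp_le_of_measure_lt_le hρm hρ0 hC hν (measurable_holderMajorant a r)
      (fun x hx => holderMajorant_nonneg hx) (antitoneOn_holderMajorant ha1)).trans ?_
    rw [mul_assoc, ENNReal.ofReal_mul hC.le]
    exact mul_le_mul_right (lintegral_holderMajorant_le ha0 ha1 hr) _
  have hnn : 0 ≤ᵐ[ν] fun t => holderMajorant a r (ρ t) :=
    Eventually.of_forall fun t => holderMajorant_nonneg (hρ0 t)
  have hmeas := ((measurable_holderMajorant a r).comp_aemeasurable hρm).aestronglyMeasurable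
  refine ⟨⟨hmeas, ?_⟩, ?_⟩
  · rw [hasFiniteIntegral_iff_ofReal hnn]
    exact hb.trans_lt ENNReal.ofReal_lt_top
  · rw [integral_eq_lintegral_of_nonneg_ae hnn hmeas]
    exact ENNReal.toReal_le_of_le_ofReal (by rw [mul_assoc]; positivity) hb

/-! ### Cauchy integrals of Hölder functions over upper regular chains -/

/-- A chain in the plane, parametrized by a finite measure space `(T, ν)` through `γ`, with complex
density `w` (so that the integral of `g` over the chain is `∫ w t • g (γ t) ∂ν`). The chain is
carried by the compact set `Γ`, the density is bounded by `L`, and a disc of radius `r` about a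
point of `Γ` has parameter measure at most `C * r`. -/
structure RegularChain {T : Type*} [MeasurableSpace T] (ν : Measure T) (γ w : T → ℂ) (Γ : Set ℂ)
    (L C : ℝ) : Prop where
  isCompact : IsCompact Γ
  nonempty : Γ.Nonempty
  aemeasurable : AEMeasurable γ ν
  aemeasurable_density : AEMeasurable w ν
  bound_nonneg : 0 ≤ L
  const_pos : 0 < C
  norm_density_le : ∀ᵐ t ∂ν, ‖w t‖ ≤ L
  mem : ∀ᵐ t ∂ν, γ t ∈ Γ
  measure_le : ∀ s ∈ Γ, ∀ r > 0, ν {t | ‖γ t - s‖ < r} ≤ ENNReal.ofReal (C * r)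

section

variable {T : Type*} [MeasurableSpace T] {E : Type*} [NormedAddCommGroup E]

/-- The Cauchy integral of `f` over a chain, off the carrier of the chain. -/
noncomputable def chainCauchy [NormedSpace ℝ E] [NormedSpace ℂ E] (ν : Measure T) (γ w : T → ℂ)
    (f : ℂ → E) (z : ℂ) : E :=
  ∫ t, ((γ t - z)⁻¹ * w t) • f (γ t) ∂ν

/-- The regularized Cauchy integral of `f` at a point `s` of the carrier; it converges absolutely
if `f` is Hölder continuous. -/
noncomputable def regCauchy [NormedSpace ℝ E] [NormedSpace ℂ E] (ν : Measure T) (γ w : T → ℂ)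
    (f : ℂ → E) (s : ℂ) : E :=
  ∫ t, ((γ t - s)⁻¹ * w t) • (f (γ t) - f s) ∂ν

variable {ν : Measure T} {γ w : T → ℂ} {Γ : Set ℂ} {L C : ℝ} {f : ℂ → E} {a H : ℝ}

theorem exists_norm_le_of_holder (hΓ : IsCompact Γ) (ha0 : 0 < a) (hH : 0 ≤ H)
    (hf : ∀ x ∈ Γ, ∀ y ∈ Γ, ‖f x - f y‖ ≤ H * ‖x - y‖ ^ a) :
    ∃ M, ∀ x ∈ Γ, ‖f x‖ ≤ M := by
  rcases Γ.eq_empty_or_nonempty with rfl | ⟨s, hs⟩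
  · exact ⟨0, by simp⟩
  · obtain ⟨R, hR⟩ := hΓ.isBounded.subset_closedBall s
    refine ⟨‖f s‖ + H * R ^ a, fun x hx => ?_⟩
    have h1 : ‖x - s‖ ≤ R := by simpa [dist_eq_norm] using hR hx
    have h2 := hf x hx s hs
    have h3 : H * ‖x - s‖ ^ a ≤ H * R ^ a := by gcongr
    have h4 := norm_add_le (f s) (f x - f s)
    rw [add_sub_cancel] at h4
    linarith

variable [NormedSpace ℂ E]

theorem integrable_inv_mul_smul [IsFiniteMeasure ν] (hch : RegularChain ν γ w Γ L C)
    {z : ℂ} (hz : z ∉ Γ) {g : T → E} (hgm : AEStronglyMeasurable g ν) {M : ℝ}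
    (hg : ∀ᵐ t ∂ν, ‖g t‖ ≤ M) :
    Integrable (fun t => ((γ t - z)⁻¹ * w t) • g t) ν := by
  have hd : 0 < Metric.infDist z Γ :=
    (hch.isCompact.isClosed.notMem_iff_infDist_pos hch.nonempty).1 hz
  refine Integrable.of_bound (C := (Metric.infDist z Γ)⁻¹ * L * M) ?_ ?_
  · exact AEStronglyMeasurable.smul
      (((hch.aemeasurable.sub_const z).inv.mul hch.aemeasurable_density).aestronglyMeasurable) hgm
  · filter_upwards [hch.norm_density_le, hch.mem, hg] with t h1 h2 h3
    rw [norm_smul, norm_mul, norm_inv]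
    have h4 : Metric.infDist z Γ ≤ ‖γ t - z‖ := by
      rw [← dist_eq_norm, dist_comm]
      exact Metric.infDist_le_dist_of_mem h2
    have hL := hch.bound_nonneg
    gcongr

theorem integrable_chainCauchy [IsFiniteMeasure ν] (hch : RegularChain ν γ w Γ L C)
    (ha0 : 0 < a) (hH : 0 ≤ H) (hf : ∀ x ∈ Γ, ∀ y ∈ Γ, ‖f x - f y‖ ≤ H * ‖x - y‖ ^ a)
    (hfm : AEStronglyMeasurable (fun t => f (γ t)) ν) {z : ℂ} (hz : z ∉ Γ) :
    Integrable (fun t => ((γ t - z)⁻¹ * w t) • f (γ t)) ν := by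
  obtain ⟨M, hM⟩ := exists_norm_le_of_holder hch.isCompact ha0 hH hf
  exact integrable_inv_mul_smul hch hz hfm (hch.mem.mono fun t ht => hM _ ht)

theorem integrable_inv_mul [IsFiniteMeasure ν] (hch : RegularChain ν γ w Γ L C)
    {z : ℂ} (hz : z ∉ Γ) : Integrable (fun t => (γ t - z)⁻¹ * w t) ν := by
  have := integrable_inv_mul_smul (g := fun _ => (1 : ℂ)) hch hz aestronglyMeasurable_const
    (M := 1) (by simp)
  simpa using this

theorem integrable_majorant (hch : RegularChain ν γ w Γ L C) (ha0 : 0 < a) (ha1 : a < 1)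
    {s : ℂ} (hs : s ∈ Γ) {r : ℝ} (hr : 0 < r) :
    Integrable (fun t => holderMajorant a r ‖γ t - s‖) ν ∧
      ∫ t, holderMajorant a r ‖γ t - s‖ ∂ν ≤ C * (a⁻¹ + (1 - a)⁻¹) * r ^ (a - 1) :=
  integrable_holderMajorant_comp (hch.aemeasurable.sub_const s).norm (fun _ => norm_nonneg _)
    hch.const_pos (hch.measure_le s hs) ha0 ha1 hr

theorem rpow_div_self {x : ℝ} (hx : 0 ≤ x) (ha0 : 0 < a) (ha1 : a < 1) :
    x ^ a / x = x ^ (a - 1) := by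
  rcases hx.eq_or_lt with rfl | hx
  · rw [Real.zero_rpow ha0.ne', Real.zero_rpow (by linarith), zero_div]
  · exact (Real.rpow_sub_one hx.ne' a).symm

theorem integrable_regCauchy (hch : RegularChain ν γ w Γ L C)
    (ha0 : 0 < a) (ha1 : a < 1)
    (hf : ∀ x ∈ Γ, ∀ y ∈ Γ, ‖f x - f y‖ ≤ H * ‖x - y‖ ^ a)
    (hfm : AEStronglyMeasurable (fun t => f (γ t)) ν) {s : ℂ} (hs : s ∈ Γ) :
    Integrable (fun t => ((γ t - s)⁻¹ * w t) • (f (γ t) - f s)) ν := by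
  obtain ⟨R, hR0, hR⟩ := hch.isCompact.isBounded.subset_closedBall_lt 0 s
  refine Integrable.mono' (((integrable_majorant hch ha0 ha1 hs hR0).1).const_mul (L * H * R)) ?_ ?_
  · exact AEStronglyMeasurable.smul
      (((hch.aemeasurable.sub_const s).inv.mul hch.aemeasurable_density).aestronglyMeasurable)
      (hfm.sub aestronglyMeasurable_const)
  · filter_upwards [hch.norm_density_le, hch.mem] with t h1 h2
    have h3 : ‖γ t - s‖ ≤ R := by simpa [dist_eq_norm] using hR h2
    have hL := hch.bound_nonneg
    rw [norm_smul, norm_mul, norm_inv, holderMajorant, max_eq_right h3,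
      ← rpow_div_self (norm_nonneg _) ha0 ha1]
    calc ‖γ t - s‖⁻¹ * ‖w t‖ * ‖f (γ t) - f s‖
        ≤ ‖γ t - s‖⁻¹ * L * (H * ‖γ t - s‖ ^ a) := by
          gcongr
          exact hf _ h2 _ hs
      _ = _ := by field_simp

variable [NormedSpace ℝ E] [CompleteSpace E]

/-- Subtracting the value at a boundary point `s`: the Cauchy integral of `f` is that of
`f - f s` plus `f s` times the Cauchy integral of `1`. -/
theorem chainCauchy_eq_add [IsFiniteMeasure ν] (hch : RegularChain ν γ w Γ L C)
    (ha0 : 0 < a) (hH : 0 ≤ H) (hf : ∀ x ∈ Γ, ∀ y ∈ Γ, ‖f x - f y‖ ≤ H * ‖x - y‖ ^ a)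
    (hfm : AEStronglyMeasurable (fun t => f (γ t)) ν) {z : ℂ} (hz : z ∉ Γ) (s : ℂ) :
    Integrable (fun t => ((γ t - z)⁻¹ * w t) • (f (γ t) - f s)) ν ∧
    chainCauchy ν γ w f z = ∫ t, ((γ t - z)⁻¹ * w t) • (f (γ t) - f s) ∂ν
      + (∫ t, (γ t - z)⁻¹ * w t ∂ν) • f s := by
  have h1 := integrable_chainCauchy hch ha0 hH hf hfm hz
  have h2 := (integrable_inv_mul hch hz).smul_const (f s)
  have h3 : (fun t => ((γ t - z)⁻¹ * w t) • (f (γ t) - f s)) =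
      fun t => ((γ t - z)⁻¹ * w t) • f (γ t) - ((γ t - z)⁻¹ * w t) • f s := by
    ext t; rw [smul_sub]
  rw [h3]
  refine ⟨h1.sub h2, ?_⟩
  rw [integral_sub h1 h2, integral_smul_const, sub_add_cancel, chainCauchy]

/-- Non-tangential approach: if the distance of `z` to `s` is comparable with the distance of `z`
to the whole carrier, the Cauchy integral at `z` is Hölder close to its regularization at `s`. -/
theorem norm_chainCauchy_sub_le [IsFiniteMeasure ν] (hch : RegularChain ν γ w Γ L C)
    (ha0 : 0 < a) (ha1 : a < 1) (hH : 0 ≤ H)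
    (hf : ∀ x ∈ Γ, ∀ y ∈ Γ, ‖f x - f y‖ ≤ H * ‖x - y‖ ^ a)
    (hfm : AEStronglyMeasurable (fun t => f (γ t)) ν) {z s : ℂ} (hz : z ∉ Γ) (hs : s ∈ Γ)
    {A : ℝ} (hA : 0 ≤ A) (hzs : ∀ y ∈ Γ, ‖z - s‖ ≤ A * ‖y - z‖) :
    ‖chainCauchy ν γ w f z - (∫ t, (γ t - z)⁻¹ * w t ∂ν) • f s - regCauchy ν γ w f s‖ ≤
      L * H * (1 + A) * (C * (a⁻¹ + (1 - a)⁻¹)) * ‖z - s‖ ^ a := by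
  obtain ⟨h1, h2⟩ := chainCauchy_eq_add hch ha0 hH hf hfm hz s
  have h3 := integrable_regCauchy hch ha0 ha1 hf hfm hs
  rw [h2, add_sub_cancel_right, regCauchy, ← integral_sub h1 h3]
  have hr : 0 < ‖z - s‖ := norm_pos_iff.2 (sub_ne_zero.2 fun h => hz (h ▸ hs))
  obtain ⟨h4, h5⟩ := integrable_majorant hch ha0 ha1 hs hr
  have hL := hch.bound_nonneg
  refine (norm_integral_le_of_norm_le (h4.const_mul (L * H * (1 + A) * ‖z - s‖)) ?_).trans ?_
  · filter_upwards [hch.norm_density_le, hch.mem] with t hw ht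
    have hγz : 0 < ‖γ t - z‖ := norm_pos_iff.2 (sub_ne_zero.2 fun h => hz (h ▸ ht))
    rcases eq_or_ne (γ t) s with hts | hts
    · simp only [hts, sub_self, smul_zero, norm_zero]
      exact mul_nonneg (by positivity) (holderMajorant_nonneg le_rfl)
    have hγs : 0 < ‖γ t - s‖ := norm_pos_iff.2 (sub_ne_zero.2 hts)
    have hmax : max ‖γ t - s‖ ‖z - s‖ ≤ (1 + A) * ‖γ t - z‖ := by
      have e1 := hzs _ ht
      have e2 := norm_sub_le_norm_sub_add_norm_sub (γ t) z s
      exact max_le (by linarith) (by linarith)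
    have hk : (γ t - z)⁻¹ - (γ t - s)⁻¹ = (z - s) * (γ t - z)⁻¹ * (γ t - s)⁻¹ := by
      have n1 : γ t - z ≠ 0 := norm_pos_iff.1 hγz
      have n2 : γ t - s ≠ 0 := norm_pos_iff.1 hγs
      field_simp
      ring
    rw [← sub_smul, ← sub_mul, hk, norm_smul, norm_mul, norm_mul, norm_mul, norm_inv, norm_inv,
      holderMajorant, ← rpow_div_self (norm_nonneg _) ha0 ha1]
    have hinv : ‖γ t - z‖⁻¹ ≤ (1 + A) / max ‖γ t - s‖ ‖z - s‖ := by
      rw [inv_eq_one_div, div_le_div_iff₀ hγz (lt_max_of_lt_left hγs)]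
      linarith
    calc ‖z - s‖ * ‖γ t - z‖⁻¹ * ‖γ t - s‖⁻¹ * ‖w t‖ * ‖f (γ t) - f s‖
        ≤ ‖z - s‖ * ((1 + A) / max ‖γ t - s‖ ‖z - s‖) * ‖γ t - s‖⁻¹ * L *
          (H * ‖γ t - s‖ ^ a) := by
          gcongr
          exact hf _ ht _ hs
      _ = _ := by field_simp
  · rw [integral_const_mul]
    calc L * H * (1 + A) * ‖z - s‖ * ∫ t, holderMajorant a ‖z - s‖ ‖γ t - s‖ ∂ν
        ≤ L * H * (1 + A) * ‖z - s‖ * (C * (a⁻¹ + (1 - a)⁻¹) * ‖z - s‖ ^ (a - 1)) := by gcongr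
      _ = _ := by
        rw [Real.rpow_sub_one hr.ne']
        field_simp

/-- Interior regularity: at distance `d` from the carrier the Cauchy integral is Lipschitz with
constant `d ^ (a - 1)`, hence Hölder on scales up to `d`. -/
theorem norm_chainCauchy_sub_chainCauchy_le [IsFiniteMeasure ν] (hch : RegularChain ν γ w Γ L C)
    (ha0 : 0 < a) (ha1 : a < 1) (hH : 0 ≤ H)
    (hf : ∀ x ∈ Γ, ∀ y ∈ Γ, ‖f x - f y‖ ≤ H * ‖x - y‖ ^ a)
    (hfm : AEStronglyMeasurable (fun t => f (γ t)) ν) {z z' : ℂ} (hz : z ∉ Γ) (hz' : z' ∉ Γ)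
    (hzz : ∀ y ∈ Γ, 2 * ‖z - z'‖ ≤ ‖y - z‖)
    (hW : ∫ t, (γ t - z)⁻¹ * w t ∂ν = ∫ t, (γ t - z')⁻¹ * w t ∂ν) :
    ‖chainCauchy ν γ w f z - chainCauchy ν γ w f z'‖ ≤
      8 * L * H * (C * (a⁻¹ + (1 - a)⁻¹)) * ‖z - z'‖ ^ a := by
  rcases eq_or_ne z z' with rfl | hne
  · simp [Real.zero_rpow ha0.ne']
  obtain ⟨s, hs, hsd⟩ := hch.isCompact.exists_infDist_eq_dist hch.nonempty z
  have hsmin : ∀ y ∈ Γ, ‖z - s‖ ≤ ‖y - z‖ := fun y hy => by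
    rw [← dist_eq_norm, ← hsd, ← dist_eq_norm, dist_comm y]
    exact Metric.infDist_le_dist_of_mem hy
  obtain ⟨h1, h2⟩ := chainCauchy_eq_add hch ha0 hH hf hfm hz s
  obtain ⟨h1', h2'⟩ := chainCauchy_eq_add hch ha0 hH hf hfm hz' s
  rw [h2, h2', hW, add_sub_add_right_eq_sub, ← integral_sub h1 h1']
  have hr : 0 < ‖z - s‖ := norm_pos_iff.2 (sub_ne_zero.2 fun h => hz (h ▸ hs))
  have hr' : 0 < ‖z - z'‖ := norm_pos_iff.2 (sub_ne_zero.2 hne)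
  obtain ⟨h4, h5⟩ := integrable_majorant hch ha0 ha1 hs hr
  have hL := hch.bound_nonneg
  refine (norm_integral_le_of_norm_le (h4.const_mul (8 * L * H * ‖z - z'‖)) ?_).trans ?_
  · filter_upwards [hch.norm_density_le, hch.mem] with t hw ht
    have hγz : 0 < ‖γ t - z‖ := norm_pos_iff.2 (sub_ne_zero.2 fun h => hz (h ▸ ht))
    have hγz' : 0 < ‖γ t - z'‖ := norm_pos_iff.2 (sub_ne_zero.2 fun h => hz' (h ▸ ht))
    rcases eq_or_ne (γ t) s with hts | hts
    · simp only [hts, sub_self, smul_zero, norm_zero]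
      exact mul_nonneg (by positivity) (holderMajorant_nonneg le_rfl)
    have hγs : 0 < ‖γ t - s‖ := norm_pos_iff.2 (sub_ne_zero.2 hts)
    have e1 := hsmin _ ht
    have e3 := hzz _ ht
    have hmax : max ‖γ t - s‖ ‖z - s‖ ≤ 2 * ‖γ t - z‖ := by
      have e2 := norm_sub_le_norm_sub_add_norm_sub (γ t) z s
      exact max_le (by linarith) (by linarith)
    have hz2 : ‖γ t - z‖ ≤ 2 * ‖γ t - z'‖ := by
      have e2 := norm_sub_le_norm_sub_add_norm_sub (γ t) z' z
      rw [norm_sub_rev z' z] at e2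
      linarith
    have hk : (γ t - z)⁻¹ - (γ t - z')⁻¹ = (z - z') * (γ t - z)⁻¹ * (γ t - z')⁻¹ := by
      have n1 : γ t - z ≠ 0 := norm_pos_iff.1 hγz
      have n2 : γ t - z' ≠ 0 := norm_pos_iff.1 hγz'
      field_simp
      ring
    have hmp : 0 < max ‖γ t - s‖ ‖z - s‖ := lt_max_of_lt_left hγs
    rw [← sub_smul, ← sub_mul, hk, norm_smul, norm_mul, norm_mul, norm_mul, norm_inv, norm_inv,
      holderMajorant, ← rpow_div_self (norm_nonneg _) ha0 ha1]
    have hinv : ‖γ t - z‖⁻¹ ≤ 2 / max ‖γ t - s‖ ‖z - s‖ := by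
      rw [inv_eq_one_div, div_le_div_iff₀ hγz hmp]
      linarith
    have hinv' : ‖γ t - z'‖⁻¹ ≤ 4 / ‖γ t - s‖ := by
      rw [inv_eq_one_div, div_le_div_iff₀ hγz' hγs]
      have := (le_max_left ‖γ t - s‖ ‖z - s‖).trans hmax
      linarith
    calc ‖z - z'‖ * ‖γ t - z‖⁻¹ * ‖γ t - z'‖⁻¹ * ‖w t‖ * ‖f (γ t) - f s‖
        ≤ ‖z - z'‖ * (2 / max ‖γ t - s‖ ‖z - s‖) * (4 / ‖γ t - s‖) * L *
          (H * ‖γ t - s‖ ^ a) := by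
          gcongr
          exact hf _ ht _ hs
      _ = _ := by field_simp; ring
  · rw [integral_const_mul]
    have hle : ‖z - z'‖ ≤ ‖z - s‖ := by
      have := hzz s hs
      rw [norm_sub_rev s z] at this
      linarith
    have ha' : 0 ≤ a⁻¹ + (1 - a)⁻¹ :=
      add_nonneg (by positivity) (inv_nonneg.2 (by linarith))
    have hC := hch.const_pos
    have hpow : ‖z - s‖ ^ (a - 1) ≤ ‖z - z'‖ ^ (a - 1) :=
      Real.rpow_le_rpow_of_nonpos hr' hle (by linarith)
    calc 8 * L * H * ‖z - z'‖ * ∫ t, holderMajorant a ‖z - s‖ ‖γ t - s‖ ∂ν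
        ≤ 8 * L * H * ‖z - z'‖ * (C * (a⁻¹ + (1 - a)⁻¹) * ‖z - z'‖ ^ (a - 1)) := by
          gcongr
          exact h5.trans (by gcongr)
      _ = _ := by
        rw [Real.rpow_sub_one hr'.ne']
        field_simp

end

/-! ### The Plemelj–Privalov theorem for regular chains -/

section

variable {T : Type*} [MeasurableSpace T] {E : Type*} [NormedAddCommGroup E]
variable {ν : Measure T} {γ w : T → ℂ} {Γ : Set ℂ} {L C : ℝ} {f : ℂ → E} {a H : ℝ}

/-- A function which is Hölder continuous on `Γ`, Hölder continuous in `Ω` at scales up to the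
distance from `Γ`, and Hölder close to its value at a nearest point of `Γ`, is Hölder continuous on
`Ω ∪ Γ`. -/
theorem exists_holder_union {Ω : Set ℂ} (hΓ : IsCompact Γ) (hne : Γ.Nonempty) (ha0 : 0 < a)
    {G : ℂ → E} {C₁ C₂ C₃ : ℝ} (h1' : 0 ≤ C₁) (h2' : 0 ≤ C₂) (h3' : 0 ≤ C₃)
    (h1 : ∀ z ∈ Ω, ∀ s ∈ Γ, (∀ y ∈ Γ, ‖z - s‖ ≤ ‖y - z‖) → ‖G z - G s‖ ≤ C₁ * ‖z - s‖ ^ a)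
    (h2 : ∀ z ∈ Ω, ∀ z' ∈ Ω, (∀ y ∈ Γ, 2 * ‖z - z'‖ ≤ ‖y - z‖) →
      ‖G z - G z'‖ ≤ C₂ * ‖z - z'‖ ^ a)
    (h3 : ∀ s ∈ Γ, ∀ s' ∈ Γ, ‖G s - G s'‖ ≤ C₃ * ‖s - s'‖ ^ a) :
    ∃ C ≥ 0, ∀ z ∈ Ω ∪ Γ, ∀ z' ∈ Ω ∪ Γ, ‖G z - G z'‖ ≤ C * ‖z - z'‖ ^ a := by
  have hproj : ∀ z ∈ Ω ∪ Γ, ∃ p ∈ Γ, (∀ y ∈ Γ, ‖z - p‖ ≤ ‖y - z‖) ∧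
      ‖G z - G p‖ ≤ C₁ * ‖z - p‖ ^ a := by
    intro z hz
    obtain ⟨p, hp, hpd⟩ := hΓ.exists_infDist_eq_dist hne z
    have hmin : ∀ y ∈ Γ, ‖z - p‖ ≤ ‖y - z‖ := fun y hy => by
      rw [← dist_eq_norm, ← hpd, ← dist_eq_norm, dist_comm y]
      exact Metric.infDist_le_dist_of_mem hy
    by_cases hzΓ : z ∈ Γ
    · exact ⟨z, hzΓ, fun y _ => by simp, by simp [Real.zero_rpow ha0.ne']⟩
    · exact ⟨p, hp, hmin, h1 z (hz.resolve_right hzΓ) p hp hmin⟩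
  refine ⟨max C₂ ((2 * C₁ + C₃) * 6 ^ a), le_max_of_le_left h2', fun z hz z' hz' => ?_⟩
  by_cases hcase : z ∈ Ω ∧ z' ∈ Ω ∧ ∀ y ∈ Γ, 2 * ‖z - z'‖ ≤ ‖y - z‖
  · refine (h2 z hcase.1 z' hcase.2.1 hcase.2.2).trans ?_
    gcongr
    exact le_max_left _ _
  · have hnear : ∃ y ∈ Γ, ‖y - z‖ ≤ 2 * ‖z - z'‖ := by
      by_cases hzΓ : z ∈ Γ
      · exact ⟨z, hzΓ, by simp⟩
      by_cases hzΓ' : z' ∈ Γ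
      · exact ⟨z', hzΓ', by rw [norm_sub_rev]; linarith [norm_nonneg (z - z')]⟩
      by_contra! hcon
      exact hcase ⟨hz.resolve_right hzΓ, hz'.resolve_right hzΓ', fun y hy => (hcon y hy).le⟩
    obtain ⟨y, hy, hyz⟩ := hnear
    obtain ⟨p, hp, hpm, hpG⟩ := hproj z hz
    obtain ⟨q, hq, hqm, hqG⟩ := hproj z' hz'
    set r := ‖z - z'‖ with hr
    have hr0 : 0 ≤ r := norm_nonneg _
    have e1 : ‖z - p‖ ≤ 2 * r := (hpm y hy).trans hyz
    have e2 : ‖z' - q‖ ≤ 3 * r := by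
      have := norm_sub_le_norm_sub_add_norm_sub y z z'
      linarith [hqm y hy]
    have e3 : ‖p - q‖ ≤ 6 * r := by
      have e4 := norm_sub_le_norm_sub_add_norm_sub p z q
      have e5 := norm_sub_le_norm_sub_add_norm_sub z z' q
      rw [norm_sub_rev p z] at e4
      linarith
    have e6 : ‖G z - G z'‖ ≤ ‖G z - G p‖ + ‖G p - G q‖ + ‖G z' - G q‖ := by
      have e4 := norm_sub_le_norm_sub_add_norm_sub (G z) (G p) (G z')
      have e5 := norm_sub_le_norm_sub_add_norm_sub (G p) (G q) (G z')
      rw [norm_sub_rev (G q)] at e5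
      linarith
    have b1 : ‖G z - G p‖ ≤ C₁ * (6 * r) ^ a := hpG.trans (by gcongr; linarith)
    have b2 : ‖G p - G q‖ ≤ C₃ * (6 * r) ^ a := (h3 p hp q hq).trans (by gcongr)
    have b3 : ‖G z' - G q‖ ≤ C₁ * (6 * r) ^ a := hqG.trans (by gcongr; linarith)
    calc ‖G z - G z'‖ ≤ (2 * C₁ + C₃) * (6 * r) ^ a := by linarith
      _ = (2 * C₁ + C₃) * 6 ^ a * r ^ a := by
        rw [Real.mul_rpow (by norm_num) hr0]; ring
      _ ≤ _ := by gcongr; exact le_max_right _ _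

variable [NormedSpace ℂ E] [NormedSpace ℝ E] [CompleteSpace E]

/-- The Plemelj–Privalov theorem for a chain whose Cauchy integral of `1` is the indicator function
of `D`. Near every point `s` of the carrier and at every scale `r` the chain has to leave a disc of
radius `κ * r` free: Hölder continuity of the boundary values follows by comparing them with the
Cauchy integral at the centre of such a disc. -/
theorem exists_plemelj_decomposition [IsFiniteMeasure ν] (hch : RegularChain ν γ w Γ L C)
    {D : Set ℂ} (hDΓ : Disjoint D Γ)
    (hW₁ : ∀ z ∈ D, ∫ t, (γ t - z)⁻¹ * w t ∂ν = 1)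
    (hW₀ : ∀ z, z ∉ D → z ∉ Γ → ∫ t, (γ t - z)⁻¹ * w t ∂ν = 0)
    {κ : ℝ} (hκ : 0 < κ)
    (hcork : ∀ s ∈ Γ, ∀ r > 0, ∃ z, ‖z - s‖ ≤ r ∧ ∀ y ∈ Γ, κ * r ≤ ‖y - z‖)
    (ha0 : 0 < a) (ha1 : a < 1) (hH : 0 ≤ H)
    (hf : ∀ x ∈ Γ, ∀ y ∈ Γ, ‖f x - f y‖ ≤ H * ‖x - y‖ ^ a)
    (hfm : AEStronglyMeasurable (fun t => f (γ t)) ν) :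
    ∃ P M : ℂ → E, (∀ z ∈ D, P z = chainCauchy ν γ w f z) ∧
      (∀ z, z ∉ D → z ∉ Γ → M z = -chainCauchy ν γ w f z) ∧
      (∀ s ∈ Γ, f s = P s + M s) ∧
      (∃ K ≥ 0, ∀ z ∈ D ∪ Γ, ∀ z' ∈ D ∪ Γ, ‖P z - P z'‖ ≤ K * ‖z - z'‖ ^ a) ∧
      (∃ K ≥ 0, ∀ z ∈ Dᶜ, ∀ z' ∈ Dᶜ, ‖M z - M z'‖ ≤ K * ‖z - z'‖ ^ a) := by
  classical
  -- the boundary values of the Cauchy integral, from inside and from outside of `D`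
  set P : ℂ → E := fun z =>
    if z ∈ Γ then f z + regCauchy ν γ w f z else chainCauchy ν γ w f z with hPdef
  set M : ℂ → E := fun z =>
    if z ∈ Γ then -regCauchy ν γ w f z else -chainCauchy ν γ w f z with hMdef
  have hDn : ∀ z ∈ D, z ∉ Γ := fun z hz hz' => hDΓ.le_bot ⟨hz, hz'⟩
  have hL := hch.bound_nonneg
  have hC := hch.const_pos
  have ha' : 0 ≤ a⁻¹ + (1 - a)⁻¹ := add_nonneg (by positivity) (inv_nonneg.2 (by linarith))
  set K : ℝ → ℝ := fun A => L * H * (1 + A) * (C * (a⁻¹ + (1 - a)⁻¹)) with hK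
  have hK0 : ∀ A, 0 ≤ A → 0 ≤ K A := fun A hA => by positivity
  have hP1 : ∀ A, 0 ≤ A → ∀ z ∈ D, ∀ s ∈ Γ, (∀ y ∈ Γ, ‖z - s‖ ≤ A * ‖y - z‖) →
      ‖P z - P s‖ ≤ K A * ‖z - s‖ ^ a := by
    intro A hA z hz s hs h
    have := norm_chainCauchy_sub_le hch ha0 ha1 hH hf hfm (hDn z hz) hs hA h
    rw [hW₁ z hz, one_smul] at this
    simp only [hPdef, if_pos hs, if_neg (hDn z hz)]
    rwa [← sub_sub]
  have hM1 : ∀ A, 0 ≤ A → ∀ z, z ∉ D → z ∉ Γ → ∀ s ∈ Γ, (∀ y ∈ Γ, ‖z - s‖ ≤ A * ‖y - z‖) →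
      ‖M z - M s‖ ≤ K A * ‖z - s‖ ^ a := by
    intro A hA z hz hz' s hs h
    have := norm_chainCauchy_sub_le hch ha0 ha1 hH hf hfm hz' hs hA h
    rw [hW₀ z hz hz', zero_smul, sub_zero] at this
    simp only [hMdef, if_pos hs, if_neg hz']
    rwa [← norm_neg, neg_sub, sub_neg_eq_add, neg_add_eq_sub]
  have hsum : ∀ s ∈ Γ, f s = P s + M s := fun s hs => by
    simp only [hPdef, hMdef, if_pos hs, add_neg_cancel_right]
  set K₃ : ℝ := 2 * K (2 / κ) * 2 ^ a + H with hK₃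
  have hK₃0 : 0 ≤ K₃ := by
    have := hK0 (2 / κ) (by positivity)
    positivity
  have hΓ : ∀ s ∈ Γ, ∀ s' ∈ Γ, ‖P s - P s'‖ ≤ K₃ * ‖s - s'‖ ^ a ∧
      ‖M s - M s'‖ ≤ K₃ * ‖s - s'‖ ^ a := by
    intro s hs s' hs'
    rcases eq_or_ne s s' with rfl | hne
    · simp [Real.zero_rpow ha0.ne']
    set r := ‖s - s'‖ with hr
    have hr0 : 0 < r := norm_pos_iff.2 (sub_ne_zero.2 hne)
    obtain ⟨z, hz, hzy⟩ := hcork s hs r hr0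
    have hz2 : ‖z - s'‖ ≤ 2 * r := by
      have := norm_sub_le_norm_sub_add_norm_sub z s s'
      linarith
    have hA : ∀ y ∈ Γ, 2 * r ≤ 2 / κ * ‖y - z‖ := fun y hy => by
      have := hzy y hy
      rw [div_mul_eq_mul_div, le_div_iff₀ hκ]
      linarith
    have hzΓ : z ∉ Γ := fun h => by
      have := hzy z h
      rw [sub_self, norm_zero] at this
      exact absurd this (not_le.2 (by positivity))
    have hKA := hK0 (2 / κ) (by positivity)
    -- comparison through `z`, valid for the one of `P`, `M` that is Hölder near `z`
    have htri : ∀ Q : ℂ → E, ‖Q z - Q s‖ ≤ K (2 / κ) * ‖z - s‖ ^ a →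
        ‖Q z - Q s'‖ ≤ K (2 / κ) * ‖z - s'‖ ^ a → ‖Q s - Q s'‖ ≤ 2 * K (2 / κ) * 2 ^ a * r ^ a := by
      intro Q q1 q2
      have q3 : ‖z - s‖ ^ a ≤ (2 * r) ^ a :=
        Real.rpow_le_rpow (norm_nonneg _) (by linarith) ha0.le
      have q4 : ‖z - s'‖ ^ a ≤ (2 * r) ^ a :=
        Real.rpow_le_rpow (norm_nonneg _) hz2 ha0.le
      have q5 := norm_sub_le_norm_sub_add_norm_sub (Q s) (Q z) (Q s')
      rw [norm_sub_rev (Q s) (Q z)] at q5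
      have q6 := mul_le_mul_of_nonneg_left q3 hKA
      have q7 := mul_le_mul_of_nonneg_left q4 hKA
      calc ‖Q s - Q s'‖ ≤ 2 * K (2 / κ) * (2 * r) ^ a := by linarith
        _ = _ := by rw [Real.mul_rpow (by norm_num) hr0.le]; ring
    have hfs := hf s hs s' hs'
    have hle : 2 * K (2 / κ) * 2 ^ a * r ^ a ≤ K₃ * r ^ a := by
      rw [hK₃]
      gcongr
      linarith
    have hPM : P s - P s' = (f s - f s') - (M s - M s') := by
      rw [hsum s hs, hsum s' hs']; abel
    have hMP : M s - M s' = (f s - f s') - (P s - P s') := by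
      rw [hsum s hs, hsum s' hs']; abel
    by_cases hzD : z ∈ D
    · have h := htri P
        (hP1 _ (by positivity) z hzD s hs fun y hy => (hA y hy).trans' (by linarith))
        (hP1 _ (by positivity) z hzD s' hs' fun y hy => (hA y hy).trans' hz2)
      refine ⟨h.trans hle, ?_⟩
      rw [hMP]
      refine (norm_sub_le _ _).trans ((add_le_add hfs h).trans_eq ?_)
      rw [hK₃]; ring
    · have h := htri M
        (hM1 _ (by positivity) z hzD hzΓ s hs fun y hy => (hA y hy).trans' (by linarith))
        (hM1 _ (by positivity) z hzD hzΓ s' hs' fun y hy => (hA y hy).trans' hz2)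
      refine ⟨?_, h.trans hle⟩
      rw [hPM]
      refine (norm_sub_le _ _).trans ((add_le_add hfs h).trans_eq ?_)
      rw [hK₃]; ring
  refine ⟨P, M, fun z hz => if_neg (hDn z hz), fun z hz hz' => if_neg hz', hsum, ?_, ?_⟩
  · refine exists_holder_union hch.isCompact hch.nonempty ha0 (hK0 1 zero_le_one)
      (C₂ := 8 * L * H * (C * (a⁻¹ + (1 - a)⁻¹))) (by positivity) hK₃0
      (fun z hz s hs h => hP1 1 zero_le_one z hz s hs (by simpa using h)) ?_
      (fun s hs s' hs' => (hΓ s hs s' hs').1)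
    intro z hz z' hz' h
    simp only [hPdef, if_neg (hDn z hz), if_neg (hDn z' hz')]
    exact norm_chainCauchy_sub_chainCauchy_le hch ha0 ha1 hH hf hfm (hDn z hz) (hDn z' hz') h
      ((hW₁ z hz).trans (hW₁ z' hz').symm)
  · obtain ⟨K', hK', h⟩ := exists_holder_union (Ω := (D ∪ Γ)ᶜ) (G := M) hch.isCompact hch.nonempty
      ha0 (hK0 1 zero_le_one)
      (C₂ := 8 * L * H * (C * (a⁻¹ + (1 - a)⁻¹))) (by positivity) hK₃0
      (fun z hz s hs h => hM1 1 zero_le_one z (fun h => hz (Or.inl h)) (fun h => hz (Or.inr h)) s hs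
        (by simpa using h)) (by
          intro z hz z' hz' h
          simp only [mem_compl_iff, mem_union, not_or] at hz hz'
          simp only [hMdef, if_neg hz.2, if_neg hz'.2]
          rw [← neg_sub', norm_neg]
          exact norm_chainCauchy_sub_chainCauchy_le hch ha0 ha1 hH hf hfm hz.2 hz'.2 h
            ((hW₀ z hz.1 hz.2).trans (hW₀ z' hz'.1 hz'.2).symm))
      (fun s hs s' hs' => (hΓ s hs s' hs').2)
    have hsub : Dᶜ ⊆ (D ∪ Γ)ᶜ ∪ Γ := fun z hz => by
      by_cases hzΓ : z ∈ Γ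
      · exact Or.inr hzΓ
      · exact Or.inl fun h => h.elim hz hzΓ
    exact ⟨K', hK', fun z hz z' hz' => h z (hsub hz) z' (hsub hz')⟩

end

/-! ### Regular arcs -/

/-- A regular `C¹` arc parametrized by `[0, 1]`. -/
structure IsRegularArc (g : ℝ → ℂ) : Prop where
  contDiffOn : ContDiffOn ℝ 1 g (Icc 0 1)
  deriv_ne_zero : ∀ t ∈ Icc (0 : ℝ) 1, derivWithin g (Icc 0 1) t ≠ 0

namespace IsRegularArc

variable {g : ℝ → ℂ}

theorem hasDerivWithinAt (hg : IsRegularArc g) {t : ℝ} (ht : t ∈ Icc (0 : ℝ) 1) :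
    HasDerivWithinAt g (derivWithin g (Icc 0 1) t) (Icc 0 1) t :=
  (hg.contDiffOn.differentiableOn one_ne_zero t ht).hasDerivWithinAt

theorem hasDerivAt (hg : IsRegularArc g) {t : ℝ} (ht : t ∈ Ioo (0 : ℝ) 1) :
    HasDerivAt g (derivWithin g (Icc 0 1) t) t :=
  (hg.hasDerivWithinAt (Ioo_subset_Icc_self ht)).hasDerivAt (Icc_mem_nhds ht.1 ht.2)

theorem continuousOn (hg : IsRegularArc g) : ContinuousOn g (Icc 0 1) := hg.contDiffOn.continuousOn

theorem continuousOn_derivWithin (hg : IsRegularArc g) :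
    ContinuousOn (derivWithin g (Icc 0 1)) (Icc 0 1) :=
  hg.contDiffOn.continuousOn_derivWithin (uniqueDiffOn_Icc zero_lt_one) le_rfl

theorem exists_norm_derivWithin_le (hg : IsRegularArc g) :
    ∃ L, 0 ≤ L ∧ ∀ t ∈ Icc (0 : ℝ) 1, ‖derivWithin g (Icc 0 1) t‖ ≤ L := by
  obtain ⟨L, hL⟩ := isCompact_Icc.exists_bound_of_continuousOn hg.continuousOn_derivWithin
  exact ⟨L, (norm_nonneg _).trans (hL 0 (left_mem_Icc.2 zero_le_one)), hL⟩

theorem exists_le_norm_derivWithin (hg : IsRegularArc g) :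
    ∃ m > 0, ∀ t ∈ Icc (0 : ℝ) 1, m ≤ ‖derivWithin g (Icc 0 1) t‖ := by
  obtain ⟨x, hx, hmin⟩ := isCompact_Icc.exists_isMinOn (nonempty_Icc.2 zero_le_one)
    hg.continuousOn_derivWithin.norm
  exact ⟨_, norm_pos_iff.2 (hg.deriv_ne_zero x hx), fun t ht => hmin ht⟩

/-- On parameter intervals of a fixed length a regular arc is uniformly close to its tangents. -/
theorem exists_norm_sub_sub_le (hg : IsRegularArc g) :
    ∃ δ > 0, ∀ t₀ ∈ Icc (0 : ℝ) 1, ∀ s ∈ Icc (0 : ℝ) 1, ∀ t ∈ Icc (0 : ℝ) 1,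
      |s - t₀| ≤ δ → |t - t₀| ≤ δ →
      ‖g t - g s - (t - s : ℝ) * derivWithin g (Icc 0 1) t₀‖ ≤
        ‖derivWithin g (Icc 0 1) t₀‖ / 4 * |t - s| := by
  obtain ⟨m, hm, hmle⟩ := hg.exists_le_norm_derivWithin
  have huc := isCompact_Icc.uniformContinuousOn_of_continuous hg.continuousOn_derivWithin
  rw [Metric.uniformContinuousOn_iff] at huc
  obtain ⟨δ, hδ, hδ'⟩ := huc (m / 4) (by positivity)
  refine ⟨δ / 2, by positivity, fun t₀ ht₀ s hs t ht hst htt => ?_⟩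
  set v := derivWithin g (Icc 0 1) t₀ with hv
  set S : Set ℝ := Icc 0 1 ∩ Metric.closedBall t₀ (δ / 2) with hS
  have hconv : Convex ℝ S := (convex_Icc 0 1).inter (convex_closedBall _ _)
  have hd : ∀ x ∈ S, HasDerivWithinAt (fun x : ℝ => g x - (x : ℂ) * v)
      (derivWithin g (Icc 0 1) x - v) S x := by
    intro x hx
    have h1 := (hg.hasDerivWithinAt hx.1).mono (inter_subset_left : S ⊆ Icc 0 1)
    have h2 : HasDerivWithinAt (fun x : ℝ => (x : ℂ) * v) (1 * v) S x :=
      (Complex.ofRealCLM.hasDerivAt.mul_const v).hasDerivWithinAt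
    exact (h1.sub h2).congr_deriv (by rw [one_mul])
  have hb : ∀ x ∈ S, ‖derivWithin g (Icc 0 1) x - v‖ ≤ ‖v‖ / 4 := by
    intro x hx
    have h1 := hδ' x hx.1 t₀ ht₀ (lt_of_le_of_lt hx.2 (by linarith))
    rw [dist_eq_norm] at h1
    exact h1.le.trans (by linarith [hmle t₀ ht₀])
  have := hconv.norm_image_sub_le_of_norm_hasDerivWithin_le hd hb
    (⟨hs, by simpa [Real.dist_eq] using hst⟩ : s ∈ S)
    (⟨ht, by simpa [Real.dist_eq] using htt⟩ : t ∈ S)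
  rw [Real.norm_eq_abs] at this
  have e : g t - g s - (t - s : ℝ) * v = g t - t * v - (g s - s * v) := by
    push_cast
    ring
  rw [e]
  exact this

/-- A disc of radius `r` contains at most a length comparable to `r` of a regular arc. -/
theorem exists_volume_le (hg : IsRegularArc g) :
    ∃ C > 0, ∀ z : ℂ, ∀ r > 0,
      volume.restrict (Ioc 0 1) {t | ‖g t - z‖ < r} ≤ ENNReal.ofReal (C * r) := by
  obtain ⟨δ, hδ, hloc⟩ := hg.exists_norm_sub_sub_le
  obtain ⟨m, hm, hmle⟩ := hg.exists_le_norm_derivWithin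
  obtain ⟨F, hF, hFfin, hcov⟩ :=
    Metric.finite_approx_of_totallyBounded (isCompact_Icc (a := (0 : ℝ)) (b := 1)).totallyBounded
      δ hδ
  refine ⟨(hFfin.toFinset.card + 1) * (4 / m), by positivity, fun z r hr => ?_⟩
  rw [Measure.restrict_apply' measurableSet_Ioc]
  have hsub : {t | ‖g t - z‖ < r} ∩ Ioc 0 1 ⊆
      ⋃ x ∈ hFfin.toFinset, {t | ‖g t - z‖ < r} ∩ (Icc 0 1 ∩ Metric.ball x δ) := by
    intro t ht
    obtain ⟨x, hx, hxt⟩ := mem_iUnion₂.1 (hcov (Ioc_subset_Icc_self ht.2))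
    exact mem_iUnion₂.2 ⟨x, hFfin.mem_toFinset.2 hx, ht.1, Ioc_subset_Icc_self ht.2, hxt⟩
  have hpiece : ∀ x ∈ hFfin.toFinset,
      volume ({t | ‖g t - z‖ < r} ∩ (Icc 0 1 ∩ Metric.ball x δ)) ≤ ENNReal.ofReal (4 / m * r) := by
    intro x hx
    have hx1 := hF (hFfin.mem_toFinset.1 hx)
    refine (Real.volume_le_diam _).trans (Metric.ediam_le fun s hs t ht => ?_)
    rw [edist_dist, dist_comm, Real.dist_eq]
    refine ENNReal.ofReal_le_ofReal ?_
    have h1 := hloc x hx1 s hs.2.1 t ht.2.1 hs.2.2.le ht.2.2.le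
    have h2 := hmle x hx1
    set v := derivWithin g (Icc 0 1) x
    have h3 : ‖((t - s : ℝ) : ℂ) * v‖ = |t - s| * ‖v‖ := by
      rw [norm_mul, Complex.norm_real, Real.norm_eq_abs]
    have h4 := norm_sub_norm_le (((t - s : ℝ) : ℂ) * v) (g t - g s)
    rw [norm_sub_rev (((t - s : ℝ) : ℂ) * v), h3] at h4
    have h5 : ‖g t - g s‖ ≤ 2 * r := by
      have := norm_sub_le_norm_sub_add_norm_sub (g t) z (g s)
      rw [norm_sub_rev z] at this
      have e1 : ‖g s - z‖ < r := hs.1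
      have e2 : ‖g t - z‖ < r := ht.1
      linarith
    rw [div_mul_eq_mul_div, le_div_iff₀ hm]
    have h6 : |t - s| * m ≤ |t - s| * ‖v‖ := by gcongr
    have h7 : 0 ≤ |t - s| * m := by positivity
    nlinarith
  refine (measure_mono hsub).trans ((measure_biUnion_finset_le _ _).trans
    ((Finset.sum_le_sum hpiece).trans ?_))
  rw [Finset.sum_const, nsmul_eq_mul, ← ENNReal.ofReal_natCast, ← ENNReal.ofReal_mul (by positivity)]
  refine ENNReal.ofReal_le_ofReal ?_
  rw [mul_assoc]
  gcongr
  linarith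

end IsRegularArc

/-! ### Discs avoiding a regular curve -/

/-- A plane set all of whose chords have almost the same direction (up to 30 degrees). -/
def IsThin (S : Set ℂ) : Prop :=
  ∃ v : ℂ, v ≠ 0 ∧ ∀ p ∈ S, ∀ q ∈ S, ∃ τ : ℝ, ‖p - q - τ * v‖ ≤ ‖v‖ / 4 * |τ|

/-- A thin set misses one of two discs displaced in the normal direction. -/
theorem IsThin.exists_disc {S : Set ℂ} (hS : IsThin S) (z : ℂ) {r : ℝ} (hr : 0 < r) :
    ∃ z', ‖z' - z‖ + r / 8 ≤ r ∧ ∀ y ∈ S, r / 8 ≤ ‖y - z'‖ := by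
  obtain ⟨v, hv, hS⟩ := hS
  have hv' : 0 < ‖v‖ := norm_pos_iff.2 hv
  set u : ℂ := v / ‖v‖ with hu
  have hu1 : ‖u‖ = 1 := by
    rw [hu, norm_div, Complex.norm_real, norm_norm, div_self hv'.ne']
  have hu0 : u ≠ 0 := norm_ne_zero_iff.1 (by rw [hu1]; exact one_ne_zero)
  by_contra! hcon
  have hdisp : ∀ ε : ℝ, |ε| = r / 2 → ‖z + ε * (Complex.I * u) - z‖ + r / 8 ≤ r := by
    intro ε hε
    rw [add_sub_cancel_left, norm_mul, norm_mul, Complex.norm_I, hu1, Complex.norm_real,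
      Real.norm_eq_abs, hε]
    linarith
  obtain ⟨p, hp, hpz⟩ := hcon _ (hdisp (r / 2) (abs_of_pos (by positivity)))
  obtain ⟨q, hq, hqz⟩ := hcon _ (hdisp (-(r / 2)) (by rw [abs_neg, abs_of_pos (by positivity)]))
  obtain ⟨τ, hτ⟩ := hS p hp q hq
  set e₁ := p - (z + ((r / 2 : ℝ) : ℂ) * (Complex.I * u)) with he₁
  set e₂ := q - (z + ((-(r / 2) : ℝ) : ℂ) * (Complex.I * u)) with he₂
  set e₃ := p - q - τ * v with he₃
  -- in the coordinates given by `u` the chord is at once nearly vertical and nearly horizontal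
  have key : (r : ℂ) * Complex.I - (τ * ‖v‖ : ℝ) = (e₃ - e₁ + e₂) / u := by
    rw [eq_div_iff hu0]
    have hvu : v = ‖v‖ * u := by
      rw [hu, mul_div_cancel₀ _ (Complex.ofReal_ne_zero.2 hv'.ne')]
    have : e₃ - e₁ + e₂ = r * (Complex.I * u) - τ * v := by
      rw [he₁, he₂, he₃]; push_cast; ring
    rw [this]
    nth_rewrite 2 [hvu]
    push_cast
    ring
  have hnorm : ‖(r : ℂ) * Complex.I - (τ * ‖v‖ : ℝ)‖ < |τ * ‖v‖| / 4 + r / 4 := by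
    rw [key, norm_div, hu1, div_one, abs_mul, abs_of_pos hv']
    have e1 := norm_add_le (e₃ - e₁) e₂
    have e2 := norm_sub_le e₃ e₁
    linarith
  have hre := Complex.abs_re_le_norm ((r : ℂ) * Complex.I - (τ * ‖v‖ : ℝ))
  have him := Complex.abs_im_le_norm ((r : ℂ) * Complex.I - (τ * ‖v‖ : ℝ))
  simp only [Complex.sub_re, Complex.mul_re, Complex.ofReal_re, Complex.I_re, Complex.ofReal_im,
    Complex.I_im, Complex.sub_im, Complex.mul_im, mul_zero, mul_one, sub_zero, add_zero,
    zero_sub, abs_neg] at hre him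
  rw [abs_of_pos hr] at him
  linarith

theorem exists_disc_of_isThin {κι : Type*} (F : Finset κι) {S : κι → Set ℂ}
    (hS : ∀ i ∈ F, IsThin (S i)) :
    ∃ κ > 0, ∀ z : ℂ, ∀ r > 0, ∃ z', ‖z' - z‖ + κ * r ≤ r ∧ ∀ i ∈ F, ∀ y ∈ S i,
      κ * r ≤ ‖y - z'‖ := by
  classical
  induction F using Finset.induction_on with
  | empty => exact ⟨1, one_pos, fun z r _ => ⟨z, by simp, by simp⟩⟩
  | insert i F _ ih =>
    obtain ⟨κ, hκ, h⟩ := ih fun l hl => hS l (Finset.mem_insert_of_mem hl)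
    refine ⟨κ / 8, by positivity, fun z r hr => ?_⟩
    obtain ⟨z₁, h1, h2⟩ := h z r hr
    obtain ⟨z₂, h3, h4⟩ := (hS i (Finset.mem_insert_self i F)).exists_disc z₁ (r := κ * r)
      (by positivity)
    refine ⟨z₂, ?_, fun l hl y hy => ?_⟩
    · have := norm_sub_le_norm_sub_add_norm_sub z₂ z₁ z
      linarith
    · rcases Finset.mem_insert.1 hl with rfl | hl
      · linarith [h4 y hy]
      · have h5 := h2 l hl y hy
        have := norm_sub_le_norm_sub_add_norm_sub y z₂ z₁
        linarith

/-- A finite union of regular arcs leaves, in each disc, a concentric fraction of a disc free. -/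
theorem exists_disc_of_isRegularArc {ι : Type*} [Fintype ι] {arc : ι → ℝ → ℂ}
    (harc : ∀ i, IsRegularArc (arc i)) :
    ∃ κ > 0, ∀ z : ℂ, ∀ r > 0, ∃ z', ‖z' - z‖ ≤ r ∧
      ∀ y ∈ ⋃ i, arc i '' Icc 0 1, κ * r ≤ ‖y - z'‖ := by
  have hpiece : ∀ i, ∃ F : Finset ℝ, ∃ S : ℝ → Set ℂ, (∀ x ∈ F, IsThin (S x)) ∧
      arc i '' Icc 0 1 ⊆ ⋃ x ∈ F, S x := by
    intro i
    obtain ⟨δ, hδ, hloc⟩ := (harc i).exists_norm_sub_sub_le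
    obtain ⟨F, hF, hFfin, hcov⟩ :=
      Metric.finite_approx_of_totallyBounded
        (isCompact_Icc (a := (0 : ℝ)) (b := 1)).totallyBounded δ hδ
    refine ⟨hFfin.toFinset, fun x => arc i '' (Icc 0 1 ∩ Metric.ball x δ), fun x hx => ?_, ?_⟩
    · have hx1 := hF (hFfin.mem_toFinset.1 hx)
      refine ⟨_, (harc i).deriv_ne_zero x hx1, ?_⟩
      rintro _ ⟨t, ht, rfl⟩ _ ⟨s, hs, rfl⟩
      exact ⟨t - s, hloc x hx1 s hs.1 t ht.1 hs.2.le ht.2.le⟩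
    · rintro _ ⟨t, ht, rfl⟩
      obtain ⟨x, hx, hxt⟩ := mem_iUnion₂.1 (hcov ht)
      exact mem_iUnion₂.2 ⟨x, hFfin.mem_toFinset.2 hx, t, ⟨ht, hxt⟩, rfl⟩
  choose F S hthin hcov using hpiece
  obtain ⟨κ, hκ, h⟩ := exists_disc_of_isThin (Finset.univ.sigma F)
    (S := fun x : (_ : ι) × ℝ => S x.1 x.2)
    (fun x hx => hthin x.1 x.2 (Finset.mem_sigma.1 hx).2)
  refine ⟨κ, hκ, fun z r hr => ?_⟩
  obtain ⟨z', h1, h2⟩ := h z r hr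
  refine ⟨z', by linarith [mul_pos hκ hr], fun y hy => ?_⟩
  obtain ⟨i, hi⟩ := mem_iUnion.1 hy
  obtain ⟨x, hx, hxy⟩ := mem_iUnion₂.1 (hcov i hi)
  exact h2 ⟨i, x⟩ (Finset.mem_sigma.2 ⟨Finset.mem_univ _, hx⟩) y hxy

/-! ### The chain of a finite family of regular arcs -/

section

variable {ι : Type*} [Fintype ι] [MeasurableSpace ι] [DiscreteMeasurableSpace ι]

variable (ι) in
/-- The parameter measure of a family of arcs: Lebesgue measure on a copy of `[0, 1]` for each
arc. -/
noncomputable def arcMeasure : Measure (ι × ℝ) :=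
  Measure.sum fun i => (volume.restrict (Ioc 0 1)).map (Prod.mk i)

theorem arcMeasure_apply (s : Set (ι × ℝ)) :
    arcMeasure ι s = ∑ i, volume.restrict (Ioc 0 1) {t | (i, t) ∈ s} := by
  rw [arcMeasure, Measure.sum_apply_of_countable, tsum_fintype]
  refine Finset.sum_congr rfl fun i _ => ?_
  rw [(measurableEmbedding_prodMk_left i).map_apply]
  rfl

instance : IsFiniteMeasure (arcMeasure ι) :=
  ⟨by rw [arcMeasure_apply]; simp⟩

theorem ae_arcMeasure {p : ι × ℝ → Prop} (h : ∀ i, ∀ t ∈ Icc (0 : ℝ) 1, p (i, t)) :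
    ∀ᵐ x ∂arcMeasure ι, p x := by
  rw [ae_iff, arcMeasure_apply]
  refine Finset.sum_eq_zero fun i _ => ?_
  rw [Measure.restrict_apply' measurableSet_Ioc]
  convert measure_empty (μ := volume)
  ext t
  simp only [mem_inter_iff, mem_empty_iff_false, iff_false, not_and]
  exact fun ht ht' => ht (h i t (Ioc_subset_Icc_self ht'))

theorem aestronglyMeasurable_arcMeasure {E : Type*} [NormedAddCommGroup E] {g : ι × ℝ → E}
    (h : ∀ i, ContinuousOn (fun t => g (i, t)) (Icc 0 1)) :
    AEStronglyMeasurable g (arcMeasure ι) := by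
  refine AEStronglyMeasurable.sum_measure fun i => ?_
  rw [(measurableEmbedding_prodMk_left i).aestronglyMeasurable_map_iff]
  exact ((h i).mono Ioc_subset_Icc_self).aestronglyMeasurable measurableSet_Ioc

theorem integral_arcMeasure {E : Type*} [NormedAddCommGroup E] [NormedSpace ℝ E] {g : ι × ℝ → E}
    (hg : Integrable g (arcMeasure ι)) :
    ∫ x, g x ∂arcMeasure ι = ∑ i, ∫ t in (0 : ℝ)..1, g (i, t) := by
  rw [arcMeasure, integral_sum_measure hg, tsum_fintype]
  refine Finset.sum_congr rfl fun i _ => ?_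
  rw [(measurableEmbedding_prodMk_left i).integral_map, intervalIntegral.integral_of_le zero_le_one]

/-- A nonempty finite family of regular arcs, with density `γ' / (2 π i)`, is a regular chain. -/
theorem exists_regularChain_arcMeasure [Nonempty ι] {arc : ι → ℝ → ℂ}
    (harc : ∀ i, IsRegularArc (arc i)) :
    ∃ L C, RegularChain (arcMeasure ι) (fun x => arc x.1 x.2)
      (fun x => (2 * Real.pi * Complex.I)⁻¹ * derivWithin (arc x.1) (Icc 0 1) x.2)
      (⋃ i, arc i '' Icc 0 1) L C := by
  choose L hL0 hL using fun i => (harc i).exists_norm_derivWithin_le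
  choose C hC0 hC using fun i => (harc i).exists_volume_le
  refine ⟨‖(2 * Real.pi * Complex.I)⁻¹‖ * ∑ i, L i, ∑ i, C i, ?_⟩
  refine
    { isCompact := isCompact_iUnion fun i => isCompact_Icc.image_of_continuousOn (harc i).continuousOn
      nonempty := ?_
      aemeasurable :=
        (aestronglyMeasurable_arcMeasure fun i => (harc i).continuousOn).aemeasurable
      aemeasurable_density :=
        (aestronglyMeasurable_arcMeasure fun i =>
          ((harc i).continuousOn_derivWithin).const_smul (2 * Real.pi * Complex.I)⁻¹).aemeasurable
      bound_nonneg := mul_nonneg (norm_nonneg _) (Finset.sum_nonneg fun i _ => hL0 i)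
      const_pos := Finset.sum_pos (fun i _ => hC0 i) Finset.univ_nonempty
      norm_density_le := ae_arcMeasure fun i t ht => ?_
      mem := ae_arcMeasure fun i t ht => mem_iUnion.2 ⟨i, t, ht, rfl⟩
      measure_le := fun s _ r hr => ?_ }
  · obtain ⟨i⟩ := ‹Nonempty ι›
    exact ⟨arc i 0, mem_iUnion.2 ⟨i, 0, left_mem_Icc.2 zero_le_one, rfl⟩⟩
  · rw [norm_mul]
    gcongr
    exact (hL i t ht).trans
      (Finset.single_le_sum (f := L) (fun l _ => hL0 l) (Finset.mem_univ i))
  · rw [arcMeasure_apply, Finset.sum_mul, ENNReal.ofReal_sum_of_nonneg fun i _ =>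
      mul_nonneg (hC0 i).le hr.le]
    exact Finset.sum_le_sum fun i _ => hC i s r hr

end

/-! ### The Cauchy integral of `1` over an arc -/

/-- The unnormalized Cauchy integral of `1` over the part of an arc with parameters in `[c, d]`. -/
noncomputable def arcCauchy (g : ℝ → ℂ) (c d : ℝ) (z : ℂ) : ℂ :=
  ∫ t in c..d, (g t - z)⁻¹ * derivWithin g (Icc 0 1) t

namespace IsRegularArc

variable {g : ℝ → ℂ} {c d : ℝ} {z : ℂ}

theorem continuousOn_inv_mul (hg : IsRegularArc g) (hc : 0 ≤ c) (hd : d ≤ 1)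
    (hz : z ∉ g '' Icc c d) :
    ContinuousOn (fun t => (g t - z)⁻¹ * derivWithin g (Icc 0 1) t) (Icc c d) := by
  have hsub : Icc c d ⊆ Icc 0 1 := Icc_subset_Icc hc hd
  refine ContinuousOn.mul (ContinuousOn.inv₀ ((hg.continuousOn.mono hsub).sub continuousOn_const)
    fun t ht h => hz ⟨t, ht, sub_eq_zero.1 h⟩) (hg.continuousOn_derivWithin.mono hsub)

/-- The derivative of the Cauchy integral of `1` over an arc depends on the end points only, since
`(g t - z)⁻²` times the tangent has the primitive `-(g t - z)⁻¹`. -/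
theorem hasDerivAt_arcCauchy (hg : IsRegularArc g) (hc : 0 ≤ c) (hcd : c ≤ d) (hd : d ≤ 1)
    (hz : z ∉ g '' Icc c d) :
    HasDerivAt (arcCauchy g c d) ((g c - z)⁻¹ - (g d - z)⁻¹) z := by
  have hsub : Icc c d ⊆ Icc 0 1 := Icc_subset_Icc hc hd
  have hcompact : IsCompact (g '' Icc c d) :=
    isCompact_Icc.image_of_continuousOn (hg.continuousOn.mono hsub)
  obtain ⟨r, hr, hball⟩ := Metric.isOpen_iff.1 hcompact.isClosed.isOpen_compl z hz
  obtain ⟨L, hL0, hL⟩ := hg.exists_norm_derivWithin_le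
  have hU : uIoc c d ⊆ Icc c d := by rw [uIoc_of_le hcd]; exact Ioc_subset_Icc_self
  have hcont2 : ContinuousOn (fun t => ((g t - z) ^ 2)⁻¹ * derivWithin g (Icc 0 1) t)
      (Icc c d) := by
    refine ContinuousOn.mul (ContinuousOn.inv₀ (((hg.continuousOn.mono hsub).sub
      continuousOn_const).pow 2) fun t ht h => hz ⟨t, ht, sub_eq_zero.1 ?_⟩)
      (hg.continuousOn_derivWithin.mono hsub)
    exact pow_eq_zero_iff two_ne_zero |>.1 h
  have hftc : ∫ t in c..d, ((g t - z) ^ 2)⁻¹ * derivWithin g (Icc 0 1) t =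
      (g c - z)⁻¹ - (g d - z)⁻¹ := by
    rw [intervalIntegral.integral_eq_sub_of_hasDerivAt_of_le (f := fun t => -(g t - z)⁻¹) hcd]
    · ring
    · exact (ContinuousOn.inv₀ ((hg.continuousOn.mono hsub).sub continuousOn_const)
        fun t ht h => hz ⟨t, ht, sub_eq_zero.1 h⟩).neg
    · intro t ht
      have h1 := (hg.hasDerivAt ⟨hc.trans_lt ht.1, ht.2.trans_le hd⟩).sub_const z
      have hne : g t - z ≠ 0 := fun h => hz ⟨t, Ioo_subset_Icc_self ht, sub_eq_zero.1 h⟩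
      refine (h1.inv hne).neg.congr_deriv ?_
      field_simp
    · exact (hcont2.mono (by rw [uIcc_of_le hcd])).intervalIntegrable
  have hfar : ∀ x ∈ Metric.ball z (r / 2), ∀ t ∈ Icc c d, r / 2 ≤ ‖g t - x‖ := by
    intro x hx t ht
    by_contra! hlt
    refine hball (?_ : g t ∈ Metric.ball z r) ⟨t, ht, rfl⟩
    rw [mem_ball_iff_norm] at hx ⊢
    have := norm_sub_le_norm_sub_add_norm_sub (g t) x z
    linarith
  have hmem : ∀ x ∈ Metric.ball z (r / 2), x ∉ g '' Icc c d := by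
    rintro x hx ⟨t, ht, rfl⟩
    have := hfar _ hx t ht
    rw [sub_self, norm_zero] at this
    linarith
  have key := intervalIntegral.hasDerivAt_integral_of_dominated_loc_of_deriv_le (μ := volume)
    (F := fun x t => (g t - x)⁻¹ * derivWithin g (Icc 0 1) t)
    (F' := fun x t => ((g t - x) ^ 2)⁻¹ * derivWithin g (Icc 0 1) t) (x₀ := z) (a := c) (b := d)
    (bound := fun _ => ((r / 2) ^ 2)⁻¹ * L)
    (Metric.ball_mem_nhds z (half_pos hr)) ?_ ?_ ?_ ?_ intervalIntegrable_const ?_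
  · rw [hftc] at key
    exact key.2
  · filter_upwards [Metric.ball_mem_nhds z (half_pos hr)] with x hx
    exact ((hg.continuousOn_inv_mul hc hd (hmem x hx)).mono hU).aestronglyMeasurable
      measurableSet_uIoc
  · exact ((hg.continuousOn_inv_mul hc hd hz).mono (by rw [uIcc_of_le hcd])).intervalIntegrable
  · exact (hcont2.mono hU).aestronglyMeasurable measurableSet_uIoc
  · refine Eventually.of_forall fun t ht x hx => ?_
    rw [norm_mul, norm_inv, norm_pow]
    gcongr
    · exact hfar x hx t (hU ht)
    · exact hL t (hsub (hU ht))
  · refine Eventually.of_forall fun t ht x hx => ?_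
    have hne : g t - x ≠ 0 := fun h => hmem x hx ⟨t, hU ht, sub_eq_zero.1 h⟩
    have h1 : HasDerivAt (fun x => g t - x) (-1) x := by
      simpa using (hasDerivAt_id x).const_sub (g t)
    refine ((h1.inv hne).mul_const _).congr_deriv ?_
    field_simp

theorem tendsto_arcCauchy_cobounded (hg : IsRegularArc g) :
    Tendsto (arcCauchy g 0 1) (Bornology.cobounded ℂ) (𝓝 0) := by
  obtain ⟨L, hL0, hL⟩ := hg.exists_norm_derivWithin_le
  obtain ⟨R, hR⟩ := isCompact_Icc.exists_bound_of_continuousOn hg.continuousOn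
  have hlim : Tendsto (fun z : ℂ => (‖z‖ - R)⁻¹ * L) (Bornology.cobounded ℂ) (𝓝 0) := by
    have h1 : Tendsto (fun z : ℂ => ‖z‖ - R) (Bornology.cobounded ℂ) atTop :=
      tendsto_atTop_add_const_right _ _ tendsto_norm_cobounded_atTop
    simpa using (tendsto_inv_atTop_zero.comp h1).mul_const L
  refine squeeze_zero_norm' ?_ hlim
  filter_upwards [tendsto_norm_cobounded_atTop.eventually_gt_atTop R] with z hz
  have := intervalIntegral.norm_integral_le_of_norm_le_const (a := 0) (b := 1)
    (f := fun t => (g t - z)⁻¹ * derivWithin g (Icc 0 1) t) (C := (‖z‖ - R)⁻¹ * L) ?_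
  · simpa [arcCauchy] using this
  · intro t ht
    rw [uIoc_of_le zero_le_one] at ht
    have ht' := Ioc_subset_Icc_self ht
    rw [norm_mul, norm_inv]
    have h0 : 0 < ‖z‖ - R := sub_pos.2 hz
    gcongr
    · have := norm_sub_norm_le z (g t)
      rw [norm_sub_rev] at this
      linarith [hR t ht']
    · exact hL t ht'

/-- Off the arc, the logarithm of `(g t - z) / u` is a primitive, provided the arc avoids the ray
from `z` in direction `-u`. -/
theorem arcCauchy_eq_log_sub_log (hg : IsRegularArc g) (hc : 0 < c) (hcd : c ≤ d) (hd : d < 1)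
    {u : ℂ} (hu : u ≠ 0) (hz : ∀ t ∈ Icc c d, (g t - z) / u ∈ Complex.slitPlane) :
    arcCauchy g c d z = Complex.log ((g d - z) / u) - Complex.log ((g c - z) / u) := by
  have hz' : z ∉ g '' Icc c d := by
    rintro ⟨t, ht, rfl⟩
    have := hz t ht
    rw [sub_self, zero_div] at this
    exact Complex.zero_notMem_slitPlane this
  refine intervalIntegral.integral_eq_sub_of_hasDerivAt
    (f := fun t => Complex.log ((g t - z) / u)) (fun t ht => ?_)
    (((hg.continuousOn_inv_mul hc.le hd.le hz').mono (by rw [uIcc_of_le hcd])).intervalIntegrable)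
  rw [uIcc_of_le hcd] at ht
  have h1 := ((hg.hasDerivAt ⟨hc.trans_le ht.1, ht.2.trans_lt hd⟩).sub_const z).div_const u
  have hne : g t - z ≠ 0 := fun h => hz' ⟨t, ht, sub_eq_zero.1 h⟩
  refine (h1.clog_real (hz t ht)).congr_deriv ?_
  field_simp

end IsRegularArc

/-- The logarithms on the two sides of the real axis differ by `π i`. -/
theorem log_sub_log_neg_of_im_pos {x : ℂ} (hx : 0 < x.im) :
    Complex.log x - Complex.log (-x) = Real.pi * Complex.I := by
  simp only [Complex.log, norm_neg, Complex.arg_neg_eq_arg_sub_pi_of_im_pos hx]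
  push_cast
  ring

/-- The jump of the Cauchy integral of `1` across a short arc `g`: if in the coordinates `h`
centred at `p` with real axis in the direction `v` the arc runs within 45 degrees from the real
axis, the values at `p + i ε v` and `p - i ε v` differ by `2 π i` in the limit. -/
theorem tendsto_arcCauchy_sub {g : ℝ → ℂ} (hg : IsRegularArc g) {c d t₀ : ℝ} (hc : 0 < c)
    (hct : c < t₀) (htd : t₀ < d) (hd : d < 1) {v : ℂ} (hv : v ≠ 0) {h : ℝ → ℂ}
    (hh : ∀ t, g t = g t₀ + h t * v)
    (hcone : ∀ t ∈ Icc c d, ‖h t - (t - t₀ : ℝ)‖ ≤ |t - t₀| / 4) :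
    Tendsto (fun ε : ℝ => arcCauchy g c d (g t₀ + ε * (Complex.I * v)) -
      arcCauchy g c d (g t₀ - ε * (Complex.I * v))) (𝓝[>] 0) (𝓝 (2 * Real.pi * Complex.I)) := by
  have hcd : c ≤ d := (hct.trans htd).le
  have hIv : Complex.I * v ≠ 0 := mul_ne_zero Complex.I_ne_zero hv
  have hIv' : -(Complex.I * v) ≠ 0 := neg_ne_zero.2 hIv
  have hre : ∀ t ∈ Icc c d, |(h t).re - (t - t₀)| ≤ |t - t₀| / 4 := fun t ht => by
    have := (Complex.abs_re_le_norm _).trans (hcone t ht)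
    simpa using this
  have hslit : ∀ σ : ℝ, (σ = 1 ∨ σ = -1) → ∀ ε : ℝ, 0 < ε → ∀ t ∈ Icc c d,
      (ε : ℂ) + σ * (Complex.I * h t) ∈ Complex.slitPlane := by
    intro σ hσ ε hε t ht
    rw [Complex.mem_slitPlane_iff]
    have h1 := hre t ht
    by_cases h0 : (h t).re = 0
    · left
      rw [h0, zero_sub, abs_neg] at h1
      have h2 : t - t₀ = 0 := abs_eq_zero.1 (le_antisymm (by linarith) (abs_nonneg _))
      have h3 := hcone t ht
      rw [h2] at h3
      have h4 : h t = 0 := by simpa using h3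
      simpa [h4] using hε
    · right
      rcases hσ with rfl | rfl <;> simpa using h0
  have hform : ∀ ε : ℝ, ∀ t, (g t - (g t₀ + ε * (Complex.I * v))) / (-(Complex.I * v)) =
      ε + (1 : ℝ) * (Complex.I * h t) := by
    intro ε t
    rw [div_eq_iff hIv', hh t]
    push_cast
    linear_combination h t * v * Complex.I_sq
  have hform' : ∀ ε : ℝ, ∀ t, (g t - (g t₀ - ε * (Complex.I * v))) / (Complex.I * v) =
      ε + (-1 : ℝ) * (Complex.I * h t) := by
    intro ε t
    rw [div_eq_iff hIv, hh t]
    push_cast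
    linear_combination h t * v * Complex.I_sq
  have hlim : ∀ σ : ℝ, (σ = 1 ∨ σ = -1) → ∀ t ∈ Icc c d, t ≠ t₀ →
      Tendsto (fun ε : ℝ => Complex.log ((ε : ℂ) + σ * (Complex.I * h t))) (𝓝[>] 0)
        (𝓝 (Complex.log (σ * (Complex.I * h t)))) := by
    intro σ hσ t ht hne
    have hre0 : (h t).re ≠ 0 := fun h0 => by
      have h1 := hre t ht
      rw [h0, zero_sub, abs_neg] at h1
      exact hne (sub_eq_zero.1 (abs_eq_zero.1 (le_antisymm (by linarith) (abs_nonneg _))))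
    have hmem : (σ : ℂ) * (Complex.I * h t) ∈ Complex.slitPlane := by
      rw [Complex.mem_slitPlane_iff]
      right
      rcases hσ with rfl | rfl <;> simpa using hre0
    have h1 : Tendsto (fun ε : ℝ => (ε : ℂ) + σ * (Complex.I * h t)) (𝓝[>] 0)
        (𝓝 (σ * (Complex.I * h t))) := by
      have h2 : Tendsto (fun ε : ℝ => (ε : ℂ) + σ * (Complex.I * h t)) (𝓝 0)
          (𝓝 (((0 : ℝ) : ℂ) + σ * (Complex.I * h t))) :=
        (Complex.continuous_ofReal.tendsto 0).add_const _
      rw [Complex.ofReal_zero, zero_add] at h2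
      exact h2.mono_left nhdsWithin_le_nhds
    exact (continuousAt_clog hmem).tendsto.comp h1
  have hL := ((hlim 1 (Or.inl rfl) d (right_mem_Icc.2 hcd) htd.ne').sub
    (hlim 1 (Or.inl rfl) c (left_mem_Icc.2 hcd) hct.ne)).sub
    ((hlim (-1) (Or.inr rfl) d (right_mem_Icc.2 hcd) htd.ne').sub
    (hlim (-1) (Or.inr rfl) c (left_mem_Icc.2 hcd) hct.ne))
  have hval : Complex.log ((1 : ℝ) * (Complex.I * h d)) - Complex.log ((1 : ℝ) * (Complex.I * h c))
      - (Complex.log ((-1 : ℝ) * (Complex.I * h d)) - Complex.log ((-1 : ℝ) * (Complex.I * h c))) =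
      2 * Real.pi * Complex.I := by
    have hdpos : 0 < (Complex.I * h d).im := by
      have h1 := hre d (right_mem_Icc.2 hcd)
      rw [abs_of_pos (sub_pos.2 htd)] at h1
      have h2 := (abs_le.1 h1).1
      simp only [Complex.mul_im, Complex.I_re, Complex.I_im, zero_mul, one_mul, zero_add]
      linarith
    have hcpos : 0 < (-(Complex.I * h c)).im := by
      have h1 := hre c (left_mem_Icc.2 hcd)
      rw [abs_of_neg (sub_neg.2 hct)] at h1
      have h2 := (abs_le.1 h1).2
      simp only [Complex.neg_im, Complex.mul_im, Complex.I_re, Complex.I_im, zero_mul, one_mul,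
        zero_add]
      linarith
    have e1 := log_sub_log_neg_of_im_pos hdpos
    have e2 := log_sub_log_neg_of_im_pos hcpos
    rw [neg_neg] at e2
    push_cast
    rw [one_mul, one_mul, neg_one_mul, neg_one_mul]
    linear_combination e1 + e2
  rw [hval] at hL
  refine hL.congr' ?_
  filter_upwards [self_mem_nhdsWithin] with ε hε
  have hε' : 0 < ε := hε
  rw [hg.arcCauchy_eq_log_sub_log hc hcd hd hIv' fun t ht => by
      rw [hform]; exact hslit 1 (Or.inl rfl) ε hε' t ht,
    hg.arcCauchy_eq_log_sub_log hc hcd hd hIv fun t ht => by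
      rw [hform']; exact hslit (-1) (Or.inr rfl) ε hε' t ht]
  simp only [hform, hform']

/-! ### The Cauchy integral of `1` over a boundary contour -/

/-- A finite family of regular arcs, closed up by the permutation `next`, without multiple points,
which bounds the bounded open set `D` on its left. -/
structure IsContour {ι : Type*} (arc : ι → ℝ → ℂ) (next : Equiv.Perm ι) (D : Set ℂ) : Prop where
  regular : ∀ i, IsRegularArc (arc i)
  joined : ∀ i, arc i 1 = arc (next i) 0
  simple : ∀ i l, ∀ s ∈ Ico (0 : ℝ) 1, ∀ t ∈ Ico (0 : ℝ) 1, arc i s = arc l t → i = l ∧ s = t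
  isOpen : IsOpen D
  isBounded : Bornology.IsBounded D
  iUnion_eq : ⋃ i, arc i '' Icc 0 1 = frontier D
  left_side : ∀ i, ∀ t ∈ Ioo (0 : ℝ) 1, ∀ᶠ ε : ℝ in 𝓝[>] 0,
    arc i t + ε * (Complex.I * derivWithin (arc i) (Icc 0 1) t) ∈ D
  right_side : ∀ i, ∀ t ∈ Ioo (0 : ℝ) 1, ∀ᶠ ε : ℝ in 𝓝[>] 0,
    arc i t - ε * (Complex.I * derivWithin (arc i) (Icc 0 1) t) ∉ closure D

/-- A set that does not meet the frontier of `D` lies on one side if it is connected. -/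
theorem subset_of_isPreconnected_of_disjoint_frontier {D S : Set ℂ} (hD : IsOpen D)
    (hS : IsPreconnected S) (hdisj : Disjoint S (frontier D)) {x : ℂ} (hxS : x ∈ S) :
    (x ∈ D → S ⊆ D) ∧ (x ∉ D → Disjoint S D) := by
  have hcov : S ⊆ D ∪ (closure D)ᶜ := fun y hy => by
    by_cases hyD : y ∈ D
    · exact Or.inl hyD
    · refine Or.inr fun hyc => hdisj.le_bot ⟨hy, ?_⟩
      rw [hD.frontier_eq]
      exact ⟨hyc, hyD⟩
  have hd : Disjoint D (closure D)ᶜ := disjoint_compl_right.mono_left subset_closure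
  refine ⟨fun hx => hS.subset_left_of_subset_union hD isClosed_closure.isOpen_compl hd hcov
    ⟨x, hxS, hx⟩, fun hx => ?_⟩
  exact hd.symm.mono_left (hS.subset_right_of_subset_union hD isClosed_closure.isOpen_compl hd hcov
    ⟨x, hxS, (hcov hxS).resolve_left hx⟩)

/-- A function that is constant near each point of a preconnected set, up to a set `Γ` with dense
complement, is constant off `Γ`. -/
theorem exists_eq_const_of_eventually {S Γ : Set ℂ} (hS : IsPreconnected S) (hΓ : Dense Γᶜ)
    (hsub : Γᶜ ⊆ S) {g : ℂ → ℂ} (hg : ∀ z ∈ S, ∃ c, ∀ᶠ y in 𝓝 z, y ∉ Γ → g y = c) :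
    ∃ c, ∀ y, y ∉ Γ → g y = c := by
  obtain ⟨y₀, hy₀⟩ := hΓ.nonempty
  refine ⟨g y₀, fun y hy => ?_⟩
  set A : Set ℂ := {z | ∀ᶠ y in 𝓝 z, y ∉ Γ → g y = g y₀} with hA
  set B : Set ℂ := {z | ∀ᶠ y in 𝓝 z, y ∉ Γ → g y ≠ g y₀} with hB
  have hAo : IsOpen A := isOpen_iff_mem_nhds.2 fun z hz => eventually_eventually_nhds.2 hz
  have hBo : IsOpen B := isOpen_iff_mem_nhds.2 fun z hz => eventually_eventually_nhds.2 hz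
  have hAB : Disjoint A B := by
    refine Set.disjoint_left.2 fun z hzA hzB => ?_
    obtain ⟨x, hx, hxΓ⟩ := mem_closure_iff_nhds.1 (hΓ z) _ (hzA.and hzB)
    exact hx.2 hxΓ (hx.1 hxΓ)
  have hcov : S ⊆ A ∪ B := fun z hz => by
    obtain ⟨c, hc⟩ := hg z hz
    by_cases hcg : c = g y₀
    · exact Or.inl (hc.mono fun x hx hxΓ => (hx hxΓ).trans hcg)
    · exact Or.inr (hc.mono fun x hx hxΓ => by rw [hx hxΓ]; exact hcg)
  have hy₀A : y₀ ∈ A := (hcov (hsub hy₀)).resolve_right fun h => h.self_of_nhds hy₀ rfl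
  exact (hS.subset_left_of_subset_union hAo hBo hAB hcov ⟨y₀, hsub hy₀, hy₀A⟩
    (hsub hy)).self_of_nhds hy

section

variable {ι : Type*} {arc : ι → ℝ → ℂ} {next : Equiv.Perm ι} {D : Set ℂ}

theorem IsContour.dense_compl_frontier (h : IsContour arc next D) : Dense (frontier D)ᶜ := by
  rw [← interior_eq_empty_iff_dense_compl, ← frontier_compl]
  exact interior_frontier h.isOpen.isClosed_compl

/-- A point interior to an arc is passed only once. -/
theorem IsContour.eq_of_arc_eq (h : IsContour arc next D) {i l : ι} {t s : ℝ}
    (ht : t ∈ Ioo (0 : ℝ) 1) (hs : s ∈ Icc (0 : ℝ) 1) (hts : arc i t = arc l s) :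
    i = l ∧ t = s := by
  rcases hs.2.eq_or_lt with rfl | hs1
  · rw [h.joined] at hts
    exact absurd (h.simple i (next l) t ⟨ht.1.le, ht.2⟩ 0 ⟨le_rfl, zero_lt_one⟩ hts).2 ht.1.ne'
  · exact h.simple i l t ⟨ht.1.le, ht.2⟩ s ⟨hs.1, hs1⟩ hts

variable [Fintype ι]

/-- The unnormalized Cauchy integral of `1` over a family of arcs. -/
noncomputable def contourCauchy (arc : ι → ℝ → ℂ) (z : ℂ) : ℂ := ∑ i, arcCauchy (arc i) 0 1 z

/-- Off the contour the derivative of the Cauchy integral of `1` telescopes to zero. -/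
theorem IsContour.hasDerivAt_contourCauchy (h : IsContour arc next D) {z : ℂ}
    (hz : z ∉ frontier D) : HasDerivAt (contourCauchy arc) 0 z := by
  have h1 : ∀ i ∈ Finset.univ, HasDerivAt (arcCauchy (arc i) 0 1)
      ((arc i 0 - z)⁻¹ - (arc i 1 - z)⁻¹) z := fun i _ =>
    (h.regular i).hasDerivAt_arcCauchy le_rfl zero_le_one le_rfl fun hmem =>
      hz (h.iUnion_eq ▸ mem_iUnion.2 ⟨i, hmem⟩)
  refine (HasDerivAt.fun_sum h1).congr_deriv ?_
  rw [Finset.sum_sub_distrib, sub_eq_zero]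
  simp_rw [h.joined]
  exact (Equiv.sum_comp next fun i => (arc i 0 - z)⁻¹).symm

theorem IsContour.contourCauchy_eq_of_isPreconnected (h : IsContour arc next D) {S : Set ℂ}
    (hS : IsPreconnected S) (hdisj : Disjoint S (frontier D)) {x y : ℂ} (hx : x ∈ S) (hy : y ∈ S) :
    contourCauchy arc x = contourCauchy arc y := by
  have hsub : S ⊆ (frontier D)ᶜ := disjoint_left.1 hdisj
  have hopen : IsOpen (frontier D)ᶜ := isClosed_frontier.isOpen_compl
  have hxy : y ∈ connectedComponentIn (frontier D)ᶜ x :=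
    hS.subset_connectedComponentIn hx hsub hy
  have hd : ∀ z ∈ connectedComponentIn (frontier D)ᶜ x, HasDerivAt (contourCauchy arc) 0 z :=
    fun z hz => h.hasDerivAt_contourCauchy (connectedComponentIn_subset _ _ hz)
  exact hopen.connectedComponentIn.is_const_of_deriv_eq_zero isPreconnected_connectedComponentIn
    (fun z hz => (hd z hz).differentiableAt.differentiableWithinAt)
    (fun z hz => (hd z hz).deriv) (mem_connectedComponentIn (hsub hx)) hxy

theorem IsContour.tendsto_contourCauchy_cobounded (h : IsContour arc next D) :
    Tendsto (contourCauchy arc) (Bornology.cobounded ℂ) (𝓝 0) := by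
  have := tendsto_finsetSum (Finset.univ : Finset ι)
    fun i _ => (h.regular i).tendsto_arcCauchy_cobounded
  rwa [Finset.sum_const_zero] at this

/-- Near an interior point of an arc, in the coordinate `(z - arc t₀) / v` with `v` the tangent, the
arc is a small perturbation of the real axis. -/
theorem IsRegularArc.exists_chart {g : ℝ → ℂ} (hg : IsRegularArc g) {t₀ : ℝ}
    (ht₀ : t₀ ∈ Ioo (0 : ℝ) 1) :
    ∃ δ > 0, 0 < t₀ - δ ∧ t₀ + δ < 1 ∧ ∀ s ∈ Icc (t₀ - δ) (t₀ + δ), ∀ t ∈ Icc (t₀ - δ) (t₀ + δ),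
      ‖(g t - g t₀) / derivWithin g (Icc 0 1) t₀ - (g s - g t₀) / derivWithin g (Icc 0 1) t₀ -
        (t - s : ℝ)‖ ≤ |t - s| / 4 := by
  obtain ⟨δ, hδ, hloc⟩ := hg.exists_norm_sub_sub_le
  have hv := hg.deriv_ne_zero t₀ (Ioo_subset_Icc_self ht₀)
  set v := derivWithin g (Icc 0 1) t₀
  have hv' : 0 < ‖v‖ := norm_pos_iff.2 hv
  obtain ⟨h0, h1⟩ := ht₀
  have hm : 0 < min t₀ (1 - t₀) := lt_min h0 (sub_pos.2 h1)
  refine ⟨min δ (min t₀ (1 - t₀) / 2), lt_min hδ (half_pos hm), ?_, ?_, ?_⟩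
  · have e1 := min_le_right δ (min t₀ (1 - t₀) / 2)
    have e2 := min_le_left t₀ (1 - t₀)
    linarith
  · have e1 := min_le_right δ (min t₀ (1 - t₀) / 2)
    have e2 := min_le_right t₀ (1 - t₀)
    linarith
  · intro s hs t ht
    have e1 := min_le_right δ (min t₀ (1 - t₀) / 2)
    have e2 := min_le_left t₀ (1 - t₀)
    have e3 := min_le_right t₀ (1 - t₀)
    have e4 := min_le_left δ (min t₀ (1 - t₀) / 2)
    have h := hloc t₀ ⟨h0.le, h1.le⟩ s ⟨by linarith [hs.1], by linarith [hs.2]⟩ t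
      ⟨by linarith [ht.1], by linarith [ht.2]⟩
      (abs_le.2 ⟨by linarith [hs.1], by linarith [hs.2]⟩)
      (abs_le.2 ⟨by linarith [ht.1], by linarith [ht.2]⟩)
    have e5 : (g t - g t₀) / v - (g s - g t₀) / v - (t - s : ℝ) =
        (g t - g s - (t - s : ℝ) * v) / v := by
      field_simp
      ring
    rw [e5, norm_div, div_le_iff₀ hv']
    linarith

/-- The Cauchy integral of `1` jumps by `2 π i` at every interior point of an arc. -/
theorem IsContour.tendsto_contourCauchy_sub (h : IsContour arc next D) {i : ι} {t₀ : ℝ}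
    (ht₀ : t₀ ∈ Ioo (0 : ℝ) 1)
    (hoff : ∀ᶠ ε : ℝ in 𝓝[>] 0,
      arc i t₀ + ε * (Complex.I * derivWithin (arc i) (Icc 0 1) t₀) ∉ frontier D ∧
      arc i t₀ - ε * (Complex.I * derivWithin (arc i) (Icc 0 1) t₀) ∉ frontier D) :
    Tendsto (fun ε : ℝ =>
      contourCauchy arc (arc i t₀ + ε * (Complex.I * derivWithin (arc i) (Icc 0 1) t₀)) -
      contourCauchy arc (arc i t₀ - ε * (Complex.I * derivWithin (arc i) (Icc 0 1) t₀)))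
      (𝓝[>] 0) (𝓝 (2 * Real.pi * Complex.I)) := by
  classical
  have hg := h.regular i
  obtain ⟨δ, hδ, hc, hd, hchart⟩ := hg.exists_chart ht₀
  have hv := hg.deriv_ne_zero t₀ (Ioo_subset_Icc_self ht₀)
  set v := derivWithin (arc i) (Icc 0 1) t₀ with hvdef
  set c := t₀ - δ with hcdef
  set d := t₀ + δ with hddef
  have hcd : c ≤ d := by linarith
  have hjump := tendsto_arcCauchy_sub hg hc (by linarith : c < t₀) (by linarith : t₀ < d) hd hv
    (h := fun t => (arc i t - arc i t₀) / v) (fun t => by field_simp; ring) (fun t ht => by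
      have := hchart t₀ ⟨by linarith, by linarith⟩ t ht
      simpa using this)
  set rest : ℂ → ℂ := fun z => ∑ l ∈ Finset.univ.erase i, arcCauchy (arc l) 0 1 z +
    (arcCauchy (arc i) 0 c z + arcCauchy (arc i) d 1 z) with hrest
  have hcont : ContinuousAt rest (arc i t₀) := by
    refine ContinuousAt.add (tendsto_finsetSum _ fun l hl => ?_) (ContinuousAt.add ?_ ?_)
    · refine ((h.regular l).hasDerivAt_arcCauchy le_rfl zero_le_one le_rfl ?_).continuousAt
      rintro ⟨s, hs, hst⟩
      exact Finset.ne_of_mem_erase hl (h.eq_of_arc_eq ht₀ hs hst.symm).1.symm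
    · refine (hg.hasDerivAt_arcCauchy le_rfl hc.le (by linarith) ?_).continuousAt
      rintro ⟨s, hs, hst⟩
      have := (h.eq_of_arc_eq ht₀ ⟨hs.1, by linarith [hs.2]⟩ hst.symm).2
      linarith [hs.2]
    · refine (hg.hasDerivAt_arcCauchy (by linarith) hd.le le_rfl ?_).continuousAt
      rintro ⟨s, hs, hst⟩
      have := (h.eq_of_arc_eq ht₀ ⟨by linarith [hs.1], hs.2⟩ hst.symm).2
      linarith [hs.1]
  have hsplit : ∀ z, z ∉ frontier D → contourCauchy arc z = arcCauchy (arc i) c d z + rest z := by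
    intro z hz
    have hzi : z ∉ arc i '' Icc 0 1 := fun hmem => hz (h.iUnion_eq ▸ mem_iUnion.2 ⟨i, hmem⟩)
    have hint : ∀ x y, 0 ≤ x → x ≤ y → y ≤ 1 → IntervalIntegrable
        (fun t => (arc i t - z)⁻¹ * derivWithin (arc i) (Icc 0 1) t) volume x y := by
      intro x y hx hxy hy
      refine ((hg.continuousOn_inv_mul le_rfl le_rfl hzi).mono ?_).intervalIntegrable
      rw [uIcc_of_le hxy]
      exact Icc_subset_Icc hx hy
    have e1 : arcCauchy (arc i) 0 1 z =
        arcCauchy (arc i) 0 c z + arcCauchy (arc i) c d z + arcCauchy (arc i) d 1 z := by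
      simp only [arcCauchy]
      rw [intervalIntegral.integral_add_adjacent_intervals (hint 0 c le_rfl hc.le (by linarith))
        (hint c d hc.le hcd hd.le), intervalIntegral.integral_add_adjacent_intervals
        (hint 0 d le_rfl (by linarith) hd.le) (hint d 1 (by linarith) hd.le le_rfl)]
    rw [contourCauchy, ← Finset.add_sum_erase _ _ (Finset.mem_univ i), e1, hrest]
    ring
  have hlin : ∀ σ : ℝ, Tendsto (fun ε : ℝ => arc i t₀ + σ * (ε * (Complex.I * v))) (𝓝[>] 0)
      (𝓝 (arc i t₀)) := by
    intro σ
    have h1 : Continuous fun ε : ℝ => arc i t₀ + σ * (ε * (Complex.I * v)) := by fun_prop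
    have h2 := h1.tendsto 0
    simp only [Complex.ofReal_zero, zero_mul, mul_zero, add_zero] at h2
    exact h2.mono_left nhdsWithin_le_nhds
  have hrest0 := (hcont.tendsto.comp (hlin 1)).sub (hcont.tendsto.comp (hlin (-1)))
  have htot := hjump.add hrest0
  rw [sub_self, add_zero] at htot
  refine htot.congr' ?_
  filter_upwards [hoff] with ε hε
  rw [hsplit _ hε.1, hsplit _ hε.2]
  simp only [Function.comp]
  push_cast
  rw [one_mul, neg_one_mul, ← sub_eq_add_neg]
  ring

/-- Near an interior point of an arc, the Cauchy integral of `1` minus `2 π i` times the indicator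
function of `D` is constant off the contour: locally the contour has exactly two sides, and the
jumps cancel. -/
theorem IsContour.exists_eventually_eq (h : IsContour arc next D) {i : ι} {t₀ : ℝ}
    (ht₀ : t₀ ∈ Ioo (0 : ℝ) 1) :
    ∃ c, ∀ᶠ y in 𝓝 (arc i t₀), y ∉ frontier D →
      contourCauchy arc y - D.indicator (fun _ => 2 * Real.pi * Complex.I) y = c := by
  have hg := h.regular i
  obtain ⟨δ, hδ, hc, hd, hchart⟩ := hg.exists_chart ht₀
  have hleft := h.left_side i t₀ ht₀
  have hright := h.right_side i t₀ ht₀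
  have hjump := h.tendsto_contourCauchy_sub (i := i) ht₀
  have hv := hg.deriv_ne_zero t₀ (Ioo_subset_Icc_self ht₀)
  set v := derivWithin (arc i) (Icc 0 1) t₀ with hvdef
  have hv' : 0 < ‖v‖ := norm_pos_iff.2 hv
  set p := arc i t₀ with hp
  -- the part of the contour outside of a short arc about `p` keeps a distance `η` from `p`
  set R : Set ℂ := ⋃ l, arc l '' (Icc 0 1 \ {t | l = i ∧ t ∈ Ioo (t₀ - δ) (t₀ + δ)}) with hR
  have hRc : IsCompact R := by
    refine isCompact_iUnion fun l => IsCompact.image_of_continuousOn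
      (isCompact_Icc.diff (isOpen_const.and isOpen_Ioo))
      ((h.regular l).continuousOn.mono sdiff_subset)
  have hpR : p ∉ R := by
    intro hmem
    obtain ⟨l, s, hs, hsp⟩ := mem_iUnion.1 hmem
    obtain ⟨rfl, rfl⟩ := h.eq_of_arc_eq ht₀ hs.1 hsp.symm
    exact hs.2 ⟨rfl, by linarith, by linarith⟩
  obtain ⟨η, hη, hball⟩ := Metric.isOpen_iff.1 hRc.isClosed.isOpen_compl p hpR
  set ρ := min δ (η / (4 * ‖v‖)) with hρ
  have hρ0 : 0 < ρ := lt_min hδ (by positivity)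
  have hρδ : ρ ≤ δ := min_le_left _ _
  have hρη : ρ * (4 * ‖v‖) ≤ η := by
    rw [← le_div_iff₀ (by positivity)]
    exact min_le_right _ _
  -- the two sides of the short arc
  set side : Set ℝ → Set ℂ := fun J =>
    (fun x : ℝ × ℝ => arc i x.1 + x.2 * (Complex.I * v)) '' (Ioo (t₀ - ρ) (t₀ + ρ) ×ˢ J) with hside
  have hside_conn : ∀ J, IsPreconnected J → IsPreconnected (side J) := by
    intro J hJ
    refine (isPreconnected_Ioo.prod hJ).image _ ?_
    refine ContinuousOn.add (hg.continuousOn.comp continuousOn_fst fun x hx => ?_) (by fun_prop)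
    exact ⟨by linarith [hx.1.1], by linarith [hx.1.2]⟩
  have hside_disj : ∀ J, (∀ ε ∈ J, |ε| < ρ ∧ ε ≠ 0) → Disjoint (side J) (frontier D) := by
    intro J hJ
    rw [Set.disjoint_left]
    rintro _ ⟨⟨t, ε⟩, ⟨ht, hε⟩, rfl⟩ hmem
    simp only at ht hε hmem
    obtain ⟨hε1, hε0⟩ := hJ ε hε
    have htδ : t ∈ Icc (t₀ - δ) (t₀ + δ) := ⟨by linarith [ht.1], by linarith [ht.2]⟩
    rw [← h.iUnion_eq] at hmem
    obtain ⟨l, s, hs, hst⟩ := mem_iUnion.1 hmem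
    have hnear : arc i t + ε * (Complex.I * v) ∈ Metric.ball p η := by
      rw [mem_ball_iff_norm]
      have e1 := hchart t₀ ⟨by linarith, by linarith⟩ t htδ
      rw [← hp, sub_self, zero_div, sub_zero] at e1
      have e2 : ‖(arc i t - p) / v‖ ≤ 5 / 4 * |t - t₀| := by
        have := norm_add_le ((arc i t - p) / v - (t - t₀ : ℝ)) (t - t₀ : ℝ)
        rw [sub_add_cancel, Complex.norm_real, Real.norm_eq_abs] at this
        linarith
      rw [norm_div, div_le_iff₀ hv'] at e2
      have e3 : |t - t₀| ≤ ρ := abs_le.2 ⟨by linarith [ht.1], by linarith [ht.2]⟩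
      have e4 : arc i t + ε * (Complex.I * v) - p = (arc i t - p) + ε * (Complex.I * v) := by ring
      rw [e4]
      refine (norm_add_le _ _).trans_lt ?_
      rw [norm_mul, norm_mul, Complex.norm_I, one_mul, Complex.norm_real, Real.norm_eq_abs]
      have e5 : |t - t₀| * ‖v‖ ≤ ρ * ‖v‖ := by gcongr
      have e6 : |ε| * ‖v‖ ≤ ρ * ‖v‖ := by gcongr
      have e7 : 0 < ρ * ‖v‖ := by positivity
      linarith
    by_cases hsR : l = i ∧ s ∈ Ioo (t₀ - δ) (t₀ + δ)
    · obtain ⟨rfl, hsδ⟩ := hsR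
      have e1 := hchart t htδ s (Ioo_subset_Icc_self hsδ)
      rw [hst] at e1
      have e2 : (arc l t + ε * (Complex.I * v) - p) / v - (arc l t - p) / v = ε * Complex.I := by
        field_simp
        ring
      rw [e2] at e1
      have e3 := (Complex.abs_re_le_norm _).trans e1
      simp only [Complex.sub_re, Complex.mul_re, Complex.ofReal_re, Complex.I_re, mul_zero,
        Complex.ofReal_im, Complex.I_im, mul_one, sub_zero, zero_sub, abs_neg] at e3
      have e4 : s - t = 0 := abs_eq_zero.1 (le_antisymm (by linarith) (abs_nonneg _))
      rw [e4] at e1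
      simp [hε0] at e1
    · exact hball hnear (mem_iUnion.2 ⟨l, s, ⟨hs, hsR⟩, hst⟩)
  have hpos : ∀ ε ∈ Ioo (0 : ℝ) ρ, |ε| < ρ ∧ ε ≠ 0 := fun ε hε =>
    ⟨by rw [abs_of_pos hε.1]; exact hε.2, hε.1.ne'⟩
  have hneg : ∀ ε ∈ Ioo (-ρ) (0 : ℝ), |ε| < ρ ∧ ε ≠ 0 := fun ε hε =>
    ⟨by rw [abs_of_neg hε.2]; linarith [hε.1], hε.2.ne⟩
  have ht₀ρ : t₀ ∈ Ioo (t₀ - ρ) (t₀ + ρ) := ⟨by linarith, by linarith⟩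
  have hmemP : ∀ ε ∈ Ioo (0 : ℝ) ρ, p + ε * (Complex.I * v) ∈ side (Ioo 0 ρ) := fun ε hε =>
    ⟨(t₀, ε), ⟨ht₀ρ, hε⟩, rfl⟩
  have hmemN : ∀ ε ∈ Ioo (0 : ℝ) ρ, p - ε * (Complex.I * v) ∈ side (Ioo (-ρ) 0) := fun ε hε =>
    ⟨(t₀, -ε), ⟨ht₀ρ, by linarith [hε.2], by linarith [hε.1]⟩, by
      simp only [← hp]; push_cast; ring⟩
  have hsmall : ∀ᶠ ε : ℝ in 𝓝[>] 0, ε ∈ Ioo (0 : ℝ) ρ := Ioo_mem_nhdsGT hρ0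
  have hcP := hside_conn _ (isPreconnected_Ioo (a := (0 : ℝ)) (b := ρ))
  have hcN := hside_conn _ (isPreconnected_Ioo (a := -ρ) (b := (0 : ℝ)))
  have hdP := hside_disj _ hpos
  have hdN := hside_disj _ hneg
  have hPD : side (Ioo 0 ρ) ⊆ D := by
    obtain ⟨ε, hε, hεD⟩ := (hsmall.and hleft).exists
    exact (subset_of_isPreconnected_of_disjoint_frontier h.isOpen hcP hdP (hmemP ε hε)).1 hεD
  have hND : Disjoint (side (Ioo (-ρ) 0)) D := by
    obtain ⟨ε, hε, hεD⟩ := (hsmall.and hright).exists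
    exact (subset_of_isPreconnected_of_disjoint_frontier h.isOpen hcN hdN (hmemN ε hε)).2
      fun hmem => hεD (subset_closure hmem)
  have hρ2 : ρ / 2 ∈ Ioo 0 ρ := ⟨half_pos hρ0, half_lt_self hρ0⟩
  set wP := contourCauchy arc (p + ((ρ / 2 : ℝ) : ℂ) * (Complex.I * v)) with hwP
  set wN := contourCauchy arc (p - ((ρ / 2 : ℝ) : ℂ) * (Complex.I * v)) with hwN
  have hP : ∀ y ∈ side (Ioo 0 ρ), contourCauchy arc y = wP := fun y hy =>
    h.contourCauchy_eq_of_isPreconnected hcP hdP hy (hmemP _ hρ2)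
  have hN : ∀ y ∈ side (Ioo (-ρ) 0), contourCauchy arc y = wN := fun y hy =>
    h.contourCauchy_eq_of_isPreconnected hcN hdN hy (hmemN _ hρ2)
  have hdiff : wP - wN = 2 * Real.pi * Complex.I := by
    have hlim := hjump (hsmall.mono fun ε hε =>
      ⟨fun hf => hdP.le_bot ⟨hmemP ε hε, hf⟩, fun hf => hdN.le_bot ⟨hmemN ε hε, hf⟩⟩)
    refine tendsto_nhds_unique (tendsto_const_nhds.congr' ?_) hlim
    filter_upwards [hsmall] with ε hε
    rw [hP _ (hmemP ε hε), hN _ (hmemN ε hε)]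
  refine ⟨wN, ?_⟩
  have hξ : ∀ᶠ y in 𝓝 p, ‖(y - p) / v‖ < ρ / 4 := by
    have h1 : ContinuousAt (fun y : ℂ => ‖(y - p) / v‖) p := by fun_prop
    refine h1.eventually_lt_const ?_
    simp only [sub_self, zero_div, norm_zero]
    linarith
  filter_upwards [hξ] with y hy hyΓ
  -- vertical projection of `y` to the arc, by the intermediate value theorem
  set ξ := (y - p) / v with hξdef
  have hIcc : ∀ t ∈ Icc (t₀ - ρ / 2) (t₀ + ρ / 2), t ∈ Icc (t₀ - δ) (t₀ + δ) := fun t ht =>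
    ⟨by linarith [ht.1], by linarith [ht.2]⟩
  have hch0 : ∀ t ∈ Icc (t₀ - ρ / 2) (t₀ + ρ / 2),
      ‖(arc i t - p) / v - (t - t₀ : ℝ)‖ ≤ |t - t₀| / 4 := fun t ht => by
    have := hchart t₀ ⟨by linarith, by linarith⟩ t (hIcc t ht)
    rwa [← hp, sub_self, zero_div, sub_zero] at this
  have hre : ∀ t ∈ Icc (t₀ - ρ / 2) (t₀ + ρ / 2),
      |((arc i t - p) / v).re - (t - t₀)| ≤ |t - t₀| / 4 := fun t ht => by
    have := (Complex.abs_re_le_norm _).trans (hch0 t ht)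
    rwa [Complex.sub_re, Complex.ofReal_re] at this
  have hcontre : ContinuousOn (fun t => ((arc i t - p) / v).re)
      (Icc (t₀ - ρ / 2) (t₀ + ρ / 2)) := by
    refine Complex.continuous_re.comp_continuousOn (ContinuousOn.div_const
      ((hg.continuousOn.mono fun t ht => ?_).sub continuousOn_const) _)
    exact ⟨by linarith [ht.1], by linarith [ht.2]⟩
  have hab : t₀ - ρ / 2 ≤ t₀ + ρ / 2 := by linarith
  have hξre := abs_lt.1 ((Complex.abs_re_le_norm ξ).trans_lt hy)
  have hξim := abs_lt.1 ((Complex.abs_im_le_norm ξ).trans_lt hy)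
  obtain ⟨t, ht, htξ⟩ := intermediate_value_Icc hab hcontre (show ξ.re ∈ Icc _ _ from by
    constructor
    · have e1 := (abs_le.1 (hre _ (left_mem_Icc.2 hab))).2
      rw [show t₀ - ρ / 2 - t₀ = -(ρ / 2) by ring, abs_neg, abs_of_pos (half_pos hρ0)] at e1
      linarith [hξre.1]
    · have e1 := (abs_le.1 (hre _ (right_mem_Icc.2 hab))).1
      rw [show t₀ + ρ / 2 - t₀ = ρ / 2 by ring, abs_of_pos (half_pos hρ0)] at e1
      linarith [hξre.2])
  have him : |((arc i t - p) / v).im| ≤ ρ / 8 := by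
    have e1 := (Complex.abs_im_le_norm _).trans (hch0 t ht)
    rw [Complex.sub_im, Complex.ofReal_im, sub_zero] at e1
    have e2 : |t - t₀| ≤ ρ / 2 := abs_le.2 ⟨by linarith [ht.1], by linarith [ht.2]⟩
    linarith
  have him' := abs_le.1 him
  set ε := ξ.im - ((arc i t - p) / v).im with hεdef
  have hyt : y = arc i t + ε * (Complex.I * v) := by
    have e1 : ξ = (arc i t - p) / v + ε * Complex.I := by
      apply Complex.ext
      · simp only [Complex.add_re, Complex.mul_re, Complex.ofReal_re, Complex.I_re, mul_zero,
          Complex.ofReal_im, Complex.I_im, mul_one, sub_zero, add_zero]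
        exact htξ.symm
      · simp only [Complex.add_im, Complex.mul_im, Complex.ofReal_re, Complex.I_re, mul_zero,
          Complex.ofReal_im, Complex.I_im, mul_one, add_zero, hεdef]
        ring
    have e2 : y = p + ξ * v := by rw [hξdef]; field_simp; ring
    rw [e2, e1]
    field_simp
    ring
  have htρ : t ∈ Ioo (t₀ - ρ) (t₀ + ρ) := ⟨by linarith [ht.1], by linarith [ht.2]⟩
  rcases lt_trichotomy ε 0 with hε | hε | hε
  · have hmem : y ∈ side (Ioo (-ρ) 0) := ⟨(t, ε), ⟨htρ, by linarith [hξim.1, him'.2], hε⟩, hyt.symm⟩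
    rw [hN y hmem, indicator_of_notMem (disjoint_left.1 hND hmem), sub_zero]
  · refine absurd ?_ hyΓ
    rw [hyt, hε, ← h.iUnion_eq]
    simp only [Complex.ofReal_zero, zero_mul, add_zero]
    exact mem_iUnion.2 ⟨i, t, ⟨by linarith [ht.1], by linarith [ht.2]⟩, rfl⟩
  · have hmem : y ∈ side (Ioo 0 ρ) := ⟨(t, ε), ⟨htρ, hε, by linarith [hξim.2, him'.1]⟩, hyt.symm⟩
    rw [hP y hmem, indicator_of_mem (hPD hmem), ← hdiff, sub_sub_cancel]

/-- The Cauchy integral of `1` over the boundary contour of `D` is `2 π i` times the indicator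
function of `D`. Their difference is locally constant off the finite set of junctions, whose
complement is connected, and vanishes at infinity. -/
theorem IsContour.contourCauchy_eq_indicator (h : IsContour arc next D) {z : ℂ}
    (hz : z ∉ frontier D) :
    contourCauchy arc z = D.indicator (fun _ => 2 * Real.pi * Complex.I) z := by
  set J : Set ℂ := range fun i => arc i 0 with hJ
  have hJc : IsPreconnected Jᶜ := by
    refine (Set.Countable.isPathConnected_compl_of_one_lt_rank ?_
      (countable_range _)).isConnected.isPreconnected
    rw [Complex.rank_real_complex]
    exact Nat.one_lt_ofNat
  have hJsub : (frontier D)ᶜ ⊆ Jᶜ := by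
    rintro z hz ⟨i, rfl⟩
    exact hz (h.iUnion_eq ▸ mem_iUnion.2 ⟨i, 0, left_mem_Icc.2 zero_le_one, rfl⟩)
  have hloc : ∀ x ∈ Jᶜ, ∃ c, ∀ᶠ y in 𝓝 x, y ∉ frontier D →
      contourCauchy arc y - D.indicator (fun _ => 2 * Real.pi * Complex.I) y = c := by
    intro x hx
    by_cases hxΓ : x ∈ frontier D
    · rw [← h.iUnion_eq] at hxΓ
      obtain ⟨i, t, ht, rfl⟩ := mem_iUnion.1 hxΓ
      refine h.exists_eventually_eq ⟨ht.1.lt_of_ne ?_, ht.2.lt_of_ne ?_⟩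
      · rintro rfl
        exact hx ⟨i, rfl⟩
      · rintro rfl
        exact hx ⟨next i, (h.joined i).symm⟩
    · obtain ⟨r, hr, hball⟩ := Metric.isOpen_iff.1 isClosed_frontier.isOpen_compl x hxΓ
      have hpre : IsPreconnected (Metric.ball x r) := (convex_ball x r).isPreconnected
      have hdisj : Disjoint (Metric.ball x r) (frontier D) := disjoint_left.2 hball
      refine ⟨contourCauchy arc x - D.indicator (fun _ => 2 * Real.pi * Complex.I) x, ?_⟩
      filter_upwards [Metric.ball_mem_nhds x hr] with y hy _
      rw [h.contourCauchy_eq_of_isPreconnected hpre hdisj hy (Metric.mem_ball_self hr)]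
      have hD := subset_of_isPreconnected_of_disjoint_frontier h.isOpen hpre hdisj
        (Metric.mem_ball_self hr)
      by_cases hxD : x ∈ D
      · rw [indicator_of_mem hxD, indicator_of_mem (hD.1 hxD hy)]
      · rw [indicator_of_notMem hxD, indicator_of_notMem (disjoint_left.1 (hD.2 hxD) hy)]
  obtain ⟨c, hc⟩ := exists_eq_const_of_eventually hJc h.dense_compl_frontier hJsub hloc
  have hc0 : c = 0 := by
    refine tendsto_nhds_unique (tendsto_const_nhds.congr' ?_) h.tendsto_contourCauchy_cobounded
    have h1 : ∀ᶠ y in Bornology.cobounded ℂ, y ∉ closure D :=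
      Bornology.isBounded_def.1 h.isBounded.closure
    filter_upwards [h1] with y hy
    rw [← hc y fun hf => hy (frontier_subset_closure hf),
      indicator_of_notMem fun hD => hy (subset_closure hD), sub_zero]
  exact sub_eq_zero.1 ((hc z hz).trans hc0)

end

/-! ### The Plemelj–Privalov theorem for boundary contours -/

theorem holderOnWith_iff_norm_sub_le {E F : Type*} [SeminormedAddCommGroup E]
    [SeminormedAddCommGroup F] {K α : ℝ≥0} {g : E → F} {S : Set E} :
    HolderOnWith K α g S ↔ ∀ x ∈ S, ∀ y ∈ S, ‖g x - g y‖ ≤ K * ‖x - y‖ ^ (α : ℝ) := by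
  refine ⟨fun h x hx y hy => ?_, fun h x hx y hy => ?_⟩
  · simpa only [dist_eq_norm] using h.dist_le hx hy
  · rw [edist_dist, edist_dist, ENNReal.ofReal_rpow_of_nonneg dist_nonneg α.coe_nonneg,
      ← ENNReal.ofReal_coe_nnreal, ← ENNReal.ofReal_mul K.coe_nonneg, dist_eq_norm, dist_eq_norm]
    exact ENNReal.ofReal_le_ofReal (h x hx y hy)

section

variable {ι : Type*} {arc : ι → ℝ → ℂ} {next : Equiv.Perm ι} {D : Set ℂ}
variable {E : Type*} [NormedAddCommGroup E]

theorem IsContour.continuousOn_comp (h : IsContour arc next D) {f : ℂ → E}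
    (hf : ContinuousOn f (frontier D)) (i : ι) :
    ContinuousOn (fun t => f (arc i t)) (Icc 0 1) :=
  hf.comp (h.regular i).continuousOn fun _ ht =>
    h.iUnion_eq ▸ mem_iUnion.2 ⟨i, mem_image_of_mem _ ht⟩

variable [NormedSpace ℂ E]

theorem IsContour.intervalIntegrable_contourTransform (h : IsContour arc next D) {f : ℂ → E}
    (hf : ContinuousOn f (frontier D)) {z : ℂ} (hz : z ∉ frontier D) (i : ι) :
    IntervalIntegrable (fun t => ((arc i t - z)⁻¹ *
      ((2 * Real.pi * Complex.I)⁻¹ * derivWithin (arc i) (Icc 0 1) t)) • f (arc i t))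
      volume 0 1 := by
  refine ContinuousOn.intervalIntegrable ?_
  rw [uIcc_of_le zero_le_one]
  refine ContinuousOn.smul (ContinuousOn.mul (ContinuousOn.inv₀ ((h.regular i).continuousOn.sub
    continuousOn_const) fun t ht h0 => hz ?_)
    (continuousOn_const.mul (h.regular i).continuousOn_derivWithin)) (h.continuousOn_comp hf i)
  rw [← sub_eq_zero.1 h0, ← h.iUnion_eq]
  exact mem_iUnion.2 ⟨i, mem_image_of_mem _ ht⟩

variable [Fintype ι] [NormedSpace ℝ E]

/-- The Cauchy transform `(1 / 2 π i) ∫ f(s) / (s - z) ds` over a finite family of arcs. -/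
noncomputable def contourTransform (arc : ι → ℝ → ℂ) (f : ℂ → E) (z : ℂ) : E :=
  ∑ i, ∫ t in (0 : ℝ)..1, ((arc i t - z)⁻¹ *
    ((2 * Real.pi * Complex.I)⁻¹ * derivWithin (arc i) (Icc 0 1) t)) • f (arc i t)

/-- Near infinity the Cauchy transform is a Lipschitz function of `1 / z`, with value `0` at
infinity. -/
theorem IsContour.exists_lipschitz_infty (h : IsContour arc next D) {f : ℂ → E}
    (hf : ContinuousOn f (frontier D)) :
    ∃ ε > 0, (∀ z, z ≠ 0 → ‖z‖ ≤ ε → z⁻¹ ∉ closure D) ∧ ∃ K ≥ 0, ∀ z z' : ℂ, ‖z‖ ≤ ε → ‖z'‖ ≤ ε →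
      ‖(if z = 0 then 0 else contourTransform arc f z⁻¹) -
        (if z' = 0 then 0 else contourTransform arc f z'⁻¹)‖ ≤ K * ‖z - z'‖ := by
  obtain ⟨R, hR0, hR⟩ := h.isBounded.closure.subset_closedBall_lt 0 0
  have hRn : ∀ x ∈ closure D, ‖x‖ ≤ R := fun x hx => by simpa using hR hx
  choose L hL0 hL using fun i => (h.regular i).exists_norm_derivWithin_le
  choose B hB using fun i => isCompact_Icc.exists_bound_of_continuousOn (h.continuousOn_comp hf i)
  have hB0 : ∀ i, 0 ≤ B i := fun i =>
    (norm_nonneg _).trans (hB i 0 (left_mem_Icc.2 zero_le_one))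
  -- the kernel in the coordinate `1 / z`, regular at `z = 0`
  set k : ι → ℂ → ℝ → E := fun i z t => (z * (z * arc i t - 1)⁻¹ *
    ((2 * Real.pi * Complex.I)⁻¹ * derivWithin (arc i) (Icc 0 1) t)) • f (arc i t) with hk
  have hform : ∀ z : ℂ, (if z = 0 then 0 else contourTransform arc f z⁻¹) =
      ∑ i, ∫ t in (0 : ℝ)..1, k i z t := by
    intro z
    by_cases hz : z = 0
    · simp [hz, hk]
    · rw [if_neg hz, contourTransform]
      refine Finset.sum_congr rfl fun i _ => intervalIntegral.integral_congr fun t _ => ?_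
      have e1 : arc i t - z⁻¹ = z⁻¹ * (z * arc i t - 1) := by field_simp
      simp only [hk, e1, mul_inv, inv_inv]
  have harcR : ∀ i, ∀ t ∈ Icc (0 : ℝ) 1, ‖arc i t‖ ≤ R := fun i t ht =>
    hRn _ (frontier_subset_closure (h.iUnion_eq ▸ mem_iUnion.2 ⟨i, mem_image_of_mem _ ht⟩))
  have hε0 : 0 < (2 * R)⁻¹ := by positivity
  have hden : ∀ z : ℂ, ‖z‖ ≤ (2 * R)⁻¹ → ∀ i, ∀ t ∈ Icc (0 : ℝ) 1,
      1 / 2 ≤ ‖z * arc i t - 1‖ := by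
    intro z hz i t ht
    have e1 : ‖z * arc i t‖ ≤ 1 / 2 := by
      rw [norm_mul]
      calc ‖z‖ * ‖arc i t‖ ≤ (2 * R)⁻¹ * R := by gcongr; exact harcR i t ht
        _ = 1 / 2 := by field_simp
    have e2 := norm_sub_norm_le 1 (z * arc i t)
    rw [norm_one, norm_sub_rev] at e2
    linarith
  have hint : ∀ z : ℂ, ‖z‖ ≤ (2 * R)⁻¹ → ∀ i, IntervalIntegrable (k i z) volume 0 1 := by
    intro z hz i
    refine ContinuousOn.intervalIntegrable ?_
    rw [uIcc_of_le zero_le_one]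
    refine ContinuousOn.smul (ContinuousOn.mul (continuousOn_const.mul (ContinuousOn.inv₀
      ((continuousOn_const.mul (h.regular i).continuousOn).sub continuousOn_const)
      fun t ht h0 => ?_)) (continuousOn_const.mul (h.regular i).continuousOn_derivWithin))
      (h.continuousOn_comp hf i)
    have := hden z hz i t ht
    rw [h0, norm_zero] at this
    linarith
  refine ⟨(2 * R)⁻¹, hε0, fun z hz0 hz hmem => ?_,
    ∑ i, 4 * (‖(2 * Real.pi * Complex.I)⁻¹‖ * L i) * B i,
    Finset.sum_nonneg fun i _ => mul_nonneg (mul_nonneg (by norm_num)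
      (mul_nonneg (norm_nonneg _) (hL0 i))) (hB0 i), fun z z' hz hz' => ?_⟩
  · have e1 := hRn _ hmem
    rw [norm_inv] at e1
    have e2 := inv_anti₀ (norm_pos_iff.2 hz0) hz
    rw [inv_inv] at e2
    linarith
  · rw [hform, hform, ← Finset.sum_sub_distrib, Finset.sum_mul]
    refine (norm_sum_le _ _).trans (Finset.sum_le_sum fun i _ => ?_)
    rw [← intervalIntegral.integral_sub (hint z hz i) (hint z' hz' i)]
    refine (intervalIntegral.norm_integral_le_of_norm_le_const
      (C := 4 * (‖(2 * Real.pi * Complex.I)⁻¹‖ * L i) * B i * ‖z - z'‖) fun t ht => ?_).trans_eq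
      (by simp)
    rw [uIoc_of_le zero_le_one] at ht
    have ht' := Ioc_subset_Icc_self ht
    have d1 := hden z hz i t ht'
    have d2 := hden z' hz' i t ht'
    have n1 : z * arc i t - 1 ≠ 0 := norm_pos_iff.1 (by linarith)
    have n2 : z' * arc i t - 1 ≠ 0 := norm_pos_iff.1 (by linarith)
    have e1 : z * (z * arc i t - 1)⁻¹ - z' * (z' * arc i t - 1)⁻¹ =
        (z' - z) * (z * arc i t - 1)⁻¹ * (z' * arc i t - 1)⁻¹ := by
      linear_combination (-(z * (z * arc i t - 1)⁻¹)) * mul_inv_cancel₀ n2 +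
        (z' * (z' * arc i t - 1)⁻¹) * mul_inv_cancel₀ n1
    have hLi := hL0 i
    have hBi := hB0 i
    simp only [hk]
    rw [← sub_smul, ← sub_mul, e1, norm_smul, norm_mul, norm_mul, norm_mul, norm_mul, norm_inv,
      norm_inv (z' * arc i t - 1), norm_sub_rev z' z]
    have i1 : ‖z * arc i t - 1‖⁻¹ ≤ 2 := by
      rw [inv_le_comm₀ (by linarith) two_pos]; linarith
    have i2 : ‖z' * arc i t - 1‖⁻¹ ≤ 2 := by
      rw [inv_le_comm₀ (by linarith) two_pos]; linarith
    calc _ ≤ ‖z - z'‖ * 2 * 2 * (‖(2 * Real.pi * Complex.I)⁻¹‖ * L i) * B i := by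
          gcongr
          · exact hL i t ht'
          · exact hB i t ht'
      _ = _ := by ring

variable [CompleteSpace E]

/-- The Plemelj–Privalov theorem: the two boundary values of the Cauchy transform of a Hölder
continuous function exist, are Hölder continuous of the same order and split the function. -/
theorem IsContour.exists_plemelj_decomposition (h : IsContour arc next D) {α H : ℝ≥0}
    (hα0 : 0 < α) (hα1 : α < 1) {f : ℂ → E} (hf : HolderOnWith H α f (frontier D)) :
    ∃ P M : ℂ → E, (∀ z ∈ D, P z = contourTransform arc f z) ∧
      (∀ z, z ∉ closure D → M z = -contourTransform arc f z) ∧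
      (∀ s ∈ frontier D, f s = P s + M s) ∧
      (∃ K, HolderOnWith K α P (closure D)) ∧ (∃ K, HolderOnWith K α M Dᶜ) := by
  have hcl : closure D = D ∪ frontier D := (closure_eq_self_union_frontier D)
  rcases isEmpty_or_nonempty ι with hι | hι
  · -- without arcs the open and bounded set `D` has empty frontier, hence is empty
    have hfr : frontier D = ∅ := by rw [← h.iUnion_eq, iUnion_of_empty]
    have hD : D = ∅ := by
      rcases frontier_eq_empty_iff.1 hfr with hD | hD
      · exact hD
      · exact absurd (hD ▸ h.isBounded) (NormedSpace.unbounded_univ ℝ ℂ)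
    subst hD
    have h0 : ∀ z, contourTransform arc f z = 0 := fun z => by simp [contourTransform]
    refine ⟨0, 0, by simp, by simp [h0], by simp, ⟨0, ?_⟩, ⟨0, ?_⟩⟩
    · simp
    · exact holderOnWith_iff_norm_sub_le.2 fun x _ y _ => by simp
  · let _ : MeasurableSpace ι := ⊤
    have : DiscreteMeasurableSpace ι := ⟨fun _ => trivial⟩
    obtain ⟨L, C, hch⟩ := exists_regularChain_arcMeasure h.regular
    obtain ⟨κ, hκ, hdisc⟩ := exists_disc_of_isRegularArc h.regular
    rw [h.iUnion_eq] at hch hdisc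
    have hfc : ContinuousOn f (frontier D) := hf.continuousOn hα0
    have hf' := holderOnWith_iff_norm_sub_le.1 hf
    have hfm : AEStronglyMeasurable (fun x : ι × ℝ => f (arc x.1 x.2)) (arcMeasure ι) :=
      aestronglyMeasurable_arcMeasure fun i => h.continuousOn_comp hfc i
    have hα0' : (0 : ℝ) < α := by exact_mod_cast hα0
    have hα1' : (α : ℝ) < 1 := by exact_mod_cast hα1
    have hDΓ : Disjoint D (frontier D) := by
      rw [h.isOpen.frontier_eq]
      exact disjoint_sdiff_right
    have htr : ∀ z, z ∉ frontier D → chainCauchy (arcMeasure ι) (fun x => arc x.1 x.2)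
        (fun x => (2 * Real.pi * Complex.I)⁻¹ * derivWithin (arc x.1) (Icc 0 1) x.2) f z =
        contourTransform arc f z := fun z hz =>
      integral_arcMeasure (integrable_chainCauchy hch hα0' H.2 hf' hfm hz)
    have hW : ∀ z, z ∉ frontier D → ∫ x : ι × ℝ, (arc x.1 x.2 - z)⁻¹ *
        ((2 * Real.pi * Complex.I)⁻¹ * derivWithin (arc x.1) (Icc 0 1) x.2) ∂arcMeasure ι =
        D.indicator (fun _ => 1) z := fun z hz => by
      have e1 : ∑ i, ∫ t in (0 : ℝ)..1, (arc i t - z)⁻¹ *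
          ((2 * Real.pi * Complex.I)⁻¹ * derivWithin (arc i) (Icc 0 1) t) =
          (2 * Real.pi * Complex.I)⁻¹ * contourCauchy arc z := by
        rw [contourCauchy, Finset.mul_sum]
        refine Finset.sum_congr rfl fun i _ => ?_
        rw [arcCauchy, ← intervalIntegral.integral_const_mul]
        congr 1
        ext t
        ring
      rw [integral_arcMeasure (integrable_inv_mul hch hz), e1, h.contourCauchy_eq_indicator hz]
      by_cases hzD : z ∈ D
      · rw [indicator_of_mem hzD, indicator_of_mem hzD,
          inv_mul_cancel₀ Complex.two_pi_I_ne_zero]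
      · rw [indicator_of_notMem hzD, indicator_of_notMem hzD, mul_zero]
    obtain ⟨P, M, h1, h2, h3, ⟨K, hK, h4⟩, ⟨K', hK', h5⟩⟩ :=
      SliceCauchy.exists_plemelj_decomposition hch hDΓ
        (fun z hz => (hW z (disjoint_left.1 hDΓ hz)).trans (indicator_of_mem hz _))
        (fun z hz hz' => (hW z hz').trans (indicator_of_notMem hz _)) hκ
        (fun s _ r hr => hdisc s r hr) hα0' hα1' H.2 hf' hfm
    refine ⟨P, M, fun z hz => ?_, fun z hz => ?_, h3, ⟨⟨K, hK⟩, ?_⟩, ⟨⟨K', hK'⟩, ?_⟩⟩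
    · rw [h1 z hz, htr z (disjoint_left.1 hDΓ hz)]
    · rw [hcl, mem_union, not_or] at hz
      rw [h2 z hz.1 hz.2, htr z hz.2]
    · rw [hcl]
      exact holderOnWith_iff_norm_sub_le.2 h4
    · exact holderOnWith_iff_norm_sub_le.2 h5

end

/-! ### Hölder continuity at infinity -/

/-- On bounded sets Lipschitz estimates are Hölder estimates. -/
theorem le_rpow_mul_rpow {a x d : ℝ} (hx : 0 ≤ x) (hxd : x ≤ d) (ha : a ≤ 1) :
    x ≤ d ^ (1 - a) * x ^ a := by
  rcases hx.eq_or_lt with rfl | hx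
  · exact mul_nonneg (Real.rpow_nonneg hxd _) (Real.rpow_nonneg le_rfl _)
  · calc x = x ^ (1 - a) * x ^ a := by
          rw [← Real.rpow_add hx, sub_add_cancel, Real.rpow_one]
      _ ≤ _ := by
        gcongr

/-- A Hölder continuous function on `S` which near infinity is a Lipschitz function of `1 / z` is
bounded, and `z ↦ M (1 / z)` is Hölder continuous. -/
theorem exists_bound_and_holder_inv {E : Type*} [NormedAddCommGroup E] {S : Set ℂ} {M : ℂ → E}
    {α K : ℝ≥0} (hα0 : 0 < α) (hα1 : α < 1) (hM : HolderOnWith K α M S) {ε K' : ℝ} (hε : 0 < ε)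
    (hK' : 0 ≤ K')
    (hlip : ∀ z z' : ℂ, ‖z‖ ≤ ε → ‖z'‖ ≤ ε →
      ‖(if z = 0 then 0 else M z⁻¹) - (if z' = 0 then 0 else M z'⁻¹)‖ ≤ K' * ‖z - z'‖) :
    ∃ B, 0 ≤ B ∧ (∀ z ∈ S, ‖M z‖ ≤ B) ∧
      ∃ C, HolderOnWith C α (fun z => if z = 0 then 0 else M z⁻¹) {z | z = 0 ∨ z⁻¹ ∈ S} := by
  have hα0' : (0 : ℝ) < α := by exact_mod_cast hα0
  have hα1' : (α : ℝ) < 1 := by exact_mod_cast hα1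
  have hM' := holderOnWith_iff_norm_sub_le.1 hM
  have hfar : ∀ z, ε⁻¹ ≤ ‖z‖ → ‖M z‖ ≤ K' * ε := by
    intro z hz
    have hz0 : z ≠ 0 := norm_pos_iff.1 (lt_of_lt_of_le (inv_pos.2 hε) hz)
    have hzi : ‖z⁻¹‖ ≤ ε := by
      rw [norm_inv]
      exact inv_le_of_inv_le₀ hε hz
    have := hlip z⁻¹ 0 hzi (by simpa using hε.le)
    rw [if_neg (inv_ne_zero hz0), if_pos rfl, inv_inv, sub_zero, sub_zero] at this
    exact this.trans (by gcongr)
  have hbd : ∃ B, 0 ≤ B ∧ ∀ z ∈ S, ‖M z‖ ≤ B := by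
    by_cases hex : ∃ z₀ ∈ S, ‖z₀‖ < ε⁻¹
    · obtain ⟨z₀, hz₀, hz₀ε⟩ := hex
      refine ⟨K' * ε + (‖M z₀‖ + K * (2 * ε⁻¹) ^ (α : ℝ)), by positivity, fun z hz => ?_⟩
      rcases le_or_gt ε⁻¹ ‖z‖ with h | h
      · exact (hfar z h).trans (le_add_of_nonneg_right (by positivity))
      · have e1 := hM' z hz z₀ hz₀
        have e2 : ‖z - z₀‖ ≤ 2 * ε⁻¹ := by linarith [norm_sub_le z z₀]
        have e3 : K * ‖z - z₀‖ ^ (α : ℝ) ≤ K * (2 * ε⁻¹) ^ (α : ℝ) := by gcongr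
        have e4 := norm_add_le (M z₀) (M z - M z₀)
        rw [add_sub_cancel] at e4
        have e5 : 0 ≤ K' * ε := by positivity
        linarith
    · push Not at hex
      exact ⟨K' * ε, by positivity, fun z hz => hfar z (hex z hz)⟩
  obtain ⟨B, hB0, hB⟩ := hbd
  refine ⟨B, hB0, hB, ?_⟩
  have hB' : ∀ z ∈ {z | z = 0 ∨ z⁻¹ ∈ S}, ‖(if z = 0 then 0 else M z⁻¹)‖ ≤ B := by
    intro z hz
    by_cases hz0 : z = 0
    · simpa [hz0] using hB0
    · rw [if_neg hz0]
      exact hB _ (hz.resolve_left hz0)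
  set c₁ := K' * (2 * ε) ^ (1 - (α : ℝ)) with hc₁
  set c₂ := 2 * B * (2 / ε) ^ (α : ℝ) with hc₂
  set c₃ := K * (4 / ε ^ 2) ^ (α : ℝ) with hc₃
  have hc₁0 : 0 ≤ c₁ := by positivity
  have hc₂0 : 0 ≤ c₂ := by positivity
  have hc₃0 : 0 ≤ c₃ := by positivity
  refine ⟨⟨c₁ + c₂ + c₃, by positivity⟩, holderOnWith_iff_norm_sub_le.2 fun z hz z' hz' => ?_⟩
  change _ ≤ (c₁ + c₂ + c₃) * _
  have hp : 0 ≤ ‖z - z'‖ ^ (α : ℝ) := Real.rpow_nonneg (norm_nonneg _) _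
  -- `1 / z` stays near infinity, or the two points are far apart, or `1 / z` stays bounded
  by_cases hsmall : ‖z‖ ≤ ε ∧ ‖z'‖ ≤ ε
  · have e1 := le_rpow_mul_rpow (a := α) (norm_nonneg (z - z'))
      (by linarith [norm_sub_le z z'] : ‖z - z'‖ ≤ 2 * ε) hα1'.le
    refine (hlip z z' hsmall.1 hsmall.2).trans ?_
    calc K' * ‖z - z'‖ ≤ c₁ * ‖z - z'‖ ^ (α : ℝ) := by
          rw [hc₁, mul_assoc]
          gcongr
      _ ≤ _ := by gcongr; linarith
  rcases le_or_gt (ε / 2) ‖z - z'‖ with hd | hd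
  · have e1 : 1 ≤ (2 / ε) ^ (α : ℝ) * ‖z - z'‖ ^ (α : ℝ) := by
      rw [← Real.mul_rpow (by positivity) (norm_nonneg _)]
      refine Real.one_le_rpow ?_ hα0'.le
      rw [div_mul_eq_mul_div, le_div_iff₀ hε]
      linarith
    refine (norm_sub_le _ _).trans ((add_le_add (hB' z hz) (hB' z' hz')).trans ?_)
    calc B + B = 2 * B * 1 := by ring
      _ ≤ 2 * B * ((2 / ε) ^ (α : ℝ) * ‖z - z'‖ ^ (α : ℝ)) := by gcongr
      _ = c₂ * ‖z - z'‖ ^ (α : ℝ) := by rw [hc₂]; ring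
      _ ≤ _ := by gcongr; linarith
  · have hlarge : ε / 2 < ‖z‖ ∧ ε / 2 < ‖z'‖ := by
      have e1 := norm_sub_norm_le z z'
      have e2 := norm_sub_norm_le z' z
      rw [norm_sub_rev] at e2
      by_contra hcon
      refine hsmall ?_
      by_cases h1 : ε / 2 < ‖z‖
      · have h2 : ‖z'‖ ≤ ε / 2 := not_lt.1 fun h2 => hcon ⟨h1, h2⟩
        exact ⟨by linarith, by linarith⟩
      · have h2 := not_lt.1 h1
        exact ⟨by linarith, by linarith⟩
    have hz0 : z ≠ 0 := norm_pos_iff.1 (by linarith)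
    have hz0' : z' ≠ 0 := norm_pos_iff.1 (by linarith)
    rw [if_neg hz0, if_neg hz0']
    have e1 : ‖z⁻¹ - z'⁻¹‖ ≤ 4 / ε ^ 2 * ‖z - z'‖ := by
      rw [inv_sub_inv hz0 hz0', norm_div, norm_mul, norm_sub_rev, div_eq_inv_mul]
      gcongr
      rw [inv_le_comm₀ (by positivity) (by positivity), inv_div]
      calc ε ^ 2 / 4 = ε / 2 * (ε / 2) := by ring
        _ ≤ _ := by gcongr <;> linarith
    refine (hM' _ (hz.resolve_left hz0) _ (hz'.resolve_left hz0')).trans ?_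
    calc K * ‖z⁻¹ - z'⁻¹‖ ^ (α : ℝ) ≤ K * (4 / ε ^ 2 * ‖z - z'‖) ^ (α : ℝ) := by gcongr
      _ = c₃ * ‖z - z'‖ ^ (α : ℝ) := by
        rw [Real.mul_rpow (by positivity) (norm_nonneg _), hc₃]; ring
      _ ≤ _ := by gcongr; linarith

/-! ### Slices of the quaternions -/

section Slice

variable {j k : Quaternion ℝ}

theorem imagSphere_mul_self (hj : j ∈ imagSphere) : j * j = -1 := by
  have h1 : Quaternion.normSq j = 1 := by rw [Quaternion.normSq_eq_norm_mul_self, hj.2, one_mul]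
  rw [← sq, Quaternion.sq_eq_neg_normSq.2 hj.1, h1, Quaternion.coe_one]

theorem neg_mem_imagSphere (hj : j ∈ imagSphere) : -j ∈ imagSphere :=
  ⟨by simp [hj.1], by rw [norm_neg, hj.2]⟩

theorem slicePt_re (hj : j ∈ imagSphere) (z : ℂ) : (slicePt j z).re = z.re := by
  simp [slicePt, hj.1]

theorem slicePt_im (hj : j ∈ imagSphere) (z : ℂ) : (slicePt j z).im = z.im • j := by
  have h0 := hj.1
  ext <;> simp [slicePt, h0]

theorem norm_slicePt_im (hj : j ∈ imagSphere) (z : ℂ) : ‖(slicePt j z).im‖ = |z.im| := by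
  rw [slicePt_im hj, norm_smul, hj.2, mul_one, Real.norm_eq_abs]

theorem slicePt_eq_liftAux (hj : j ∈ imagSphere) (z : ℂ) :
    slicePt j z = Complex.liftAux j (imagSphere_mul_self hj) z := by
  rw [Complex.liftAux_apply]
  rfl

theorem slicePt_mul (hj : j ∈ imagSphere) (z w : ℂ) :
    slicePt j (z * w) = slicePt j z * slicePt j w := by
  simp only [slicePt_eq_liftAux hj, map_mul]

theorem slicePt_sub (j : Quaternion ℝ) (z w : ℂ) :
    slicePt j (z - w) = slicePt j z - slicePt j w := by
  simp only [slicePt, Complex.sub_re, Complex.sub_im, sub_smul, Quaternion.coe_sub]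
  abel

theorem norm_slicePt (hj : j ∈ imagSphere) (z : ℂ) : ‖slicePt j z‖ = ‖z‖ := by
  have h1 : Quaternion.normSq j = 1 := by rw [Quaternion.normSq_eq_norm_mul_self, hj.2, one_mul]
  have h2 : ‖slicePt j z‖ * ‖slicePt j z‖ = ‖z‖ * ‖z‖ := by
    rw [← Quaternion.normSq_eq_norm_mul_self, Complex.norm_mul_self_eq_normSq, Complex.normSq_apply]
    rw [Quaternion.normSq_def'] at h1 ⊢
    have h0 := hj.1
    simp only [slicePt, Quaternion.re_add, Quaternion.re_coe, Quaternion.re_smul, h0,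
      Quaternion.imI_add, Quaternion.imI_coe, Quaternion.imI_smul, Quaternion.imJ_add,
      Quaternion.imJ_coe, Quaternion.imJ_smul, Quaternion.imK_add, Quaternion.imK_coe,
      Quaternion.imK_smul, smul_eq_mul] at h1 ⊢
    linear_combination z.im ^ 2 * h1
  exact (mul_self_inj (norm_nonneg _) (norm_nonneg _)).1 h2

theorem slicePt_inv (hj : j ∈ imagSphere) (z : ℂ) : slicePt j z⁻¹ = (slicePt j z)⁻¹ := by
  simp only [slicePt_eq_liftAux hj, map_inv₀]

theorem slicePt_eq_zero_iff (hj : j ∈ imagSphere) {z : ℂ} : slicePt j z = 0 ↔ z = 0 := by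
  rw [← norm_eq_zero, norm_slicePt hj, norm_eq_zero]

theorem continuous_slicePt (j : Quaternion ℝ) : Continuous (slicePt j) := by
  unfold slicePt
  exact (Quaternion.continuous_coe.comp Complex.continuous_re).add
    (Complex.continuous_im.smul continuous_const)

theorem slicePt_neg_eq (j : Quaternion ℝ) (z : ℂ) : slicePt (-j) z = slicePt j (star z) := by
  simp [slicePt]

/-- Every quaternion lies in a slice. -/
theorem exists_eq_slicePt (hj : j ∈ imagSphere) (p : Quaternion ℝ) :
    ∃ k ∈ imagSphere, p = slicePt k ⟨p.re, ‖p.im‖⟩ := by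
  by_cases h : p.im = 0
  · refine ⟨j, hj, ?_⟩
    have := p.re_add_im
    rw [h, add_zero] at this
    simp [slicePt, h, this]
  · have h' : ‖p.im‖ ≠ 0 := norm_ne_zero_iff.2 h
    refine ⟨‖p.im‖⁻¹ • p.im, ⟨by simp, by
      rw [norm_smul, norm_inv, norm_norm, inv_mul_cancel₀ h']⟩, ?_⟩
    simp only [slicePt]
    rw [smul_smul, mul_inv_cancel₀ h', one_smul, p.re_add_im]

/-- The point of the closed upper half plane representing the sphere `[p]`. -/
noncomputable def sphereParam (p : Quaternion ℝ) : ℂ := ⟨p.re, ‖p.im‖⟩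

theorem continuous_sphereParam : Continuous sphereParam := by
  have h : sphereParam = fun p : Quaternion ℝ => (p.re : ℂ) + ‖p.im‖ * Complex.I := by
    ext p
    exact Complex.mk_eq_add_mul_I _ _
  rw [h]
  exact (Complex.continuous_ofReal.comp Quaternion.continuous_re).add
    ((Complex.continuous_ofReal.comp Quaternion.continuous_im.norm).mul continuous_const)

theorem sphereParam_slicePt (hk : k ∈ imagSphere) (z : ℂ) :
    (0 ≤ z.im ∧ sphereParam (slicePt k z) = z) ∨
      (z.im < 0 ∧ sphereParam (slicePt k z) = star z) := by
  rw [sphereParam, slicePt_re hk, norm_slicePt_im hk]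
  rcases le_or_gt 0 z.im with h | h
  · left
    exact ⟨h, by rw [abs_of_nonneg h]⟩
  · right
    refine ⟨h, ?_⟩
    rw [abs_of_neg h]
    rfl

theorem slicePt_mem_sphereOf (hj : j ∈ imagSphere) (hk : k ∈ imagSphere) (z : ℂ) :
    slicePt k z ∈ sphereOf (slicePt j z) := by
  rw [sphereOf, mem_ofPred_eq, slicePt_re hj, norm_slicePt_im hj]
  rcases le_or_gt 0 z.im with h | h
  · exact ⟨k, hk, by rw [abs_of_nonneg h]; rfl⟩
  · exact ⟨-k, neg_mem_imagSphere hk, by rw [abs_of_neg h, smul_neg, neg_smul, neg_neg]; rfl⟩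

namespace AxiallySymmetric

variable {U : Set (Quaternion ℝ)}

theorem slicePt_mem (hU : AxiallySymmetric U) (hj : j ∈ imagSphere) (hk : k ∈ imagSphere) {z : ℂ}
    (hz : slicePt j z ∈ U) : slicePt k z ∈ U :=
  hU _ hz (slicePt_mem_sphereOf hj hk z)

theorem star_mem_sliceSet (hU : AxiallySymmetric U) (hj : j ∈ imagSphere) {z : ℂ}
    (hz : z ∈ sliceSet j U) : star z ∈ sliceSet j U := by
  have := hU.slicePt_mem hj (neg_mem_imagSphere hj) hz
  rwa [slicePt_neg_eq] at this

theorem star_mem_closure_sliceSet (hU : AxiallySymmetric U) (hj : j ∈ imagSphere) {z : ℂ}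
    (hz : z ∈ closure (sliceSet j U)) : star z ∈ closure (sliceSet j U) :=
  map_mem_closure continuous_star hz fun _ hx => hU.star_mem_sliceSet hj hx

theorem slicePt_mem_closure_iff (hU : AxiallySymmetric U) (hj : j ∈ imagSphere)
    (hk : k ∈ imagSphere) {z : ℂ} : slicePt k z ∈ closure U ↔ z ∈ closure (sliceSet j U) := by
  refine ⟨fun hz => ?_, fun hz => map_mem_closure (continuous_slicePt k) hz fun x hx =>
    hU.slicePt_mem hj hk hx⟩
  have h1 : sphereParam (slicePt k z) ∈ closure (sliceSet j U) := by
    refine map_mem_closure continuous_sphereParam hz fun p hp => ?_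
    obtain ⟨l, hl, hpl⟩ := exists_eq_slicePt hj p
    rw [hpl] at hp
    exact hU.slicePt_mem hl hj hp
  rcases sphereParam_slicePt hk z with ⟨_, h⟩ | ⟨_, h⟩
  · rwa [h] at h1
  · rw [h] at h1
    simpa using hU.star_mem_closure_sliceSet hj h1

protected theorem exteriorOf (hU : AxiallySymmetric U) : AxiallySymmetric (exteriorOf U) := by
  rintro q hq p ⟨k, hk, rfl⟩ hp
  obtain ⟨l, hl, hql⟩ := exists_eq_slicePt hk q
  refine hq ?_
  rw [hql]
  exact (hU.slicePt_mem_closure_iff hk hl).2 ((hU.slicePt_mem_closure_iff hk hk).1 hp)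

theorem sliceSet_exteriorOf (hU : AxiallySymmetric U) (hj : j ∈ imagSphere) :
    sliceSet j (exteriorOf U) = (closure (sliceSet j U))ᶜ := by
  ext z
  exact not_congr (hU.slicePt_mem_closure_iff hj hj)

theorem slicePt_mem_frontier_iff (hU : AxiallySymmetric U) (hUo : IsOpen U) (hj : j ∈ imagSphere)
    {z : ℂ} : slicePt j z ∈ frontier U ↔ z ∈ frontier (sliceSet j U) := by
  have ho : IsOpen (sliceSet j U) := hUo.preimage (continuous_slicePt j)
  rw [hUo.frontier_eq, ho.frontier_eq, Set.mem_sdiff, Set.mem_sdiff, hU.slicePt_mem_closure_iff hj hj]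
  rfl

end AxiallySymmetric

end Slice

/-! ### The slice Cauchy kernel -/

/-- The two forms of the slice Cauchy kernel. -/
theorem cauchyKernel_eq {s p : Quaternion ℝ}
    (h1 : p ^ 2 - 2 * p * (s.re : Quaternion ℝ) + ((‖s‖ ^ 2 : ℝ) : Quaternion ℝ) ≠ 0)
    (h2 : s ^ 2 - 2 * s * (p.re : Quaternion ℝ) + ((‖p‖ ^ 2 : ℝ) : Quaternion ℝ) ≠ 0) :
    cauchyKernel s p = (s - star p) *
      (s ^ 2 - 2 * s * (p.re : Quaternion ℝ) + ((‖p‖ ^ 2 : ℝ) : Quaternion ℝ))⁻¹ := by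
  rw [cauchyKernel, eq_mul_inv_iff_mul_eq₀ h2, neg_mul, mul_assoc, ← mul_neg,
    inv_mul_eq_iff_eq_mul₀ h1]
  have e1 : ∀ q : Quaternion ℝ, ‖q‖ ^ 2 = q.re ^ 2 + q.imI ^ 2 + q.imJ ^ 2 + q.imK ^ 2 := fun q => by
    rw [sq, ← Quaternion.normSq_eq_norm_mul_self, Quaternion.normSq_def']
  have hn := e1 s
  have hm := e1 p
  generalize ‖s‖ ^ 2 = n at hn ⊢
  generalize ‖p‖ ^ 2 = m at hm ⊢
  rw [pow_two s, pow_two p, two_mul, two_mul]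
  ext <;> simp <;> rw [hn, hm] <;> ring

/-- The representation formula: in the slice of `k` the slice Cauchy kernel is a combination of the
complex Cauchy kernels at the two points of the slice of `j` on the sphere of `p`. -/
theorem cauchyKernel_slicePt {j k : Quaternion ℝ} (hj : j ∈ imagSphere) (hk : k ∈ imagSphere)
    {s z : ℂ} (hz : s ≠ z) (hz' : s ≠ star z) :
    cauchyKernel (slicePt j s) (slicePt k z) =
      slicePt j ((1 / 2) * ((s - z)⁻¹ + (s - star z)⁻¹)) +
        k * slicePt j ((1 / 2) * (Complex.I * ((s - star z)⁻¹ - (s - z)⁻¹))) := by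
  have hquad : ∀ {l : Quaternion ℝ} (hl : l ∈ imagSphere) (x : ℂ) (r n : ℝ),
      (slicePt l x) ^ 2 - 2 * slicePt l x * (r : Quaternion ℝ) + (n : Quaternion ℝ) =
        slicePt l (x ^ 2 - 2 * x * r + n) := by
    intro l hl x r n
    have hr : ∀ y : ℝ, (y : Quaternion ℝ) = Complex.liftAux l (imagSphere_mul_self hl) y := fun y => by
      rw [← slicePt_eq_liftAux hl]
      simp [slicePt]
    simp only [slicePt_eq_liftAux hl, hr, map_add, map_sub, map_mul, map_pow, map_ofNat]
  have hfac : ∀ x y : ℂ, x ^ 2 - 2 * x * (y.re : ℝ) + ((‖y‖ ^ 2 : ℝ) : ℂ) =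
      (x - y) * (x - star y) := by
    intro x y
    have e1 : ((‖y‖ ^ 2 : ℝ) : ℂ) = y * star y := by
      rw [Complex.star_def, Complex.mul_conj, Complex.normSq_eq_norm_sq]
    have e2 : (2 : ℂ) * (y.re : ℝ) = y + star y := by
      rw [Complex.star_def, Complex.add_conj]
      push_cast
      ring
    rw [e1]
    linear_combination (-x) * e2
  have hzs : z ≠ star s := fun h => hz' (by rw [h, star_star])
  have hn1 : s - z ≠ 0 := sub_ne_zero.2 hz
  have hn2 : s - star z ≠ 0 := sub_ne_zero.2 hz'
  have h1 := hquad hk z s.re (‖s‖ ^ 2)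
  have h2 := hquad hj s z.re (‖z‖ ^ 2)
  rw [hfac] at h1 h2
  have h1' : (slicePt k z) ^ 2 - 2 * slicePt k z * ((slicePt j s).re : Quaternion ℝ) +
      ((‖slicePt j s‖ ^ 2 : ℝ) : Quaternion ℝ) ≠ 0 := by
    rw [slicePt_re hj, norm_slicePt hj, h1, Ne, slicePt_eq_zero_iff hk]
    exact mul_ne_zero (sub_ne_zero.2 hz.symm) (sub_ne_zero.2 hzs)
  have h2' : (slicePt j s) ^ 2 - 2 * slicePt j s * ((slicePt k z).re : Quaternion ℝ) +
      ((‖slicePt k z‖ ^ 2 : ℝ) : Quaternion ℝ) ≠ 0 := by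
    rw [slicePt_re hk, norm_slicePt hk, h2, Ne, slicePt_eq_zero_iff hj]
    exact mul_ne_zero hn1 hn2
  rw [cauchyKernel_eq h1' h2', slicePt_re hk, norm_slicePt hk, h2, ← slicePt_inv hj]
  -- `s - p̄ = (s - Re p) + k v` for `p = u + k v`
  have e0 : star (slicePt k z) = (z.re : Quaternion ℝ) - z.im • k := by
    have hks : star k = -k := by
      have h0 := hk.1
      ext <;> simp [h0]
    simp only [slicePt, star_add, Quaternion.star_coe, Quaternion.star_smul, hks, smul_neg]
    abel
  have e1 : slicePt j s - star (slicePt k z) = slicePt j (s - z.re) + k * slicePt j (z.im : ℝ) := by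
    rw [e0, slicePt_sub]
    have e2 : ∀ y : ℝ, slicePt j (y : ℂ) = (y : Quaternion ℝ) := fun y => by simp [slicePt]
    rw [e2, e2, Quaternion.mul_coe_eq_smul]
    abel
  have hre : (z.re : ℂ) = (z + star z) / 2 := by
    rw [Complex.star_def, Complex.add_conj]
    push_cast
    ring
  have him : (z.im : ℂ) = -Complex.I * (z - star z) / 2 := by
    rw [Complex.star_def, Complex.sub_conj]
    push_cast
    linear_combination (z.im : ℂ) * Complex.I_sq
  have f1 : (s - z.re) * ((s - z) * (s - star z))⁻¹ =
      1 / 2 * ((s - z)⁻¹ + (s - star z)⁻¹) := by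
    rw [hre]
    field_simp
    ring
  have f2 : (z.im : ℂ) * ((s - z) * (s - star z))⁻¹ =
      1 / 2 * (Complex.I * ((s - star z)⁻¹ - (s - z)⁻¹)) := by
    rw [him]
    field_simp
    ring
  rw [e1, add_mul, mul_assoc, ← slicePt_mul hj, ← slicePt_mul hj, f1, f2]

/-! ### Slice functions -/

section SliceFunctions

theorem norm_imagSphere_smul_le {X : Type*} [NormedAddCommGroup X]
    [Module (Quaternion ℝ) X] [IsBoundedSMul (Quaternion ℝ) X] {j : Quaternion ℝ}
    (hj : j ∈ imagSphere) (x : X) : ‖j • x‖ ≤ ‖x‖ := by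
  have := norm_smul_le j x
  rwa [hj.2, one_mul] at this

variable {X : Type*} [NormedAddCommGroup X] [NormedSpace ℝ X]

/-- The even component `F₀` of the slice function induced by the function `P` on the slice. -/
noncomputable def sliceEven (P : ℂ → X) (z : ℂ) : X := (1 / 2 : ℝ) • (P z + P (star z))

theorem sliceEven_star (P : ℂ → X) (z : ℂ) : sliceEven P (star z) = sliceEven P z := by
  simp only [sliceEven, star_star, add_comm]

theorem sliceEven_congr {P Q : ℂ → X} {z : ℂ} (h : P z = Q z) (h' : P (star z) = Q (star z)) :
    sliceEven P z = sliceEven Q z := by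
  rw [sliceEven, sliceEven, h, h']

variable [Module (Quaternion ℝ) X] {j k : Quaternion ℝ}

/-- The odd component `F₁` of the slice function induced by the function `P` on the slice `ℂ_j`. -/
noncomputable def sliceOdd (j : Quaternion ℝ) (P : ℂ → X) (z : ℂ) : X :=
  (1 / 2 : ℝ) • (j • (P (star z) - P z))

/-- The slice function `F (u + k v) = F₀ (u, v) + k F₁ (u, v)` induced by the function `P` on the
slice `ℂ_j`. At real points the unit `p.im / ‖p.im‖` is the junk value `0`, which is harmless since
`F₁` vanishes there. -/
noncomputable def sliceExt (j : Quaternion ℝ) (P : ℂ → X) (p : Quaternion ℝ) : X :=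
  sliceEven P (sphereParam p) + (‖p.im‖⁻¹ • p.im) • sliceOdd j P (sphereParam p)

theorem sliceOdd_star (j : Quaternion ℝ) (P : ℂ → X) (z : ℂ) :
    sliceOdd j P (star z) = -sliceOdd j P z := by
  rw [sliceOdd, sliceOdd, star_star, ← smul_neg, ← smul_neg, neg_sub]

theorem sliceExt_slicePt (hk : k ∈ imagSphere) (P : ℂ → X) (z : ℂ) :
    sliceExt j P (slicePt k z) = sliceEven P z + k • sliceOdd j P z := by
  rw [sliceExt, norm_slicePt_im hk, slicePt_im hk]
  rcases sphereParam_slicePt hk z with ⟨h, hs⟩ | ⟨h, hs⟩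
  · rw [hs]
    rcases h.eq_or_lt with h0 | h0
    · have hz : star z = z := by
        rw [Complex.star_def, Complex.conj_eq_iff_im]
        exact h0.symm
      simp [sliceOdd, hz]
    · rw [abs_of_pos h0, smul_smul, inv_mul_cancel₀ h0.ne', one_smul]
  · rw [hs, sliceEven_star, sliceOdd_star, abs_of_neg h, smul_smul, inv_neg, neg_mul,
      inv_mul_cancel₀ h.ne, neg_smul, one_smul, neg_smul, smul_neg, neg_neg]

/-- On the slice `ℂ_j` itself the induced slice function is the given function. -/
theorem sliceEven_add_smul_sliceOdd [IsScalarTower ℝ (Quaternion ℝ) X] (hj : j ∈ imagSphere)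
    (P : ℂ → X) (z : ℂ) : sliceEven P z + j • sliceOdd j P z = P z := by
  rw [sliceEven, sliceOdd, smul_comm j, ← mul_smul, imagSphere_mul_self hj, neg_smul, one_smul,
    neg_sub, ← smul_add]
  module

theorem sliceExt_slicePt_self [IsScalarTower ℝ (Quaternion ℝ) X] (hj : j ∈ imagSphere)
    (P : ℂ → X) (z : ℂ) : sliceExt j P (slicePt j z) = P z := by
  rw [sliceExt_slicePt hj, sliceEven_add_smul_sliceOdd hj]

theorem sliceOdd_congr {P Q : ℂ → X} {z : ℂ} (h : P z = Q z) (h' : P (star z) = Q (star z)) :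
    sliceOdd j P z = sliceOdd j Q z := by
  rw [sliceOdd, sliceOdd, h, h']

variable [IsBoundedSMul (Quaternion ℝ) X]

/-- A bounded Hölder continuous function on the slice of `K` induces a Hölder slice continuous
function on `K`. -/
theorem holderSliceOn_of_slice {K : Set (Quaternion ℝ)} {S : Set ℂ} {α C : ℝ≥0}
    (hj : j ∈ imagSphere) (hK : ∀ k ∈ imagSphere, ∀ z, slicePt k z ∈ K ↔ z ∈ S)
    (hS : ∀ z ∈ S, star z ∈ S) {P : ℂ → X} (hP : HolderOnWith C α P S) {B : ℝ}
    (hB : ∀ z ∈ S, ‖P z‖ ≤ B) {F : Quaternion ℝ → X}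
    (hF : ∀ k ∈ imagSphere, ∀ z ∈ S, F (slicePt k z) = sliceEven P z + k • sliceOdd j P z) :
    HolderSliceOn α F K := by
  have hsh : shadow K = S := by
    ext z
    exact ⟨fun ⟨k, hk, hz⟩ => (hK k hk z).1 hz, fun hz => ⟨j, hj, (hK j hj z).2 hz⟩⟩
  have hP' := holderOnWith_iff_norm_sub_le.1 hP
  have hstar : ∀ x y : ℂ, ‖star x - star y‖ = ‖x - y‖ := fun x y => by
    rw [← star_sub, norm_star]
  have hhalf : ∀ x : X, ‖(1 / 2 : ℝ) • x‖ = 1 / 2 * ‖x‖ := fun x => by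
    rw [norm_smul, Real.norm_eq_abs, abs_of_pos (by norm_num)]
  refine ⟨sliceEven P, sliceOdd j P, fun z _ => ⟨sliceEven_star P z, sliceOdd_star j P z⟩,
    fun k hk z hz => hF k hk z (hsh ▸ hz), ⟨C, ?_⟩, ⟨C, ?_⟩, B + B, fun p hp => ?_⟩
  · rw [hsh, holderOnWith_iff_norm_sub_le]
    intro x hx y hy
    have h1 := hP' x hx y hy
    have h2 := hP' _ (hS x hx) _ (hS y hy)
    rw [hstar] at h2
    rw [sliceEven, sliceEven, ← smul_sub, hhalf, add_sub_add_comm]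
    linarith [norm_add_le (P x - P y) (P (star x) - P (star y))]
  · rw [hsh, holderOnWith_iff_norm_sub_le]
    intro x hx y hy
    have h1 := hP' x hx y hy
    have h2 := hP' _ (hS x hx) _ (hS y hy)
    rw [hstar] at h2
    rw [sliceOdd, sliceOdd, ← smul_sub, ← smul_sub, hhalf, sub_sub_sub_comm]
    have h3 := norm_imagSphere_smul_le hj (P (star x) - P (star y) - (P x - P y))
    linarith [norm_sub_le (P (star x) - P (star y)) (P x - P y)]
  · obtain ⟨k, hk, hpk⟩ := exists_eq_slicePt hj p
    rw [hpk] at hp ⊢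
    set z : ℂ := ⟨p.re, ‖p.im‖⟩
    have hz := (hK k hk z).1 hp
    have h1 := hB z hz
    have h2 := hB _ (hS z hz)
    rw [hF k hk z hz]
    have h3 : ‖sliceEven P z‖ ≤ B := by
      rw [sliceEven, hhalf]
      linarith [norm_add_le (P z) (P (star z))]
    have h4 : ‖sliceOdd j P z‖ ≤ B := by
      rw [sliceOdd, hhalf]
      linarith [norm_imagSphere_smul_le hj (P (star z) - P z), norm_sub_le (P (star z)) (P z)]
    exact (norm_add_le _ _).trans (add_le_add h3 ((norm_imagSphere_smul_le hk _).trans h4))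

/-- The complex Banach space structure given by identifying `ℂ` with the slice `ℂ_j`. -/
@[reducible]
noncomputable def sliceNormedSpace (X : Type*) [NormedAddCommGroup X] [Module (Quaternion ℝ) X]
    [IsBoundedSMul (Quaternion ℝ) X] (hj : j ∈ imagSphere) : NormedSpace ℂ X where
  toModule := Module.compHom X (Complex.liftAux j (imagSphere_mul_self hj)).toRingHom
  norm_smul_le z x := by
    change ‖(Complex.liftAux j (imagSphere_mul_self hj) z) • x‖ ≤ _
    rw [← slicePt_eq_liftAux hj, ← norm_slicePt hj]
    exact norm_smul_le _ _

end SliceFunctions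

/-! ### The left slice Cauchy transform -/

section Transform

variable {j k : Quaternion ℝ} {N : ℕ} {c : Fin N → ClosedPiecewiseC1Curve}

/-- All arcs of a family of closed curves. -/
def contourArc (c : Fin N → ClosedPiecewiseC1Curve) (x : Σ i : Fin N, Fin ((c i).n + 1)) :
    ℝ → ℂ :=
  (c x.1).arc x.2

/-- The permutation of the arcs of a family of closed curves which moves on to the following arc. -/
def contourNext (c : Fin N → ClosedPiecewiseC1Curve) :
    Equiv.Perm (Σ i : Fin N, Fin ((c i).n + 1)) :=
  Equiv.sigmaCongrRight fun _ => Equiv.addRight 1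

theorem iUnion_contourArc (c : Fin N → ClosedPiecewiseC1Curve) :
    ⋃ x, contourArc c x '' Icc 0 1 = ⋃ i, (c i).image := by
  rw [iUnion_sigma]
  rfl

theorem IsBoundaryContour.isContour {D : Set ℂ} (hc : IsBoundaryContour c D) (hD : IsOpen D)
    (hDb : Bornology.IsBounded D) : IsContour (contourArc c) (contourNext c) D where
  regular x := ⟨(c x.1).contDiffOn_arc x.2, (c x.1).deriv_ne_zero x.2⟩
  joined x := (c x.1).joined x.2
  simple := by
    rintro ⟨i, l⟩ ⟨i', l'⟩ s hs t ht hst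
    have hmem : ∀ (i : Fin N) l, ∀ t ∈ Ico (0 : ℝ) 1, (c i).arc l t ∈ (c i).image :=
      fun i l t ht => mem_iUnion.2 ⟨l, mem_image_of_mem _ (Ico_subset_Icc_self ht)⟩
    rcases eq_or_ne i i' with rfl | hne
    · obtain ⟨rfl, h⟩ := (c i).simple l l' s hs t ht hst
      exact ⟨rfl, h⟩
    · have h1 : (c i).arc l s = (c i').arc l' t := hst
      exact absurd (h1 ▸ hmem i' l' t ht) (disjoint_left.1 (hc.disjoint i i' hne) (hmem i l s hs))
  isOpen := hD
  isBounded := hDb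
  iUnion_eq := (iUnion_contourArc c).trans hc.image_eq
  left_side x := hc.left_side x.1 x.2
  right_side x := hc.right_side x.1 x.2

/-- The domain bounded by a contour is regular: the closure of its exterior is its complement. -/
theorem IsContour.closure_compl_closure {ι : Type*} {arc : ι → ℝ → ℂ} {next : Equiv.Perm ι}
    {D : Set ℂ} (h : IsContour arc next D) : closure (closure D)ᶜ = Dᶜ := by
  refine Subset.antisymm ?_ fun x hx => ?_
  · exact closure_minimal (compl_subset_compl.2 subset_closure) h.isOpen.isClosed_compl
  by_cases hxc : x ∈ closure D
  · have hxf : x ∈ frontier D := by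
      rw [h.isOpen.frontier_eq]
      exact ⟨hxc, hx⟩
    rw [← h.iUnion_eq] at hxf
    obtain ⟨i, hi⟩ := mem_iUnion.1 hxf
    have hIoo : arc i '' Ioo 0 1 ⊆ closure (closure D)ᶜ := by
      rintro _ ⟨t, ht, rfl⟩
      have h1 : Continuous fun ε : ℝ =>
          arc i t - ε * (Complex.I * derivWithin (arc i) (Icc 0 1) t) := by fun_prop
      have h2 := h1.tendsto 0
      simp only [Complex.ofReal_zero, zero_mul, sub_zero] at h2
      exact mem_closure_of_tendsto (h2.mono_left nhdsWithin_le_nhds) (h.right_side i t ht)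
    rw [← closure_Ioo zero_ne_one] at hi
    refine closure_minimal hIoo isClosed_closure (ContinuousOn.image_closure ?_ hi)
    rw [closure_Ioo zero_ne_one]
    exact (h.regular i).continuousOn
  · exact subset_closure hxc

variable {X : Type*} [NormedAddCommGroup X] [NormedSpace ℝ X] [Module (Quaternion ℝ) X]
  [IsScalarTower ℝ (Quaternion ℝ) X]

theorem real_smul_eq_slicePt_smul (j : Quaternion ℝ) (r : ℝ) (x : X) :
    r • x = slicePt j (r : ℂ) • x := by
  have : slicePt j (r : ℂ) = r • (1 : Quaternion ℝ) := by
    rw [← Quaternion.coe_mul_eq_smul, mul_one]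
    simp [slicePt]
  rw [this, smul_assoc, one_smul]

/-- The integrand of the slice Cauchy transform is the slice function induced by the integrand of
the complex Cauchy transform. -/
theorem cauchyKernel_smul_eq [NormedSpace ℂ X] (hsmul : ∀ (z : ℂ) (x : X), z • x = slicePt j z • x)
    (hj : j ∈ imagSphere) (hk : k ∈ imagSphere) {s z : ℂ} (hz : s ≠ z) (hz' : s ≠ star z) (w : ℂ)
    (x : X) :
    (1 / (2 * Real.pi)) • ((cauchyKernel (slicePt j s) (slicePt k z) * (-j * slicePt j w)) • x) =
      sliceEven (fun y => ((s - y)⁻¹ * ((2 * Real.pi * Complex.I)⁻¹ * w)) • x) z +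
      k • sliceOdd j (fun y => ((s - y)⁻¹ * ((2 * Real.pi * Complex.I)⁻¹ * w)) • x) z := by
  have hI : slicePt j Complex.I = j := by simp [slicePt]
  have hneg : -j * slicePt j w = slicePt j (-Complex.I * w) := by
    rw [neg_mul, neg_mul, ← hI, hI, ← neg_one_mul (Complex.I * w), slicePt_mul hj, slicePt_mul hj,
      hI]
    simp [slicePt]
  have hj' : ∀ y : X, j • y = Complex.I • y := fun y => by rw [hsmul, hI]
  have hr : ∀ (r : ℝ) (y : X), r • y = (r : ℂ) • y := fun r y => by
    rw [hsmul, ← real_smul_eq_slicePt_smul]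
  have hpi : ((2 : ℂ) * Real.pi * Complex.I)⁻¹ = ((1 / (2 * Real.pi) : ℝ) : ℂ) * -Complex.I := by
    push_cast
    rw [mul_inv, Complex.inv_I, one_div]
  rw [cauchyKernel_slicePt hj hk hz hz', hneg, add_mul, mul_assoc, ← slicePt_mul hj,
    ← slicePt_mul hj, add_smul, mul_smul k, ← hsmul, ← hsmul, smul_add, smul_comm _ k, hr, hr,
    sliceEven, sliceOdd, hj', hr, hr, hpi]
  congr 1
  · rw [smul_smul, ← add_smul, smul_smul]
    congr 1
    push_cast
    ring
  · congr 1
    rw [smul_smul, ← sub_smul, smul_smul, smul_smul]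
    congr 1
    push_cast
    ring

/-- The left slice Cauchy transform is the slice function induced by the Cauchy transform over the
contour in the slice `ℂ_j`. -/
theorem cauchyTransform_slicePt [IsBoundedSMul (Quaternion ℝ) X] [NormedSpace ℂ X]
    (hsmul : ∀ (z : ℂ) (x : X), z • x = slicePt j z • x) (hj : j ∈ imagSphere) (hk : k ∈ imagSphere)
    {D : Set ℂ} (h : IsContour (contourArc c) (contourNext c) D) {f : Quaternion ℝ → X}
    (hf : ContinuousOn (fun z => f (slicePt j z)) (frontier D)) {z : ℂ} (hz : z ∉ frontier D)
    (hz' : star z ∉ frontier D) :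
    cauchyTransform j c f (slicePt k z) =
      sliceEven (contourTransform (contourArc c) fun z => f (slicePt j z)) z +
      k • sliceOdd j (contourTransform (contourArc c) fun z => f (slicePt j z)) z := by
  have hint1 := h.intervalIntegrable_contourTransform hf hz
  have hint2 := h.intervalIntegrable_contourTransform hf hz'
  have : NormSMulClass (Quaternion ℝ) X := NormedDivisionRing.toNormSMulClass
  have hterm : ∀ x, (1 / (2 * Real.pi)) • ∫ t in (0 : ℝ)..1,
      (cauchyKernel (slicePt j (contourArc c x t)) (slicePt k z) *
        (-j * slicePt j (derivWithin (contourArc c x) (Icc 0 1) t))) •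
          f (slicePt j (contourArc c x t)) =
      sliceEven (fun y => ∫ t in (0 : ℝ)..1, ((contourArc c x t - y)⁻¹ *
        ((2 * Real.pi * Complex.I)⁻¹ * derivWithin (contourArc c x) (Icc 0 1) t)) •
          f (slicePt j (contourArc c x t))) z +
      k • sliceOdd j (fun y => ∫ t in (0 : ℝ)..1, ((contourArc c x t - y)⁻¹ *
        ((2 * Real.pi * Complex.I)⁻¹ * derivWithin (contourArc c x) (Icc 0 1) t)) •
          f (slicePt j (contourArc c x t))) z := by
    intro x
    have hoff : ∀ t ∈ Icc (0 : ℝ) 1, contourArc c x t ≠ z ∧ contourArc c x t ≠ star z := by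
      intro t ht
      have hmem : contourArc c x t ∈ frontier D :=
        h.iUnion_eq ▸ mem_iUnion.2 ⟨x, mem_image_of_mem _ ht⟩
      exact ⟨fun e => hz (e ▸ hmem), fun e => hz' (e ▸ hmem)⟩
    have e1 := (hint1 x).add (hint2 x)
    have e2 := (hint2 x).sub (hint1 x)
    rw [sliceEven, sliceOdd, ← intervalIntegral.integral_add (hint1 x) (hint2 x),
      ← intervalIntegral.integral_sub (hint2 x) (hint1 x), ← intervalIntegral.integral_smul,
      ← intervalIntegral.integral_smul, ← intervalIntegral.integral_smul,
      ← intervalIntegral.integral_smul, ← intervalIntegral.integral_smul,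
      ← intervalIntegral.integral_add]
    · refine intervalIntegral.integral_congr fun t ht => ?_
      rw [uIcc_of_le zero_le_one] at ht
      exact cauchyKernel_smul_eq hsmul hj hk (hoff t ht).1 (hoff t ht).2 _ _
    · exact e1.smul _
    · exact ((e2.smul j).smul (1 / 2 : ℝ)).smul k
  have hsum : cauchyTransform j c f (slicePt k z) = ∑ x, (1 / (2 * Real.pi)) • ∫ t in (0 : ℝ)..1,
      (cauchyKernel (slicePt j (contourArc c x t)) (slicePt k z) *
        (-j * slicePt j (derivWithin (contourArc c x) (Icc 0 1) t))) •
          f (slicePt j (contourArc c x t)) := by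
    rw [cauchyTransform, ← Finset.smul_sum, Fintype.sum_sigma]
    rfl
  rw [hsum, Finset.sum_congr rfl fun x _ => hterm x]
  simp only [sliceEven, sliceOdd, contourTransform]
  rw [Finset.sum_add_distrib, ← Finset.smul_sum, Finset.sum_add_distrib, ← Finset.smul_sum,
    ← Finset.smul_sum, ← Finset.smul_sum, Finset.sum_sub_distrib]

end Transform

/-! ### The slice Plemelj decomposition -/

section Main

variable {X : Type*} [NormedAddCommGroup X] [NormedSpace ℝ X] [CompleteSpace X]
  [Module (Quaternion ℝ) X] [IsScalarTower ℝ (Quaternion ℝ) X] [IsBoundedSMul (Quaternion ℝ) X]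

/-- Slicewise form of the decomposition: the boundary values are split in the plane `ℂ_j`, where
`X` is a complex Banach space, and both parts are then extended as slice functions. -/
theorem exists_slice_plemelj_decomposition [NormedSpace ℂ X] {U : Set (Quaternion ℝ)}
    (hUopen : IsOpen U) (hUbdd : Bornology.IsBounded U) (hUsym : AxiallySymmetric U)
    {j : Quaternion ℝ} (hj : j ∈ imagSphere)
    (hsmul : ∀ (z : ℂ) (x : X), z • x = slicePt j z • x)
    {N : ℕ} {c : Fin N → ClosedPiecewiseC1Curve} (hc : IsBoundaryContour c (sliceSet j U))
    {α : ℝ≥0} (hα0 : 0 < α) (hα1 : α < 1) {f : Quaternion ℝ → X} {H : ℝ≥0}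
    (hf : HolderOnWith H α f (frontier U ∩ slicePlane j)) :
    ∃ (fplus : Quaternion ℝ → X) (fminus : OnePoint (Quaternion ℝ) → X),
      (∀ p ∈ U, fplus p = cauchyTransform j c f p) ∧
      HolderSliceOn α fplus (closure U) ∧
      (∀ p ∈ exteriorOf U,
        fminus (p : OnePoint (Quaternion ℝ)) = -cauchyTransform j c f p) ∧
      HolderSliceOnWithInfty α fminus (closure (exteriorOf U)) ∧
      ∀ s ∈ frontier U ∩ slicePlane j,
        f s = fplus s + fminus (s : OnePoint (Quaternion ℝ)) := by
  set D := sliceSet j U with hDdef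
  have hDo : IsOpen D := hUopen.preimage (continuous_slicePt j)
  have hDb : Bornology.IsBounded D := by
    obtain ⟨R, hR⟩ := hUbdd.exists_norm_le
    exact isBounded_iff_forall_norm_le.2 ⟨R, fun z hz => norm_slicePt hj z ▸ hR _ hz⟩
  have h := hc.isContour hDo hDb
  set g : ℂ → X := fun z => f (slicePt j z) with hgdef
  have hg : HolderOnWith H α g (frontier D) := by
    rw [holderOnWith_iff_norm_sub_le] at hf ⊢
    intro x hx y hy
    have := hf _ ⟨(hUsym.slicePt_mem_frontier_iff hUopen hj).2 hx, x, rfl⟩ _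
      ⟨(hUsym.slicePt_mem_frontier_iff hUopen hj).2 hy, y, rfl⟩
    rwa [← slicePt_sub, norm_slicePt hj] at this
  have hgc : ContinuousOn g (frontier D) := hg.continuousOn hα0
  obtain ⟨P, M, hP, hM, hPM, ⟨A, hA⟩, ⟨B, hB⟩⟩ := h.exists_plemelj_decomposition hα0 hα1 hg
  obtain ⟨ε, hε, hεD, K, hK0, hK⟩ := h.exists_lipschitz_infty hgc
  -- near infinity `M` is minus the Cauchy transform, hence Lipschitz in `1 / z`
  have hMinv : ∀ z, ‖z‖ ≤ ε → (if z = 0 then 0 else M z⁻¹) =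
      -(if z = 0 then 0 else contourTransform (contourArc c) g z⁻¹) := by
    intro z hz
    split_ifs with h0
    · exact neg_zero.symm
    · exact hM _ (hεD z h0 hz)
  obtain ⟨b, -, hb, E, hE⟩ := exists_bound_and_holder_inv hα0 hα1 hB hε hK0 fun z z' hz hz' => by
    rw [hMinv z hz, hMinv z' hz', neg_sub_neg, norm_sub_rev]
    exact hK z z' hz hz'
  obtain ⟨a, ha⟩ := exists_norm_le_of_holder hDb.isCompact_closure
    (NNReal.coe_pos.2 hα0) A.coe_nonneg (holderOnWith_iff_norm_sub_le.1 hA)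
  have hint : ∀ k ∈ imagSphere, ∀ z, slicePt k z ∈ U → z ∈ D := fun k hk z hz =>
    hUsym.slicePt_mem hk hj hz
  have hext : ∀ k ∈ imagSphere, ∀ z, slicePt k z ∈ exteriorOf U → z ∉ closure D :=
    fun k hk z hz hzD => hz ((hUsym.slicePt_mem_closure_iff hj hk).2 hzD)
  have hfr : frontier D ⊆ closure D := frontier_subset_closure
  have hstar : ∀ z ∉ closure D, star z ∉ closure D := fun z hz hz' => hz <| by
    simpa using hUsym.star_mem_closure_sliceSet hj hz'
  have hstarD : ∀ z ∈ Dᶜ, star z ∈ Dᶜ := fun z hz hz' => hz <| by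
    simpa using hUsym.star_mem_sliceSet hj hz'
  have hcl : ∀ k ∈ imagSphere, ∀ z, slicePt k z ∈ closure (exteriorOf U) ↔ z ∈ Dᶜ := by
    intro k hk z
    rw [hUsym.exteriorOf.slicePt_mem_closure_iff hj hk, hUsym.sliceSet_exteriorOf hj,
      h.closure_compl_closure]
  obtain ⟨fm, hfm, hfm0⟩ : ∃ fm : OnePoint (Quaternion ℝ) → X,
      (∀ p : Quaternion ℝ, fm p = sliceExt j M p) ∧ fm OnePoint.infty = 0 :=
    ⟨fun q => q.elim 0 (sliceExt j M), fun _ => rfl, rfl⟩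
  refine ⟨sliceExt j P, fm, fun p hp => ?_, ?_, fun p hp => ?_,
    ⟨?_, ?_⟩, ?_⟩
  · obtain ⟨k, hk, hpk⟩ := exists_eq_slicePt hj p
    rw [hpk] at hp ⊢
    set z : ℂ := ⟨p.re, ‖p.im‖⟩
    have hz := hint k hk z hp
    have hz' := hUsym.star_mem_sliceSet hj hz
    have hnf : ∀ w ∈ D, w ∉ frontier D := fun w hw hwf => by
      rw [hDo.frontier_eq] at hwf
      exact hwf.2 hw
    rw [sliceExt_slicePt hk, cauchyTransform_slicePt hsmul hj hk h hgc (hnf z hz) (hnf _ hz'),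
      sliceEven_congr (hP z hz) (hP _ hz'), sliceOdd_congr (hP z hz) (hP _ hz')]
  · exact holderSliceOn_of_slice hj (fun k hk z => hUsym.slicePt_mem_closure_iff hj hk)
      (fun z hz => hUsym.star_mem_closure_sliceSet hj hz) hA ha
      fun k hk z _ => sliceExt_slicePt hk P z
  · obtain ⟨k, hk, hpk⟩ := exists_eq_slicePt hj p
    rw [hpk] at hp ⊢
    set z : ℂ := ⟨p.re, ‖p.im‖⟩
    have hz := hext k hk z hp
    have hz' := hstar z hz
    rw [hfm, sliceExt_slicePt hk,
      cauchyTransform_slicePt hsmul hj hk h hgc (fun e => hz (hfr e)) (fun e => hz' (hfr e)),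
      sliceEven, sliceOdd, sliceEven, sliceOdd, hM z hz, hM _ hz', ← neg_add, neg_sub_neg,
      ← neg_sub, smul_neg, smul_neg, smul_neg, smul_neg, neg_add]
  · exact holderSliceOn_of_slice hj hcl hstarD hB hb fun k hk z _ => by
      rw [hfm, sliceExt_slicePt hk]
  -- inversion preserves the slices, so `p ↦ fm p⁻¹` is induced by `z ↦ M z⁻¹`
  · refine holderSliceOn_of_slice (S := {z | z = 0 ∨ z⁻¹ ∈ Dᶜ}) (B := max b 0) hj
      (fun k hk z => ?_) (fun z hz => ?_) hE (fun z hz => ?_) fun k hk z hz => ?_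
    · simp only [mem_ofPred_eq]
      rw [slicePt_eq_zero_iff hk, ← slicePt_inv hk, hcl k hk]
    · rcases hz with rfl | hz
      · exact Or.inl (star_zero ℂ)
      · exact Or.inr (star_inv₀ z ▸ hstarD _ hz)
    · split_ifs with h0
      · simp
      · exact (hb _ (hz.resolve_left h0)).trans (le_max_left _ _)
    · rcases eq_or_ne z 0 with rfl | h0
      · simp [(slicePt_eq_zero_iff hk).2 rfl, hfm0, sliceEven, sliceOdd]
      · have h0' : star z ≠ 0 := star_ne_zero.2 h0
        rw [if_neg (mt (slicePt_eq_zero_iff hk).1 h0), hfm, ← slicePt_inv hk,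
          sliceExt_slicePt hk]
        simp only [sliceEven, sliceOdd, if_neg h0, if_neg h0', star_inv₀]
  · rintro _ ⟨hs, z, rfl⟩
    rw [hfm, sliceExt_slicePt_self hj, sliceExt_slicePt_self hj]
    exact hPM z ((hUsym.slicePt_mem_frontier_iff hUopen hj).1 hs)

end Main

end SliceCauchy

theorem mainTheorem2 {X : Type*} [NormedAddCommGroup X] [NormedSpace ℝ X] [CompleteSpace X]
    [Module (Quaternion ℝ) X] [IsScalarTower ℝ (Quaternion ℝ) X] [IsBoundedSMul (Quaternion ℝ) X]
    (U : Set (Quaternion ℝ)) (hUopen : IsOpen U) (hUbdd : Bornology.IsBounded U)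
    (hUsym : SliceCauchy.AxiallySymmetric U)
    (j : Quaternion ℝ) (hj : j ∈ SliceCauchy.imagSphere)
    {N : ℕ} (c : Fin N → SliceCauchy.ClosedPiecewiseC1Curve)
    (hc : SliceCauchy.IsBoundaryContour c (SliceCauchy.sliceSet j U))
    (α : ℝ≥0) (hα0 : 0 < α) (hα1 : α < 1)
    (f : Quaternion ℝ → X)
    (hf : ∃ C : ℝ≥0, HolderOnWith C α f (frontier U ∩ SliceCauchy.slicePlane j)) :
    ∃ (fplus : Quaternion ℝ → X) (fminus : OnePoint (Quaternion ℝ) → X),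
      (∀ p ∈ U, fplus p = SliceCauchy.cauchyTransform j c f p) ∧
      SliceCauchy.HolderSliceOn α fplus (closure U) ∧
      (∀ p ∈ SliceCauchy.exteriorOf U,
        fminus (p : OnePoint (Quaternion ℝ)) = -SliceCauchy.cauchyTransform j c f p) ∧
      SliceCauchy.HolderSliceOnWithInfty α fminus (closure (SliceCauchy.exteriorOf U)) ∧
      ∀ s ∈ frontier U ∩ SliceCauchy.slicePlane j,
        f s = fplus s + fminus (s : OnePoint (Quaternion ℝ)) := by
  obtain ⟨H, hH⟩ := hf
  let _ := SliceCauchy.sliceNormedSpace X hj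
  refine SliceCauchy.exists_slice_plemelj_decomposition hUopen hUbdd hUsym hj (fun z x => ?_) hc
    hα0 hα1 hH
  change Complex.liftAux j (SliceCauchy.imagSphere_mul_self hj) z • x = _
  rw [SliceCauchy.slicePt_eq_liftAux hj]
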